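/- **Hypergraphs.** A hypergraph $S$ consists of finite sets $S_k$ of $k$-dimensional faces, $k\in\omega$, only finitely many of them non-empty, and for every $a\in S_{k+1}$ a codomain $\gamma(a)\in S_k$ and a domain $\delta(a)$, which is either a non-empty subset of $S_k$ or a single formal empty face $1_u$ with $u\in S_{k-1}$; for $a\in S_1$ the domain is a single element of $S_0$. One puts $\gamma(1_u)=\delta(1_u)=u$, extends $\gamma,\delta$ to sets of faces, writes $\dot\delta(a)=\delta(a)\cap S$, $\theta(a)=\delta(a)\cup\{\gamma(a)\}$, $\dot\theta(a)=\theta(a)\cap S$, and does not distinguish elements from singletons. $S^{\varepsilon}$ is the set of faces whose domain is an empty face; $S^{\lambda}$ is the set of loops, i.e. faces with $\delta(a)=\gamma(a)$; $S^{-\lambda}$ is the set of non-loops; $\dot\delta^{-\lambda}(a)=\dot\delta(a)\cap S^{-\lambda}$; $\iota(\alpha)=\gamma\dot\delta^{-\lambda}(\alpha)\cap\delta\dot\delta^{-\lambda}(\alpha)$ is the set of internal faces of $\alpha$, and $\iota(S_{k+1})=\bigcup_{\alpha\in S_{k+1}}\iota(\alpha)$. On $S_k$, $<^+$ is the transitive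 closure of the relation "$x\in\delta(\alpha)$ and $\gamma(\alpha)=y$ for some $\alpha\in S_{k+1}^{-\lambda}$", and $<^-$ is the transitive closure of $\gamma(a)\in\delta(b)$ (the empty relation for $k=0$). For each of these relations $\perp$ denotes comparability. A morphism of hypergraphs is a family of maps $f_k:S_k\to T_k$ commuting with $\gamma$, restricting to bijections $\dot\delta(a)\to\dot\delta(f(a))$, and such that $\delta(a)=1_u$ implies $\delta(f(a))=1_{f(u)}$. **Ordered and local face structures.** An ordered face structure is a hypergraph $S$ with $S_0\neq\emptyset$ and a binary relation $<^\sim$ on each $S_k$, such that: (globularity) $\gamma\gamma(a)=\gamma\delta(a)-\delta\dot\delta^{-\lambda}(a)$ and $\delta\gamma(a)\equiv_1\delta\delta(a)-\gamma\dot\delta^{-\lambda}(a)$ for $\dim a\ge2$, where $A\equiv_1B$ means $A\cup 1_{\dot\theta(A\cap S)}=B\cup 1_{\dot\theta(B\cap S)}$; (local discreteness) two faces of the same $\delta(a)$ are not $\perp^+$; (strictness) $<^+$ is a strict order on each $S_k$, linear on $S_0$, and $<^\sim$ is a strict order on each $S_k$, $k\ge 1$; (disjointness) $a\perp^\sim b$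 excludes $a\perp^+b$, $a<^\sim b$ implies $a<^-b$, and if $\theta(a)\cap\theta(b)=\emptyset$ then $a<^\sim b$ iff $a<^-b$; (pencil linearity) distinct $a,b\in S_k$, $k\geq 1$, with $\dot\theta(a)\cap\dot\theta(b)\ne\emptyset$ satisfy $a\perp^\sim b$ or $a\perp^+b$, and for $a\in S^\varepsilon$ with $\gamma\gamma(a)\in\iota(b)$ one has $a<^\sim b$ or $a<^+b$; (loop-filling) $S^\lambda\subseteq\gamma(S^{-\lambda})$. With monotone morphisms (hypergraph morphisms preserving $<^\sim$) they form the category ${\bf oFs}$. A local face structure is a hypergraph with a binary relation on $\dot\delta(a)$ for each face $a$ of dimension $>1$; local morphisms are hypergraph morphisms inducing isomorphisms of $\dot\delta(a)$ with $\dot\delta(f(a))$, with these relations; they form the category ${\bf lFs}$. Restricting $<^\sim$ to the sets $\dot\delta(a)$ gives $|-|:{\bf oFs}\to{\bf lFs}$. **Domains and codomains.** For a convex subhypergraph $X$ of an ordered face structure $T$ (i.e. $X\ne\emptyset$ and $<^{X,+}$ is the restriction of $<^{T,+}$) let $\mathcal E^X_x$ be the set of loops $l\in X$ on $x$ that are not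 in $\gamma(X^{-\lambda})$; it is linearly ordered by $<^\sim$. The stretching $[X]$ has as faces the cuts $(x,L,U)$ of $\mathcal E^X_x$, for $x\in X$, with $\gamma(x,L,U)=(\gamma(x),-,\{l:x<^\sim l\})$, $\delta(x,L,U)=\{(t,\{l:l<^\sim x\},-):t\in\dot\delta(x)\}$ if $\dot\delta(x)\neq\emptyset$ and $\delta(x,L,U)=1_{\gamma\gamma(x,L,U)}$ otherwise, and with $<^\sim$ induced by the projection $\nu_X:[X]\to T$, $(x,L,U)\mapsto x$. Put ${\bf d}^{(k)}T=[d^{(k)}T]$ and ${\bf c}^{(k)}T=[c^{(k)}T]$, where $d^{(k)}T$ and $c^{(k)}T$ have no faces above dimension $k$; $(d^{(k)}T)_k=T_k-\gamma(T_{k+1}^{-\lambda})$ and $(d^{(k)}T)_l=T_l$ for $l<k$; $(c^{(k)}T)_k=T_k-\delta(T_{k+1}^{-\lambda})$, $(c^{(k)}T)_{k-1}=T_{k-1}-\iota(T_{k+1})$ and $(c^{(k)}T)_l=T_l$ for $l<k-1$. Their projections to $T$ are denoted ${\bf d}^{(k)}_T$ and ${\bf c}^{(k)}_T$. **Pairs.**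 Objects of ${\bf oFs}\times_k{\bf oFs}$ are pairs $(S,S')$ of ordered face structures together with an isomorphism identifying ${\bf c}^{(k)}S$ with ${\bf d}^{(k)}S'$; morphisms $(S,S')\to(T,T')$ are pairs of monotone morphisms $f:S\to T$, $f':S'\to T'$ for which there is a morphism $f'':{\bf c}^{(k)}S\to{\bf c}^{(k)}T$ with $f\circ{\bf c}^{(k)}_S={\bf c}^{(k)}_T\circ f''$ and $f'\circ{\bf d}^{(k)}_{S'}={\bf d}^{(k)}_{T'}\circ f''$. Let $\pi^0,\pi^1$ be the two projections to ${\bf oFs}$. A functor $F:{\bf oFs}\times_k{\bf oFs}\to{\bf oFs}$ with natural transformations $\kappa^0:\pi^0\to F$, $\kappa^1:\pi^1\to F$ is *locally a pushout* if for every object $(S,S')$ the square formed by ${\bf c}^{(k)}_S$, ${\bf d}^{(k)}_{S'}$, $\kappa^0:S\to F(S,S')$, $\kappa^1:S'\to F(S,S')$ becomes a pushout square in ${\bf lFs}$ under $|-|$. **The $k$-tensor.** The $k$-tensor $P=S\otimes_kS'$ of an object $(S,S')$, with its monotone morphisms $\kappa_S:S\to P$ and $\kappa_{S'}:S'\to P$,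 is the ordered face structure for which $|P|$ is the pushout of $|{\bf c}^{(k)}_S|$ and $|{\bf d}^{(k)}_{S'}|$ in ${\bf lFs}$ and whose relation $<^\sim$ is as follows (faces are identified with their images in $P$): on $P_l$ it is that of $S$ if $l<k$, and the union of those of $S$ and $S'$ if $l>k+1$; on $P_{k+1}$ it is the union of those of $S$ and $S'$ and of all pairs $(a,b)$ with $a\in S_{k+1}$, $b\in S'_{k+1}$ and $a<^-b$ in $P$; on $P_k$ it is the union of those of $S$ and $S'$ and, for $x\in\delta(S^{-\lambda}_{k+1})$ and $y\in\gamma(S'^{-\lambda}_{k+1})$, the relation $x<^\sim y$ if there is $z\in S_k\cap S'_k$ with $x\le^{+}z$ in $S$ and $z<^{\sim}y$ in $S'$, and the relation $y<^\sim x$ if $y<^-x$ in $P$ and there is $z\in S_k\cap S'_k$ with $x\le^{+}z$ in $S$ and $y<^{\sim}z$ in $S'$. **Proposition.** For every $k\in\omega$ the $k$-tensor is a functor $\otimes_k:{\bf oFs}\times_k{\bf oFs}\to{\bf oFs}$ which, with natural transformations $\kappa^0,\kappa^1$ whose components are the morphisms $\kappa_S,\kappa_{S'}$, is locally a pushout;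 and it is the unique such functor: for every functor $G:{\bf oFs}\times_k{\bf oFs}\to{\bf oFs}$ with natural transformations $\mu^0:\pi^0\to G$, $\mu^1:\pi^1\to G$ that is locally a pushout there is a unique natural isomorphism $e:\otimes_k\to G$ with $e\circ\kappa^0=\mu^0$ and $e\circ\kappa^1=\mu^1$. -/

import Mathlib

open CategoryTheory

universe u

namespace FaceStr

/-! ### Hypergraphs -/

/-- A hypergraph. For a face `a` of dimension `k + 1` its codomain is the face `γ a`; its domain is
the set of faces `δ a` together with the set of those empty faces `1_u` for which `u ∈ ε a`.
A domain is either a non-empty set of (non-empty) faces or a single empty face, and the domain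
of a `1`-dimensional face is a single face.  On empty faces the conventions
`γ (1_u) = u` and `δ (1_u) = {u}` are in force and need no data. -/
structure Hypergraph where
  face : ℕ → Type u
  finite_face : ∀ k, Finite (face k)
  bounded : ∃ n, ∀ k, n < k → IsEmpty (face k)
  γ : ∀ {k : ℕ}, face (k + 1) → face k
  δ : ∀ {k : ℕ}, face (k + 1) → Set (face k)
  ε : ∀ {k : ℕ}, face (k + 2) → Set (face k)
  δ_one : ∀ a : face 1, ∃ x, δ a = {x}
  δ_cases : ∀ {k : ℕ} (a : face (k + 2)),
    ((δ a).Nonempty ∧ ε a = ∅) ∨ (δ a = ∅ ∧ ∃ u, ε a = {u})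

/-- A morphism of hypergraphs: it commutes with codomains and restricts to a bijection between
the domain of a face and the domain of its image. -/
@[ext]
structure Hypergraph.Hom (S T : Hypergraph.{u}) where
  map : ∀ k, S.face k → T.face k
  map_γ : ∀ {k : ℕ} (a : S.face (k + 1)), map k (S.γ a) = T.γ (map (k + 1) a)
  bijOn_δ : ∀ {k : ℕ} (a : S.face (k + 1)), Set.BijOn (map k) (S.δ a) (T.δ (map (k + 1) a))
  map_ε : ∀ {k : ℕ} (a : S.face (k + 2)), T.ε (map (k + 2) a) = map k '' S.ε a

namespace Hypergraph

/-- The identity morphism. -/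
def Hom.id (S : Hypergraph.{u}) : Hom S S where
  map _ x := x
  map_γ _ := rfl
  bijOn_δ _ := Set.bijOn_id _
  map_ε _ := (Set.image_id _).symm

/-- Composition of morphisms, in diagrammatic order. -/
def Hom.comp {S T U : Hypergraph.{u}} (f : Hom S T) (g : Hom T U) : Hom S U where
  map k x := g.map k (f.map k x)
  map_γ a := by rw [f.map_γ, g.map_γ]
  bijOn_δ a := (g.bijOn_δ _).comp (f.bijOn_δ a)
  map_ε a := by rw [g.map_ε, f.map_ε, Set.image_image]

variable (S : Hypergraph.{u}) {k : ℕ}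

/-- Loops: faces whose domain is the singleton of their codomain. -/
def IsLoop (a : S.face (k + 1)) : Prop := S.δ a = {S.γ a}

/-- Non-empty codimension one faces of a face. -/
def θ (a : S.face (k + 1)) : Set (S.face k) := insert (S.γ a) (S.δ a)

/-- The domains of the two faces together with their codomains, empty faces included, have
nothing in common. -/
def ThetaDisjoint : ∀ {k : ℕ}, S.face (k + 1) → S.face (k + 1) → Prop
  | 0, a, b => Disjoint (S.θ a) (S.θ b)
  | _ + 1, a, b => Disjoint (S.θ a) (S.θ b) ∧ Disjoint (S.ε a) (S.ε b)

/-- Internal faces of `α`. -/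
def ι (α : S.face (k + 2)) : Set (S.face k) :=
  {x | ∃ a ∈ S.δ α, ∃ b ∈ S.δ α, ¬ S.IsLoop a ∧ ¬ S.IsLoop b ∧ S.γ a = x ∧ x ∈ S.δ b}

/-- The upper order `<⁺`: transitive closure of `x ∈ δ α`, `γ α = y`, for non-loops `α`. -/
def UpLt : S.face k → S.face k → Prop :=
  Relation.TransGen fun x y => ∃ α : S.face (k + 1), ¬ S.IsLoop α ∧ x ∈ S.δ α ∧ S.γ α = y

/-- One step of the relation `<⁻`. -/
def LowStep : ∀ {k : ℕ}, S.face k → S.face k → Prop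
  | 0, _, _ => False
  | _ + 1, a, b => S.γ a ∈ S.δ b

/-- The relation `<⁻`: transitive closure of `γ a ∈ δ b` (empty in dimension `0`). -/
def LowLt : S.face k → S.face k → Prop := Relation.TransGen S.LowStep

/-- The non-empty faces in `γ δ (α)`. -/
def codDom (α : S.face (k + 2)) : Set (S.face k) := S.γ '' S.δ α ∪ S.ε α

/-- The non-empty faces in `δ δ (α)`. -/
def domDom (α : S.face (k + 2)) : Set (S.face k) := (⋃ a ∈ S.δ α, S.δ a) ∪ S.ε α

/-- The non-loops in the domain of `α`. -/
def domNonloop (α : S.face (k + 1 + 1)) : Set (S.face (k + 1)) := {a ∈ S.δ α | ¬ S.IsLoop a}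

/-- `1`-equality of two sets of (possibly empty) faces of dimension `k + 1`.  Each set is given by
the set `A` (resp. `B`) of its non-empty faces and the set `A'` (resp. `B'`) of those `u` for which
it contains `1_u`.  Empty faces on codimension one faces of the non-empty members are ignored. -/
def OneEq (A : Set (S.face (k + 1))) (A' : Set (S.face k))
    (B : Set (S.face (k + 1))) (B' : Set (S.face k)) : Prop :=
  A = B ∧ A' ∪ (⋃ x ∈ A, S.θ x) = B' ∪ (⋃ x ∈ B, S.θ x)

end Hypergraph

/-! ### Local face structures -/

/-- A local face structure: a hypergraph with a binary relation on the domain of every face (of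
dimension at least `2`). -/
structure LocalFS extends Hypergraph.{u} where
  locLt : ∀ {k : ℕ}, face (k + 2) → face (k + 1) → face (k + 1) → Prop
  locLt_mem : ∀ {k : ℕ} (a : face (k + 2)) (x y : face (k + 1)),
    locLt a x y → x ∈ δ a ∧ y ∈ δ a

/-- A local morphism: a hypergraph morphism that restricts to isomorphisms between the domain of
any face and the domain of its image, with their relations. -/
@[ext]
structure LocalFS.Hom (S T : LocalFS.{u}) extends
    Hypergraph.Hom S.toHypergraph T.toHypergraph where
  locLt_iff : ∀ {k : ℕ} (a : S.face (k + 2)), ∀ x ∈ S.δ a, ∀ y ∈ S.δ a,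
    (S.locLt a x y ↔ T.locLt (map (k + 2) a) (map (k + 1) x) (map (k + 1) y))

/-- The category of local face structures. -/
instance : Category LocalFS.{u} where
  Hom := LocalFS.Hom
  id S := { Hypergraph.Hom.id S.toHypergraph with locLt_iff := fun _ _ _ _ _ => Iff.rfl }
  comp f g :=
    { f.toHom.comp g.toHom with
      locLt_iff := fun a x hx y hy =>
        (f.locLt_iff a x hx y hy).trans
          (g.locLt_iff _ _ ((f.bijOn_δ a).mapsTo hx) _ ((f.bijOn_δ a).mapsTo hy)) }

/-! ### Hypergraphs with a lower order, monotone morphisms -/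

/-- A hypergraph with a binary relation `<~` on the faces of each dimension. -/
structure OrdHypergraph extends Hypergraph.{u} where
  lt : ∀ {k : ℕ}, face k → face k → Prop

/-- A monotone morphism: a hypergraph morphism that preserves `<~`. -/
@[ext]
structure OrdHypergraph.Hom (S T : OrdHypergraph.{u}) extends
    Hypergraph.Hom S.toHypergraph T.toHypergraph where
  map_lt : ∀ {k : ℕ} (a b : S.face k), S.lt a b → T.lt (map k a) (map k b)

instance : Category OrdHypergraph.{u} where
  Hom := OrdHypergraph.Hom
  id S := { Hypergraph.Hom.id S.toHypergraph with map_lt := fun _ _ h => h }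
  comp f g :=
    { f.toHom.comp g.toHom with map_lt := fun a b h => g.map_lt _ _ (f.map_lt a b h) }

/-- The local part `|S|`: the relation `<~` is only kept within the domain of each face. -/
def OrdHypergraph.loc (S : OrdHypergraph.{u}) : LocalFS.{u} where
  toHypergraph := S.toHypergraph
  locLt a x y := x ∈ S.δ a ∧ y ∈ S.δ a ∧ S.lt x y
  locLt_mem _ _ _ h := ⟨h.1, h.2.1⟩

/-- `f` restricts to order isomorphisms between the domains of faces and of their images. -/
def OrdHypergraph.IsLocal {S T : OrdHypergraph.{u}} (f : S ⟶ T) : Prop :=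
  ∀ (k : ℕ) (a : S.face (k + 2)), ∀ x ∈ S.δ a, ∀ y ∈ S.δ a,
    (S.lt x y ↔ T.lt (f.map (k + 1) x) (f.map (k + 1) y))

/-- The local morphism `|f| : |S| ⟶ |T|` given by a monotone morphism `f`. -/
def OrdHypergraph.locMap {S T : OrdHypergraph.{u}} (f : S ⟶ T) (hf : OrdHypergraph.IsLocal f) :
    S.loc ⟶ T.loc :=
  { f.toHom with
    locLt_iff := fun a x hx y hy =>
      ⟨fun h => ⟨(f.bijOn_δ a).mapsTo h.1, (f.bijOn_δ a).mapsTo h.2.1,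
          (hf _ a x hx y hy).1 h.2.2⟩,
        fun h => ⟨hx, hy, (hf _ a x hx y hy).2 h.2.2⟩⟩ }

/-- A square of monotone morphisms whose image under `|-|` is a pushout square in the category of
local face structures. -/
def IsLocalPushout {C S T P : OrdHypergraph.{u}} (c : C ⟶ S) (d : C ⟶ T) (i : S ⟶ P)
    (j : T ⟶ P) : Prop :=
  ∃ (hc : OrdHypergraph.IsLocal c) (hd : OrdHypergraph.IsLocal d)
    (hi : OrdHypergraph.IsLocal i) (hj : OrdHypergraph.IsLocal j),
    IsPushout (OrdHypergraph.locMap c hc) (OrdHypergraph.locMap d hd)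
      (OrdHypergraph.locMap i hi) (OrdHypergraph.locMap j hj)

/-! ### Ordered face structures -/

/-- The axioms of ordered face structures. -/
structure OrdHypergraph.IsOrderedFS (S : OrdHypergraph.{u}) : Prop where
  nonempty : Nonempty (S.face 0)
  /-- Globularity for codomains: `γγ(a) = γδ(a) - δδ̇^{-λ}(a)`. -/
  glob_γ : ∀ {k : ℕ} (a : S.face (k + 2)),
    {S.γ (S.γ a)} = S.codDom a \ ⋃ x ∈ S.domNonloop a, S.δ x
  /-- Globularity for domains, in dimension `2`: `δγ(a) = δδ(a) - γδ̇^{-λ}(a)`. -/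
  glob_δ_two : ∀ a : S.face 2, S.δ (S.γ a) = S.domDom a \ S.γ '' S.domNonloop a
  /-- Globularity for domains, in dimension at least `3`: `δγ(a) ≡₁ δδ(a) - γδ̇^{-λ}(a)`. -/
  glob_δ : ∀ {k : ℕ} (a : S.face (k + 3)),
    S.OneEq (S.δ (S.γ a)) (S.ε (S.γ a))
      (S.domDom a \ S.γ '' S.domNonloop a) (⋃ x ∈ S.δ a, S.ε x)
  /-- Local discreteness. -/
  discrete : ∀ {k : ℕ} (a : S.face (k + 1)), ∀ x ∈ S.δ a, ∀ y ∈ S.δ a, ¬ S.UpLt x y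
  /-- Strictness. -/
  upLt_irrefl : ∀ {k : ℕ} (x : S.face k), ¬ S.UpLt x x
  lt_irrefl : ∀ {k : ℕ} (a : S.face (k + 1)), ¬ S.lt a a
  lt_trans : ∀ {k : ℕ} (a b c : S.face (k + 1)), S.lt a b → S.lt b c → S.lt a c
  upLt_linear : ∀ x y : S.face 0, x ≠ y → S.UpLt x y ∨ S.UpLt y x
  /-- Disjointness. -/
  disjoint : ∀ {k : ℕ} (a b : S.face (k + 1)),
    (S.lt a b ∨ S.lt b a) → ¬ (S.UpLt a b ∨ S.UpLt b a)
  lowLt_of_lt : ∀ {k : ℕ} (a b : S.face k), S.lt a b → S.LowLt a b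
  lt_iff_lowLt : ∀ {k : ℕ} (a b : S.face (k + 1)), S.ThetaDisjoint a b →
    (S.lt a b ↔ S.LowLt a b)
  /-- Pencil linearity. -/
  pencil : ∀ {k : ℕ} (a b : S.face (k + 1)), a ≠ b → (S.θ a ∩ S.θ b).Nonempty →
    (S.lt a b ∨ S.lt b a) ∨ (S.UpLt a b ∨ S.UpLt b a)
  pencil_empty : ∀ {k : ℕ} (a b : S.face (k + 2)), S.δ a = ∅ → S.γ (S.γ a) ∈ S.ι b →
    S.lt a b ∨ S.UpLt a b
  /-- Loop-filling. -/
  loop_filling : ∀ {k : ℕ} (a : S.face (k + 1)), S.IsLoop a →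
    ∃ α : S.face (k + 2), ¬ S.IsLoop α ∧ S.γ α = a

/-- Ordered face structures. -/
structure OrderedFS where
  toOrd : OrdHypergraph.{u}
  isOrderedFS : toOrd.IsOrderedFS

/-- The category of ordered face structures and monotone morphisms. -/
instance : Category OrderedFS.{u} where
  Hom S T := S.toOrd ⟶ T.toOrd
  id S := 𝟙 S.toOrd
  comp f g := CategoryStruct.comp (obj := OrdHypergraph) f g
  id_comp f := Category.id_comp (obj := OrdHypergraph) f
  comp_id f := Category.comp_id (obj := OrdHypergraph) f
  assoc f g h := Category.assoc (obj := OrdHypergraph) f g h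

/-- A monotone morphism of ordered face structures as a morphism of ordered hypergraphs. -/
abbrev OrderedFS.homToOrd {S T : OrderedFS.{u}} (f : S ⟶ T) : S.toOrd ⟶ T.toOrd := f

/-! ### Stretching of subhypergraphs -/

/-- A subhypergraph. -/
structure Hypergraph.Sub (S : Hypergraph.{u}) where
  carrier : ∀ k, Set (S.face k)
  γ_mem : ∀ {k : ℕ} (a : S.face (k + 1)), a ∈ carrier (k + 1) → S.γ a ∈ carrier k
  δ_mem : ∀ {k : ℕ} (a : S.face (k + 1)), a ∈ carrier (k + 1) → S.δ a ⊆ carrier k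
  ε_mem : ∀ {k : ℕ} (a : S.face (k + 2)), a ∈ carrier (k + 2) → S.ε a ⊆ carrier k

/-- The least subhypergraph containing a given set of faces. -/
def Hypergraph.generate (S : Hypergraph.{u}) (Z : ∀ k, Set (S.face k)) : S.Sub where
  carrier k := {x | ∀ X : S.Sub, (∀ l, Z l ⊆ X.carrier l) → x ∈ X.carrier k}
  γ_mem a ha X hX := X.γ_mem a (ha X hX)
  δ_mem a ha _ hx X hX := X.δ_mem a (ha X hX) hx
  ε_mem a ha _ hx X hX := X.ε_mem a (ha X hX) hx

/-- The set of empty loops in `X` over `x`: the loops in `X` on `x` that are not codomains of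
non-loops in `X`. -/
def emptyLoops {S : Hypergraph.{u}} (X : S.Sub) {k : ℕ} (x : S.face k) : Set (S.face (k + 1)) :=
  {a | a ∈ X.carrier (k + 1) ∧ S.IsLoop a ∧ S.γ a = x ∧
    ¬ ∃ α ∈ X.carrier (k + 2), ¬ S.IsLoop α ∧ S.γ α = a}

/-- A cut `(x, L, U)` over a face `x` of `X`.  Only `L` is recorded, `U` being its complement in
the set of empty loops over `x`.  This set is linearly ordered by `<~` when `X` is convex, so that
all of `L` is below all of `U` exactly when `L` is a lower set. -/
@[ext]
structure Cut (T : OrderedFS.{u}) (X : T.toOrd.Sub) (k : ℕ) where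
  base : T.toOrd.face k
  lower : Set (T.toOrd.face (k + 1))
  base_mem : base ∈ X.carrier k
  lower_sub : lower ⊆ emptyLoops X base
  isLower : ∀ l ∈ lower, ∀ l' ∈ emptyLoops X base, T.toOrd.lt l' l → l' ∈ lower

/-- The cut `(γ a, -, ↑a)`, where `↑a` is the set of empty loops `b` over `γ a` with `a <~ b`. -/
def Cut.above {T : OrderedFS.{u}} {X : T.toOrd.Sub} {k : ℕ} (a : T.toOrd.face (k + 1))
    (ha : a ∈ X.carrier (k + 1)) : Cut T X k where
  base := T.toOrd.γ a
  lower := {b ∈ emptyLoops X (T.toOrd.γ a) | ¬ T.toOrd.lt a b}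
  base_mem := X.γ_mem a ha
  lower_sub _ h := h.1
  isLower _ hl _ hl' h := ⟨hl', fun h' => hl.2 (T.isOrderedFS.lt_trans _ _ _ h' h)⟩

/-- The cut `(y, ↓a, -)`, where `↓a` is the set of empty loops `b` over `y` with `b <~ a`. -/
def Cut.below {T : OrderedFS.{u}} {X : T.toOrd.Sub} {k : ℕ} (a : T.toOrd.face (k + 1))
    (y : T.toOrd.face k) (hy : y ∈ X.carrier k) : Cut T X k where
  base := y
  lower := {b ∈ emptyLoops X y | T.toOrd.lt b a}
  base_mem := hy
  lower_sub _ h := h.1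
  isLower _ hl _ hl' h := ⟨hl', T.isOrderedFS.lt_trans _ _ _ h hl.2⟩

theorem Cut.finite (T : OrderedFS.{u}) (X : T.toOrd.Sub) (k : ℕ) : Finite (Cut T X k) := by
  have := T.toOrd.finite_face k
  have := T.toOrd.finite_face (k + 1)
  refine Finite.of_injective
    (fun c : Cut T X k => ((c.base, c.lower) : T.toOrd.face k × Set (T.toOrd.face (k + 1)))) ?_
  intro c d h
  exact Cut.ext (congrArg Prod.fst h) (congrArg Prod.snd h)

/-- The domain of a cut `(x, L, U)` consists of the cuts `(t, ↓x, -)` for `t ∈ δ x`. -/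
def Cut.dom {T : OrderedFS.{u}} {X : T.toOrd.Sub} {k : ℕ} (c : Cut T X (k + 1)) :
    Set (Cut T X k) :=
  {c' | ∃ ht : c'.base ∈ T.toOrd.δ c.base,
    c' = Cut.below c.base c'.base (X.δ_mem c.base c.base_mem ht)}

/-- The image of `Cut.dom` under the projection to faces. -/
theorem Cut.bijOn_dom {T : OrderedFS.{u}} {X : T.toOrd.Sub} {k : ℕ} (c : Cut T X (k + 1)) :
    Set.BijOn Cut.base c.dom (T.toOrd.δ c.base) := by
  refine ⟨fun c' h => h.1, ?_, ?_⟩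
  · rintro c₁ ⟨h₁, e₁⟩ c₂ ⟨h₂, e₂⟩ h
    refine Cut.ext h ?_
    rw [e₁, e₂]
    simp only [Cut.below, h]
  · intro t ht
    exact ⟨Cut.below c.base t (X.δ_mem c.base c.base_mem ht), ⟨ht, rfl⟩, rfl⟩

/-- The stretching `[X]` of a subhypergraph `X`: its faces are the cuts over faces of `X`. -/
def stretch (T : OrderedFS.{u}) (X : T.toOrd.Sub) : OrdHypergraph.{u} where
  face k := Cut T X k
  finite_face k := Cut.finite T X k
  bounded := by
    obtain ⟨n, hn⟩ := T.toOrd.bounded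
    exact ⟨n, fun k hk => ⟨fun c => (hn k hk).false c.base⟩⟩
  γ c := Cut.above c.base c.base_mem
  δ c := c.dom
  ε c := {c' | T.toOrd.δ c.base = ∅ ∧
    c' = Cut.above (T.toOrd.γ c.base) (X.γ_mem c.base c.base_mem)}
  δ_one c := by
    obtain ⟨x, hx⟩ := T.toOrd.δ_one c.base
    have hx' : x ∈ T.toOrd.δ c.base := by rw [hx]; rfl
    obtain ⟨d, hd, rfl⟩ := c.bijOn_dom.surjOn hx'
    refine ⟨d, Set.eq_singleton_iff_unique_mem.2 ⟨hd, fun d' hd' => ?_⟩⟩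
    refine c.bijOn_dom.injOn hd' hd ?_
    have := c.bijOn_dom.mapsTo hd'
    rw [hx] at this
    exact this
  δ_cases c := by
    rcases T.toOrd.δ_cases c.base with ⟨⟨t, ht⟩, -⟩ | ⟨h, -⟩
    · left
      obtain ⟨d, hd, -⟩ := c.bijOn_dom.surjOn ht
      refine ⟨⟨d, hd⟩, Set.eq_empty_of_forall_notMem fun c' hc' => ?_⟩
      have h := hc'.1
      rw [h] at ht
      exact ht
    · right
      refine ⟨Set.eq_empty_of_forall_notMem fun c' hc' => ?_,
        Cut.above (T.toOrd.γ c.base) (X.γ_mem c.base c.base_mem), ?_⟩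
      · have := hc'.1
        rw [h] at this
        exact this
      · ext c'
        simp [h]
  lt c c' := T.toOrd.lt c.base c'.base

/-- The projection `ν_X : [X] ⟶ T`, sending a cut over `x` to `x`. -/
def ν (T : OrderedFS.{u}) (X : T.toOrd.Sub) : stretch T X ⟶ T.toOrd where
  map _ c := Cut.base c
  map_γ _ := rfl
  bijOn_δ c := Cut.bijOn_dom c
  map_ε := by
    intro k c
    change T.toOrd.ε (Cut.base c) = Cut.base '' {c' : Cut T X k | T.toOrd.δ (Cut.base c) = ∅ ∧
      c' = Cut.above (T.toOrd.γ (Cut.base c)) (X.γ_mem _ (Cut.base_mem c))}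
    rcases T.toOrd.δ_cases (Cut.base c) with ⟨h, h'⟩ | ⟨h, u, hu⟩
    · rw [h']
      symm
      rw [Set.image_eq_empty]
      exact Set.eq_empty_of_forall_notMem fun c' hc' => h.ne_empty hc'.1
    · have hg := T.isOrderedFS.glob_γ (Cut.base c)
      simp only [Hypergraph.codDom, Hypergraph.domNonloop, h, hu] at hg
      simp only [Set.image_empty, Set.empty_union, Set.mem_empty_iff_false, false_and,
        Set.ofPred_false, Set.iUnion_of_empty, Set.iUnion_empty, Set.sdiff_empty] at hg
      rw [hu, ← hg]
      simp [h, Cut.above]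
  map_lt _ _ h := h

/-! ### Domains and codomains -/

/-- The set of faces `d⁽ᵏ⁾ T`. -/
def domFaces (k : ℕ) (S : Hypergraph.{u}) (l : ℕ) : Set (S.face l) :=
  {x | l ≤ k ∧ (l = k → ¬ ∃ α : S.face (l + 1), ¬ S.IsLoop α ∧ S.γ α = x)}

/-- The set of faces `c⁽ᵏ⁾ T`. -/
def codFaces (k : ℕ) (S : Hypergraph.{u}) (l : ℕ) : Set (S.face l) :=
  {x | l ≤ k ∧ (l = k → ¬ ∃ α : S.face (l + 1), ¬ S.IsLoop α ∧ x ∈ S.δ α) ∧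
    (l + 1 = k → ¬ ∃ α : S.face (l + 2), x ∈ S.ι α)}

/-- The `k`-th domain `𝐝⁽ᵏ⁾ T = [d⁽ᵏ⁾ T]`. -/
def kDom (k : ℕ) (T : OrderedFS.{u}) : OrdHypergraph.{u} :=
  stretch T (T.toOrd.generate (domFaces k T.toOrd.toHypergraph))

/-- The `k`-th codomain `𝐜⁽ᵏ⁾ T = [c⁽ᵏ⁾ T]`. -/
def kCod (k : ℕ) (T : OrderedFS.{u}) : OrdHypergraph.{u} :=
  stretch T (T.toOrd.generate (codFaces k T.toOrd.toHypergraph))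

/-- The canonical morphism `𝐝⁽ᵏ⁾ T ⟶ T`. -/
def kDomMap (k : ℕ) (T : OrderedFS.{u}) : kDom k T ⟶ T.toOrd := ν T _

/-- The canonical morphism `𝐜⁽ᵏ⁾ T ⟶ T`. -/
def kCodMap (k : ℕ) (T : OrderedFS.{u}) : kCod k T ⟶ T.toOrd := ν T _

/-! ### The category of `k`-composable pairs -/

/-- A pair `(S, S')` of ordered face structures with `𝐜⁽ᵏ⁾ S` and `𝐝⁽ᵏ⁾ S'` identified. -/
structure TensorPair (k : ℕ) where
  fst : OrderedFS.{u}
  snd : OrderedFS.{u}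
  glue : kCod k fst ≅ kDom k snd

namespace TensorPair

variable {k : ℕ}

/-- The canonical morphism from the common part to the first component. -/
def codMap (X : TensorPair.{u} k) : kCod k X.fst ⟶ X.fst.toOrd := kCodMap k X.fst

/-- The canonical morphism from the common part to the second component. -/
def domMap (X : TensorPair.{u} k) : kCod k X.fst ⟶ X.snd.toOrd :=
  X.glue.hom ≫ kDomMap k X.snd

/-- A pair of monotone morphisms compatible with a (necessarily unique) morphism between the
common parts. -/
@[ext]
structure Hom (X Y : TensorPair.{u} k) where
  fst : X.fst ⟶ Y.fst
  snd : X.snd ⟶ Y.snd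
  comm : ∃ g : kCod k X.fst ⟶ kCod k Y.fst,
    X.codMap ≫ OrderedFS.homToOrd fst = g ≫ Y.codMap ∧
    X.domMap ≫ OrderedFS.homToOrd snd = g ≫ Y.domMap

theorem comp_comm {X Y Z : TensorPair.{u} k} (f : Hom X Y) (g : Hom Y Z) :
    ∃ h : kCod k X.fst ⟶ kCod k Z.fst,
      X.codMap ≫ OrderedFS.homToOrd f.fst ≫ OrderedFS.homToOrd g.fst = h ≫ Z.codMap ∧
      X.domMap ≫ OrderedFS.homToOrd f.snd ≫ OrderedFS.homToOrd g.snd = h ≫ Z.domMap := by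
  obtain ⟨p, hp, hp'⟩ := f.comm
  obtain ⟨q, hq, hq'⟩ := g.comm
  refine ⟨p ≫ q, ?_, ?_⟩
  · rw [← Category.assoc, hp, Category.assoc, hq, Category.assoc]
  · rw [← Category.assoc, hp', Category.assoc, hq', Category.assoc]

instance : Category (TensorPair.{u} k) where
  Hom := Hom
  id X := ⟨𝟙 X.fst, 𝟙 X.snd, 𝟙 _,
    (Category.comp_id (obj := OrdHypergraph) _).trans (Category.id_comp _).symm,
    (Category.comp_id (obj := OrdHypergraph) _).trans (Category.id_comp _).symm⟩
  comp f g := ⟨f.fst ≫ g.fst, f.snd ≫ g.snd, comp_comm f g⟩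
  id_comp f := Hom.ext (Category.id_comp f.fst) (Category.id_comp f.snd)
  comp_id f := Hom.ext (Category.comp_id f.fst) (Category.comp_id f.snd)
  assoc f g h := Hom.ext (Category.assoc f.fst g.fst h.fst) (Category.assoc f.snd g.snd h.snd)

/-- The first projection. -/
def π₀ (k : ℕ) : TensorPair.{u} k ⥤ OrderedFS.{u} where
  obj X := X.fst
  map f := Hom.fst f

/-- The second projection. -/
def π₁ (k : ℕ) : TensorPair.{u} k ⥤ OrderedFS.{u} where
  obj X := X.snd
  map f := Hom.snd f

/-- The square on `X` with the morphisms `i : S ⟶ P` and `j : S' ⟶ P` is a pushout of local face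
structures. -/
def IsLocalPushoutSquare (X : TensorPair.{u} k) {P : OrderedFS.{u}} (i : X.fst ⟶ P)
    (j : X.snd ⟶ P) : Prop :=
  IsLocalPushout X.codMap X.domMap (OrderedFS.homToOrd i) (OrderedFS.homToOrd j)

/-- The relation `<~` of `S` transported along a monotone morphism `f : S ⟶ P`. -/
def LtImage {S P : OrderedFS.{u}} (f : S ⟶ P) {l : ℕ} (p q : P.toOrd.face l) : Prop :=
  ∃ a b : S.toOrd.face l, S.toOrd.lt a b ∧
    (OrderedFS.homToOrd f).map l a = p ∧ (OrderedFS.homToOrd f).map l b = q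

/-- The face `a` of `S` lies in `δ(S^{-λ})`, the face `b` of `S'` lies in `γ(S'^{-λ})`, and `z` is a
`k`-face of the common part of `S` and `S'` with `a ≤⁺ z` in `S`. -/
def MixedAt (X : TensorPair.{u} k) (a : X.fst.toOrd.face k) (b : X.snd.toOrd.face k)
    (z : (kCod k X.fst).face k) : Prop :=
  (∃ α : X.fst.toOrd.face (k + 1), ¬ X.fst.toOrd.IsLoop α ∧ a ∈ X.fst.toOrd.δ α) ∧
  (∃ β : X.snd.toOrd.face (k + 1), ¬ X.snd.toOrd.IsLoop β ∧ X.snd.toOrd.γ β = b) ∧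
  (a = X.codMap.map k z ∨ X.fst.toOrd.UpLt a (X.codMap.map k z))

/-- The `k`-tensor square `i : S ⟶ P`, `j : S' ⟶ P` on `X = (S, S')`: the local part of `P` is the
pushout of the local parts, and `<~` on `P` is
* that of `S` in dimensions below `k`;
* in dimension `k`, that of `S` on faces of `S`, that of `S'` on faces of `S'`, and between a face
  `a` in `δ(S^{-λ})` and a face `b` in `γ(S'^{-λ})` the relation determined by comparing `b` in `S'`
  with a common `k`-face `z` of `S` and `S'` that satisfies `a ≤⁺ z`;
* in dimension `k + 1`, that of `S`, that of `S'`, and `a <~ b` for all `a` from `S` and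
  `b` from `S'` with `a <⁻ b` in `P`;
* in dimensions above `k + 1`, the disjoint union of that of `S` and that of `S'`. -/
structure IsTensorSquare (X : TensorPair.{u} k) {P : OrderedFS.{u}} (i : X.fst ⟶ P)
    (j : X.snd ⟶ P) : Prop where
  isLocalPushoutSquare : X.IsLocalPushoutSquare i j
  lt_below : ∀ l < k, ∀ p q : P.toOrd.face l, P.toOrd.lt p q ↔ LtImage i p q
  lt_mid : ∀ p q : P.toOrd.face k, P.toOrd.lt p q ↔
    LtImage i p q ∨ LtImage j p q ∨
    (∃ a b z, X.MixedAt a b z ∧ (OrderedFS.homToOrd i).map k a = p ∧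
      (OrderedFS.homToOrd j).map k b = q ∧ X.snd.toOrd.lt (X.domMap.map k z) b) ∨
    (∃ a b z, X.MixedAt a b z ∧ (OrderedFS.homToOrd j).map k b = p ∧
      (OrderedFS.homToOrd i).map k a = q ∧ X.snd.toOrd.lt b (X.domMap.map k z) ∧
      P.toOrd.LowLt p q)
  lt_succ : ∀ p q : P.toOrd.face (k + 1), P.toOrd.lt p q ↔
    LtImage i p q ∨ LtImage j p q ∨
    (∃ a b, (OrderedFS.homToOrd i).map (k + 1) a = p ∧
      (OrderedFS.homToOrd j).map (k + 1) b = q ∧ P.toOrd.LowLt p q)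
  lt_above : ∀ l > k + 1, ∀ p q : P.toOrd.face l, P.toOrd.lt p q ↔
    LtImage i p q ∨ LtImage j p q

end TensorPair

end FaceStr

/-! The projection of the `k`-domain of `S'` to `S'` is injective, because every loop of `d⁽ᵏ⁾S'` is
already filled there. So the pushout `P` can be written down: all faces of `S`, together with the
faces of `S'` outside the common part. This adds nothing below dimension `k` and is a disjoint union
above it; in dimension `k` the maximal faces of `S` are matched with the minimal faces of `S'`. The
delicate dimension is `k - 1`, where the `k`-codomain of `S` may have several cuts over one face of
`S`. There `S' → P` need not be injective, and non-loops of `S'` of dimension `k` may become loops.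
The collapse is controlled by two facts: cuts over one face are joined by `<⁺`-chains (`cut_upLe`),
and strict relations between faces lift to cuts (`cut_reflect`).

Existence amounts to the axioms for `P`. The order `<⁺` of `P` is that of `S` below dimension `k`;
from `k` on, a chain lies in `S`, or in `S'`, or crosses once from `S` to `S'` at a common face
(`upLt_below`, `upLt_above`). In positive dimension `k`, a face `a` of `S` lies under exactly one
common face `z`, and comparing `a` with a face of `S'` means comparing `z` with it (`lt_ij`,
`lt_ji`). The axioms then follow from those of `S` and `S'` by general facts on ordered face
structures: the faces above a given one form a chain (`cmp_of_lt_lt`), `<⁺` is generated by minimal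
faces (`exists_min_head`, `exists_min_tail`), and faces with comparable codimension one faces are
comparable (`cmp_of_θ`).

For uniqueness, a second local pushout has the same underlying hypergraph. In an ordered face
structure `a <⁻ b` already makes `a` and `b` comparable, and this forces `<~` everywhere except
between a loop of `S` and a loop of `S'` of dimension `k + 1` over one common face. That case is
decided by naturality: `S'` is replaced by its `k`-domain with an arrow attached at that face
(`MinLoop.unroll`). The arrow is not a loop, so its order is forced, and a monotone map carries it
to the loop (`lt_of_loops`). -/

namespace FaceStr

/-! ### Upper and lower order of a hypergraph. -/

namespace Hypergraph

variable {S : Hypergraph.{u}} {k : ℕ}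

/-- The reflexive closure `≤⁺` of the upper order. -/
def UpLe (S : Hypergraph.{u}) {k : ℕ} (x y : S.face k) : Prop := x = y ∨ S.UpLt x y

theorem UpLe.refl (x : S.face k) : S.UpLe x x := Or.inl rfl

theorem UpLt.le {x y : S.face k} (h : S.UpLt x y) : S.UpLe x y := Or.inr h

theorem UpLt.trans {x y z : S.face k} (h : S.UpLt x y) (h' : S.UpLt y z) : S.UpLt x z :=
  Relation.TransGen.trans h h'

theorem UpLt.trans_le {x y z : S.face k} (h : S.UpLt x y) (h' : S.UpLe y z) : S.UpLt x z := by
  rcases h' with rfl | h'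
  exacts [h, h.trans h']

theorem UpLe.trans_lt {x y z : S.face k} (h : S.UpLe x y) (h' : S.UpLt y z) : S.UpLt x z := by
  rcases h with rfl | h
  exacts [h', h.trans h']

theorem UpLe.trans {x y z : S.face k} (h : S.UpLe x y) (h' : S.UpLe y z) : S.UpLe x z := by
  rcases h with rfl | h
  exacts [h', (h.trans_le h').le]

theorem upLt_of_mem {α : S.face (k + 1)} (hα : ¬ S.IsLoop α) {x : S.face k} (hx : x ∈ S.δ α) :
    S.UpLt x (S.γ α) :=
  .single ⟨α, hα, hx, rfl⟩

theorem upLe_of_mem {α : S.face (k + 1)} {x : S.face k} (hx : x ∈ S.δ α) :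
    S.UpLe x (S.γ α) := by
  by_cases hα : S.IsLoop α
  · left
    rw [IsLoop] at hα
    rw [hα] at hx
    exact hx
  · exact (upLt_of_mem hα hx).le

theorem IsLoop.eq {α : S.face (k + 1)} (hα : S.IsLoop α) {x : S.face k} (hx : x ∈ S.δ α) :
    x = S.γ α := by
  rw [IsLoop] at hα
  rw [hα] at hx
  exact hx

theorem IsLoop.mem {α : S.face (k + 1)} (hα : S.IsLoop α) : S.γ α ∈ S.δ α := by
  rw [IsLoop] at hα
  rw [hα]
  rfl

theorem UpLt.head {x y : S.face k} (h : S.UpLt x y) :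
    ∃ α : S.face (k + 1), ¬ S.IsLoop α ∧ x ∈ S.δ α ∧ S.UpLe (S.γ α) y := by
  obtain ⟨z, ⟨α, hα, hx, rfl⟩, hz⟩ := Relation.TransGen.head'_iff.1 h
  refine ⟨α, hα, hx, ?_⟩
  rcases Relation.reflTransGen_iff_eq_or_transGen.1 hz with h | h
  exacts [.inl h.symm, .inr h]

theorem UpLt.tail {x y : S.face k} (h : S.UpLt x y) :
    ∃ α : S.face (k + 1), ¬ S.IsLoop α ∧ (∃ t ∈ S.δ α, S.UpLe x t) ∧ S.γ α = y := by
  obtain ⟨z, hz, α, hα, hx, rfl⟩ := Relation.TransGen.tail'_iff.1 h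
  refine ⟨α, hα, ⟨z, hx, ?_⟩, rfl⟩
  rcases Relation.reflTransGen_iff_eq_or_transGen.1 hz with h | h
  exacts [.inl h.symm, .inr h]

/-- A chain of steps `γ a ∈ δ b` climbs through the codomains it meets; conversely the faces
witnessing a `<⁺`-chain are linked by such steps. Questions on `<⁻` thereby become questions on `<⁺`
one dimension lower. -/
theorem lowLt_iff {a b : S.face (k + 1)} : S.LowLt a b ↔ ∃ t ∈ S.δ b, S.UpLe (S.γ a) t := by
  constructor
  · intro h
    induction h with
    | single h => exact ⟨_, h, .refl _⟩
    | tail _ h ih =>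
      obtain ⟨t, ht, h'⟩ := ih
      exact ⟨_, h, h'.trans (upLe_of_mem ht)⟩
  · rintro ⟨t, ht, h | h⟩
    · exact .single (show S.γ a ∈ S.δ b from h.symm ▸ ht)
    · suffices H : ∀ x y, S.UpLt x y → ∀ a : S.face (k + 1), S.γ a = x →
          ∀ b : S.face (k + 1), y ∈ S.δ b → S.LowLt a b from H _ _ h a rfl b ht
      intro x y hxy
      induction hxy with
      | single h =>
        intro a ha b hb
        obtain ⟨α, -, hx, rfl⟩ := h
        exact .tail (.single (show S.γ a ∈ S.δ α from ha ▸ hx)) (show S.γ α ∈ S.δ b from hb)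
      | tail _ h ih =>
        intro a ha b hb
        obtain ⟨α, -, hx, rfl⟩ := h
        exact .tail (ih a ha α hx) (show S.γ α ∈ S.δ b from hb)

/-- Faces that are not codomains of non-loops. -/
def IsMin (S : Hypergraph.{u}) {k : ℕ} (x : S.face k) : Prop :=
  ¬ ∃ α : S.face (k + 1), ¬ S.IsLoop α ∧ S.γ α = x

/-- Faces that do not belong to the domain of a non-loop. -/
def IsMax (S : Hypergraph.{u}) {k : ℕ} (x : S.face k) : Prop :=
  ¬ ∃ α : S.face (k + 1), ¬ S.IsLoop α ∧ x ∈ S.δ α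

/-- Internal faces of a non-loop below `y`. -/
def IntUnder (S : Hypergraph.{u}) {k : ℕ} (x : S.face k) (y : S.face (k + 1)) : Prop :=
  ∃ α : S.face (k + 2), ¬ S.IsLoop α ∧ S.UpLe (S.γ α) y ∧ x ∈ S.ι α

theorem IsMin.not_lt {x y : S.face k} (h : S.IsMin y) : ¬ S.UpLt x y := fun h' => by
  obtain ⟨α, hα, -, e⟩ := h'.tail
  exact h ⟨α, hα, e⟩

theorem IsMax.not_lt {x y : S.face k} (h : S.IsMax x) : ¬ S.UpLt x y := fun h' => by
  obtain ⟨α, hα, hx, -⟩ := h'.head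
  exact h ⟨α, hα, hx⟩

theorem IsMin.eq_of_le {x y : S.face k} (h : S.IsMin y) (h' : S.UpLe x y) : x = y :=
  h'.resolve_right h.not_lt

theorem IsMax.eq_of_le {x y : S.face k} (h : S.IsMax x) (h' : S.UpLe x y) : x = y :=
  h'.resolve_right h.not_lt

end Hypergraph

open FaceStr.Hypergraph

/-! ### Globularity and the shape of domains. -/

namespace OrdHypergraph.IsOrderedFS

variable {S : OrdHypergraph.{u}} {k : ℕ}

theorem not_lt_of_le (h : S.IsOrderedFS) {x y : S.face k} (h₁ : S.UpLe x y) : ¬ S.UpLt y x :=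
  fun h₂ => h.upLt_irrefl x (h₁.trans_lt h₂)

theorem le_antisymm (h : S.IsOrderedFS) {x y : S.face k} (h₁ : S.UpLe x y) (h₂ : S.UpLe y x) :
    x = y :=
  h₁.resolve_right (h.not_lt_of_le h₂)

theorem wf (h : S.IsOrderedFS) (k : ℕ) : WellFounded (S.UpLt (k := k)) := by
  have := S.finite_face k
  have : IsTrans (S.face k) S.UpLt := ⟨fun _ _ _ h h' => h.trans h'⟩
  have : Std.Irrefl (S.UpLt (k := k)) := ⟨h.upLt_irrefl⟩
  exact Finite.wellFounded_of_trans_of_irrefl _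

/-- Induction on this relation supplies the hypothesis for all faces above the current one, as
needed when climbing from a domain towards a codomain. -/
theorem wf' (h : S.IsOrderedFS) (k : ℕ) :
    WellFounded (fun x y : S.face k => S.UpLt y x) := by
  have := S.finite_face k
  have : IsTrans (S.face k) (fun x y => S.UpLt y x) := ⟨fun _ _ _ h h' => h'.trans h⟩
  have : Std.Irrefl (fun x y : S.face k => S.UpLt y x) := ⟨h.upLt_irrefl⟩
  exact Finite.wellFounded_of_trans_of_irrefl _

theorem exists_max (h : S.IsOrderedFS) (x : S.face k) : ∃ y, S.UpLe x y ∧ S.IsMax y := by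
  induction x using (h.wf' k).induction with
  | _ x ih =>
    by_cases hx : S.IsMax x
    · exact ⟨x, .refl x, hx⟩
    · obtain ⟨α, hα, hx⟩ := not_not.1 hx
      obtain ⟨y, hy, hm⟩ := ih _ (upLt_of_mem hα hx)
      exact ⟨y, (upLt_of_mem hα hx).le.trans hy, hm⟩

theorem eq_or_mem (h : S.IsOrderedFS) (α : S.face (k + 2)) {v : S.face k} (hv : v ∈ S.codDom α) :
    v = S.γ (S.γ α) ∨ ∃ x ∈ S.δ α, ¬ S.IsLoop x ∧ v ∈ S.δ x := by
  by_cases hv' : v ∈ ⋃ x ∈ S.domNonloop α, S.δ x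
  · right
    simp only [Set.mem_iUnion] at hv'
    obtain ⟨x, hx, hx'⟩ := hv'
    exact ⟨x, hx.1, hx.2, hx'⟩
  · left
    have : v ∈ ({S.γ (S.γ α)} : Set _) := by
      rw [h.glob_γ]
      exact ⟨hv, hv'⟩
    exact this

theorem γ_eq_or_mem (h : S.IsOrderedFS) {α : S.face (k + 2)} {x : S.face (k + 1)}
    (hx : x ∈ S.δ α) :
    S.γ x = S.γ (S.γ α) ∨ ∃ x' ∈ S.δ α, ¬ S.IsLoop x' ∧ S.γ x ∈ S.δ x' :=
  h.eq_or_mem α (Or.inl ⟨x, hx, rfl⟩)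

theorem γγ_mem (h : S.IsOrderedFS) (α : S.face (k + 2)) : S.γ (S.γ α) ∈ S.codDom α := by
  have : S.γ (S.γ α) ∈ ({S.γ (S.γ α)} : Set _) := rfl
  rw [h.glob_γ] at this
  exact this.1

theorem γγ_not_mem (h : S.IsOrderedFS) {α : S.face (k + 2)} {x : S.face (k + 1)}
    (hx : x ∈ S.δ α) (hx' : ¬ S.IsLoop x) : S.γ (S.γ α) ∉ S.δ x := by
  have : S.γ (S.γ α) ∈ ({S.γ (S.γ α)} : Set _) := rfl
  rw [h.glob_γ] at this
  intro h'
  refine this.2 ?_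
  simp only [Set.mem_iUnion]
  exact ⟨x, ⟨hx, hx'⟩, h'⟩

theorem δγ_eq (h : S.IsOrderedFS) : ∀ {k : ℕ} (α : S.face (k + 2)),
    S.δ (S.γ α) = S.domDom α \ S.γ '' S.domNonloop α
  | 0, α => h.glob_δ_two α
  | _ + 1, α => (h.glob_δ α).1

theorem mem_δγ (h : S.IsOrderedFS) {α : S.face (k + 2)} {t : S.face k} :
    t ∈ S.δ (S.γ α) ↔ t ∈ S.domDom α ∧ ∀ x ∈ S.δ α, ¬ S.IsLoop x → S.γ x ≠ t := by
  rw [h.δγ_eq]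
  constructor
  · rintro ⟨h₁, h₂⟩
    exact ⟨h₁, fun x hx hx' e => h₂ ⟨x, ⟨hx, hx'⟩, e⟩⟩
  · rintro ⟨h₁, h₂⟩
    refine ⟨h₁, ?_⟩
    rintro ⟨x, ⟨hx, hx'⟩, e⟩
    exact h₂ x hx hx' e

theorem mem_domDom {S : OrdHypergraph.{u}} {α : S.face (k + 2)} {x : S.face (k + 1)}
    (hx : x ∈ S.δ α) {t : S.face k} (ht : t ∈ S.δ x) : t ∈ S.domDom α := by
  left
  simp only [Set.mem_iUnion]
  exact ⟨x, hx, ht⟩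

theorem domDom_cases {S : OrdHypergraph.{u}} {α : S.face (k + 2)} {x : S.face (k + 1)}
    (hx : x ∈ S.δ α) {t : S.face k} (ht : t ∈ S.domDom α) : ∃ y ∈ S.δ α, t ∈ S.δ y := by
  rcases ht with ht | ht
  · simp only [Set.mem_iUnion] at ht
    obtain ⟨y, hy, ht⟩ := ht
    exact ⟨y, hy, ht⟩
  · rcases S.δ_cases α with ⟨-, h'⟩ | ⟨h', -⟩
    · rw [h'] at ht
      exact ht.elim
    · rw [h'] at hx
      exact hx.elim

/-- Nothing is subtracted in the two globularity equations, and `codDom α` and `domDom α` both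
reduce to `ε α`. -/
theorem loop_of_empty (h : S.IsOrderedFS) {α : S.face (k + 2)} (hα : S.δ α = ∅) :
    S.IsLoop (S.γ α) ∧ S.ε α = {S.γ (S.γ α)} := by
  have hγ : S.codDom α = S.ε α := by simp [codDom, hα]
  have hn : S.domNonloop α = ∅ := by simp [domNonloop, hα]
  have h₁ := h.glob_γ α
  rw [hγ, hn] at h₁
  simp only [Set.mem_empty_iff_false, Set.iUnion_of_empty, Set.iUnion_empty, Set.sdiff_empty] at h₁
  refine ⟨?_, h₁.symm⟩
  have h₂ := h.δγ_eq α
  rw [hn] at h₂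
  simp only [Set.image_empty, Set.sdiff_empty] at h₂
  rw [IsLoop, h₂, h₁]
  simp [domDom, hα]

/-- Unless it is already `γγ(α)`, the codomain of a face of `δ α` lies in the domain of a non-loop
of `δ α`, whose codomain is strictly higher; finiteness stops the climb. -/
theorem γ_le (h : S.IsOrderedFS) {α : S.face (k + 2)} {x : S.face (k + 1)} (hx : x ∈ S.δ α) :
    S.UpLe (S.γ x) (S.γ (S.γ α)) := by
  suffices H : ∀ v, ∀ x ∈ S.δ α, S.γ x = v → S.UpLe v (S.γ (S.γ α)) from H _ x hx rfl
  intro v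
  induction v using (h.wf' k).induction with
  | _ v ih =>
    rintro x hx rfl
    rcases h.γ_eq_or_mem hx with e | ⟨x', hx', hl, hm⟩
    · exact .inl e
    · exact (upLt_of_mem hl hm).le.trans (ih _ (upLt_of_mem hl hm) x' hx' rfl)

theorem γ_mono (h : S.IsOrderedFS) {x y : S.face (k + 1)} (hxy : S.UpLt x y) :
    S.UpLe (S.γ x) (S.γ y) := by
  induction hxy with
  | single h' =>
    obtain ⟨α, -, hx, rfl⟩ := h'
    exact h.γ_le hx
  | tail _ h' ih =>
    obtain ⟨α, -, hx, rfl⟩ := h'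
    exact ih.trans (h.γ_le hx)

theorem γ_mono' (h : S.IsOrderedFS) {x y : S.face (k + 1)} (hxy : S.UpLe x y) :
    S.UpLe (S.γ x) (S.γ y) := by
  rcases hxy with rfl | hxy
  exacts [.refl _, h.γ_mono hxy]

/-- Comparability in the upper order, or equality. -/
def _root_.FaceStr.Hypergraph.UpCmp (S : Hypergraph.{u}) {k : ℕ} (x y : S.face k) : Prop :=
  x = y ∨ S.UpLt x y ∨ S.UpLt y x

theorem δ_unique (h : S.IsOrderedFS) {α : S.face (k + 1)} {x y : S.face k} (hx : x ∈ S.δ α)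
    (hy : y ∈ S.δ α) (hxy : S.UpCmp x y) : x = y := by
  rcases hxy with hxy | hxy | hxy
  exacts [hxy, (h.discrete α x hx y hy hxy).elim, (h.discrete α y hy x hx hxy).elim]

/-- If `x <~ y`, then `γ x` is `≤⁺` some `t'` in `δ y`, so `t <⁺ t'` inside one domain, against
local discreteness. Pencil linearity leaves only `<⁺`. -/
theorem cmp_of_δ (h : S.IsOrderedFS) {x y : S.face (k + 1)} (hx : ¬ S.IsLoop x)
    (hy : ¬ S.IsLoop y) {t : S.face k} (htx : t ∈ S.δ x) (hty : t ∈ S.δ y) : S.UpCmp x y := by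
  have key : ∀ {x y : S.face (k + 1)}, ¬ S.IsLoop x → t ∈ S.δ x → t ∈ S.δ y → ¬ S.lt x y := by
    intro x y hx htx hty hlt
    obtain ⟨t', ht', hle⟩ := lowLt_iff.1 (h.lowLt_of_lt _ _ hlt)
    exact h.discrete y t hty t' ht' ((upLt_of_mem hx htx).trans_le hle)
  by_cases e : x = y
  · exact .inl e
  rcases h.pencil x y e ⟨t, .inr htx, .inr hty⟩ with (h' | h') | h'
  exacts [(key hx htx hty h').elim, (key hy hty htx h').elim, .inr h']

/-- Here `x <~ y` would give `γ x ≤⁺ t' <⁺ γ y = γ x` for some `t'` in `δ y`. -/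
theorem cmp_of_γ (h : S.IsOrderedFS) {x y : S.face (k + 1)} (hx : ¬ S.IsLoop x)
    (hy : ¬ S.IsLoop y) (e : S.γ x = S.γ y) : S.UpCmp x y := by
  have key : ∀ {x y : S.face (k + 1)}, ¬ S.IsLoop y → S.γ x = S.γ y → ¬ S.lt x y := by
    intro x y hy e hlt
    obtain ⟨t', ht', hle⟩ := lowLt_iff.1 (h.lowLt_of_lt _ _ hlt)
    rw [e] at hle
    exact h.not_lt_of_le hle (upLt_of_mem hy ht')
  by_cases e' : x = y
  · exact .inl e'
  rcases h.pencil x y e' ⟨S.γ x, .inl rfl, .inl e⟩ with (h' | h') | h'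
  exacts [(key hy e h').elim, (key hx e.symm h').elim, .inr h']

/-- The faces above a given one form a chain: the first non-loops of two chains leaving `x` share
`x` in their domains, so they are comparable, and taking codomains is monotone. -/
theorem cmp_of_lt_lt (h : S.IsOrderedFS) {x y z : S.face k} (hy : S.UpLt x y) (hz : S.UpLt x z) :
    S.UpCmp y z := by
  suffices H : ∀ x : S.face k, ∀ y z, S.UpLe x y → S.UpLe x z → S.UpCmp y z from
    H x y z hy.le hz.le
  intro x
  induction x using (h.wf' k).induction with
  | _ x ih =>
    intro y z hy hz
    rcases hy with rfl | hy
    · exact hz.imp id .inl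
    rcases hz with rfl | hz
    · exact .inr (.inr hy)
    obtain ⟨α, hα, hxα, hαy⟩ := hy.head
    obtain ⟨β, hβ, hxβ, hβz⟩ := hz.head
    rcases h.cmp_of_δ hα hβ hxα hxβ with rfl | hlt | hlt
    · exact ih _ (upLt_of_mem hα hxα) _ _ hαy hβz
    · exact ih _ (upLt_of_mem hα hxα) _ _ hαy ((h.γ_mono hlt).trans hβz)
    · exact ih _ (upLt_of_mem hβ hxβ) _ _ ((h.γ_mono hlt).trans hαy) hβz

theorem cmp_of_le_le (h : S.IsOrderedFS) {x y z : S.face k} (hy : S.UpLe x y) (hz : S.UpLe x z) :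
    S.UpCmp y z := by
  rcases hy with rfl | hy
  · exact hz.imp id .inl
  rcases hz with rfl | hz
  · exact .inr (.inr hy)
  exact h.cmp_of_lt_lt hy hz

/-- A domain with a non-loop contains a non-loop with the terminal codomain. -/
theorem exists_last (h : S.IsOrderedFS) {α : S.face (k + 2)} {x : S.face (k + 1)}
    (hx : x ∈ S.δ α) (hl : ¬ S.IsLoop x) :
    ∃ y ∈ S.δ α, ¬ S.IsLoop y ∧ S.γ y = S.γ (S.γ α) := by
  suffices H : ∀ v, ∀ x ∈ S.δ α, ¬ S.IsLoop x → S.γ x = v →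
    ∃ y ∈ S.δ α, ¬ S.IsLoop y ∧ S.γ y = S.γ (S.γ α) from H _ x hx hl rfl
  intro v
  induction v using (h.wf' k).induction with
  | _ v ih =>
    rintro x hx hxl rfl
    rcases h.γ_eq_or_mem hx with e | ⟨x', hx', hl, hm⟩
    · exact ⟨x, hx, hxl, e⟩
    · exact ih _ (upLt_of_mem hl hm) x' hx' hl rfl

/-- A loop `γ α` would have `γγ(α)` in its domain, but the last non-loop of `δ α` has that codomain,
and codomains of non-loops are removed from `δγ(α)`. -/
theorem γ_not_loop (h : S.IsOrderedFS) {α : S.face (k + 2)} {x : S.face (k + 1)}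
    (hx : x ∈ S.δ α) (hl : ¬ S.IsLoop x) : ¬ S.IsLoop (S.γ α) := by
  intro hα
  obtain ⟨y, hy, hyl, e⟩ := h.exists_last hx hl
  exact (h.mem_δγ.1 hα.mem).2 y hy hyl e

theorem loop_of_mem (h : S.IsOrderedFS) {α : S.face (k + 2)} {x : S.face (k + 1)}
    (hx : x ∈ S.δ α) (hα : S.IsLoop (S.γ α)) : S.IsLoop x ∧ S.γ x = S.γ (S.γ α) := by
  have hl : ∀ y ∈ S.δ α, S.IsLoop y := fun y hy => by
    by_contra hl
    exact h.γ_not_loop hy hl hα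
  refine ⟨hl x hx, ?_⟩
  rcases h.γ_eq_or_mem hx with e | ⟨x', hx', hl', -⟩
  exacts [e, (hl' (hl x' hx')).elim]

theorem loop_of_le (h : S.IsOrderedFS) {x y : S.face (k + 1)} (hxy : S.UpLe x y)
    (hy : S.IsLoop y) : S.IsLoop x ∧ S.γ x = S.γ y := by
  rcases hxy with rfl | hxy
  · exact ⟨hy, rfl⟩
  induction hxy with
  | single h' =>
    obtain ⟨α, -, hx, rfl⟩ := h'
    exact h.loop_of_mem hx hy
  | tail _ h' ih =>
    obtain ⟨α, -, hx, rfl⟩ := h'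
    have := h.loop_of_mem hx hy
    have h'' := ih this.1
    exact ⟨h''.1, h''.2.trans this.2⟩

theorem not_loop_of_le (h : S.IsOrderedFS) {x y : S.face (k + 1)} (hxy : S.UpLe x y)
    (hx : ¬ S.IsLoop x) : ¬ S.IsLoop y := fun hy => hx (h.loop_of_le hxy hy).1

theorem γ_loop_of_forall (h : S.IsOrderedFS) {α : S.face (k + 2)}
    (hα : ∀ x ∈ S.δ α, S.IsLoop x) : S.IsLoop (S.γ α) := by
  rcases S.δ_cases α with ⟨⟨x, hx⟩, he⟩ | ⟨he, -⟩
  · have hγ : ∀ y ∈ S.δ α, S.γ y = S.γ (S.γ α) := fun y hy => by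
      rcases h.γ_eq_or_mem hy with e | ⟨x', hx', hl', -⟩
      exacts [e, (hl' (hα x' hx')).elim]
    ext t
    rw [h.mem_δγ]
    constructor
    · rintro ⟨ht, -⟩
      obtain ⟨y, hy, hty⟩ := domDom_cases hx ht
      rw [(hα y hy).eq hty, hγ y hy]
      rfl
    · rintro rfl
      refine ⟨mem_domDom hx ?_, fun y hy hl => (hl (hα y hy)).elim⟩
      rw [← hγ x hx]
      exact (hα x hx).mem
  · exact (h.loop_of_empty he).1

theorem exists_nonloop (h : S.IsOrderedFS) {α : S.face (k + 2)} (hα : ¬ S.IsLoop (S.γ α)) :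
    ∃ x ∈ S.δ α, ¬ S.IsLoop x ∧ S.γ x = S.γ (S.γ α) := by
  by_contra hn
  refine hα (h.γ_loop_of_forall fun x hx => ?_)
  by_contra hl
  exact hn (h.exists_last hx hl)

/-! ### Internal faces -/

theorem γ_lt_of_int (h : S.IsOrderedFS) {q : S.face k} {α : S.face (k + 2)} (hq : q ∈ S.ι α) :
    S.UpLt q (S.γ (S.γ α)) := by
  obtain ⟨e, -, e', he', -, hl', -, hm⟩ := hq
  exact (upLt_of_mem hl' hm).trans_le (h.γ_le he')

theorem not_loop_of_int (h : S.IsOrderedFS) {q : S.face k} {α : S.face (k + 2)}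
    (hq : q ∈ S.ι α) : ¬ S.IsLoop α := by
  intro hα
  obtain ⟨e, he, e', he', hl, hl', rfl, hm⟩ := hq
  rw [hα.eq he', ← hα.eq he] at hm
  exact h.upLt_irrefl _ (upLt_of_mem hl hm)

theorem γ_not_loop_of_int (h : S.IsOrderedFS) {q : S.face k} {α : S.face (k + 2)}
    (hq : q ∈ S.ι α) : ¬ S.IsLoop (S.γ α) := by
  obtain ⟨e, he, e', he', hl, hl', rfl, hm⟩ := hq
  exact h.γ_not_loop he hl

/-- Along the chain from `d` to `s` the codomain stays at `γ d` until some `α` has in its domain a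
further non-loop starting at `γ d`; that `α` is the witness. -/
theorem intUnder_of_lt (h : S.IsOrderedFS) {d s : S.face (k + 1)} (hds : S.UpLt d s)
    (hd : ¬ S.IsLoop d) (hne : S.γ d ≠ S.γ s) : S.IntUnder (S.γ d) s := by
  suffices H : ∀ d : S.face (k + 1), S.UpLt d s → ¬ S.IsLoop d → S.γ d ≠ S.γ s →
    S.IntUnder (S.γ d) s from H d hds hd hne
  intro d
  induction d using (h.wf' _).induction with
  | _ d ih =>
    intro hds hd hne
    obtain ⟨α, hα, hdα, hαs⟩ := hds.head
    rcases h.γ_eq_or_mem hdα with e | ⟨x, hx, hl, hm⟩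
    · rw [e]
      rcases hαs with e' | hαs
      · rw [e, e'] at hne
        exact (hne rfl).elim
      · exact ih _ (upLt_of_mem hα hdα) hαs (h.γ_not_loop hdα hd) (e ▸ hne)
    · exact ⟨α, hα, hαs, d, hdα, x, hx, hd, hl, rfl, hm⟩

/-- The codomain of a face strictly below `s` which is not the codomain of `s` is in the domain of
some non-loop strictly below `s`. -/
theorem exists_next (h : S.IsOrderedFS) {d s : S.face (k + 1)} (hds : S.UpLt d s)
    (hne : S.γ d ≠ S.γ s) : ∃ l, ¬ S.IsLoop l ∧ S.UpLt l s ∧ S.γ d ∈ S.δ l := by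
  suffices H : ∀ d : S.face (k + 1), S.UpLt d s → S.γ d ≠ S.γ s →
    ∃ l, ¬ S.IsLoop l ∧ S.UpLt l s ∧ S.γ d ∈ S.δ l from H d hds hne
  intro d
  induction d using (h.wf' _).induction with
  | _ d ih =>
    intro hds hne
    obtain ⟨α, hα, hdα, hαs⟩ := hds.head
    rcases h.γ_eq_or_mem hdα with e | ⟨x, hx, hl, hm⟩
    · rw [e]
      rcases hαs with e' | hαs
      · rw [e, e'] at hne
        exact (hne rfl).elim
      · exact ih _ (upLt_of_mem hα hdα) hαs (e ▸ hne)
    · exact ⟨x, hl, (upLt_of_mem hα hx).trans_le hαs, hm⟩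

/-- Once `γ d` has been absorbed as an internal face, it never reappears in the domain of a larger
face. -/
theorem γ_not_mem_of_lt (h : S.IsOrderedFS) {d s : S.face (k + 1)} (hds : S.UpLt d s)
    (hd : ¬ S.IsLoop d) : S.γ d ∉ S.δ s := by
  intro hm
  have hs := h.not_loop_of_le hds.le hd
  have hne : S.γ d ≠ S.γ s := fun e =>
    h.upLt_irrefl (S.γ s) (upLt_of_mem hs (e ▸ hm))
  -- The invariant carried upwards: `γ d` is not in `δ w`, yet it lies in the domain of a non-loop
  -- `e` strictly below `w`.
  suffices H : ∀ w : S.face (k + 1), S.UpLe w s → S.γ d ∉ S.δ w →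
      (∃ e, ¬ S.IsLoop e ∧ S.UpLt e w ∧ S.γ d ∈ S.δ e) → False by
    obtain ⟨α, hα, hαs, e, he, e', he', hl, hl', heq, hm'⟩ := h.intUnder_of_lt hds hd hne
    refine H _ hαs ?_ ⟨e', hl', upLt_of_mem hα he', hm'⟩
    rw [h.mem_δγ]
    exact fun h' => h'.2 e he hl heq
  intro w
  induction w using (h.wf' _).induction with
  | _ w ih =>
    intro hws hdw ⟨e, hel, hew, hde⟩
    rcases hws with rfl | hws
    · exact hdw hm
    obtain ⟨α, hα, hwα, hαs⟩ := hws.head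
    refine ih _ (upLt_of_mem hα hwα) hαs ?_ ⟨e, hel, hew.trans (upLt_of_mem hα hwα), hde⟩
    intro hm'
    -- Such a `y` is comparable with `e`, hence with `w`, hence equal to `w` by local discreteness.
    have key : ∀ y ∈ S.δ α, ¬ S.IsLoop y → S.γ d ∉ S.δ y := by
      intro y hy hyl hdy
      have : S.UpCmp y w := by
        rcases h.cmp_of_δ hel hyl hde hdy with rfl | h' | h'
        exacts [.inr (.inl hew), h.cmp_of_lt_lt h' hew, .inr (.inl (h'.trans hew))]
      have e := h.δ_unique hy hwα this
      exact hdw (e ▸ hdy)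
    obtain ⟨hm₁, -⟩ := h.mem_δγ.1 hm'
    obtain ⟨y, hy, hdy⟩ := domDom_cases hwα hm₁
    by_cases hyl : S.IsLoop y
    · have hγ := hyl.eq hdy
      rcases h.γ_eq_or_mem hy with e' | ⟨x, hx, hl, hmx⟩
      · have h₁ := (upLt_of_mem hel hde).trans_le ((h.γ_mono hew).trans (h.γ_le hwα))
        rw [hγ, e'] at h₁
        exact h.upLt_irrefl _ h₁
      · exact key x hx hl (hγ ▸ hmx)
    · exact key y hy hyl hdy

/-- Between `d ∈ δ α` and `γ α`, a domain face is lost only as the codomain of a non-loop of `δ α`.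
If `d` is a non-loop, the face is internal to `α`; if `d` is a loop on it, the face may instead be
the final codomain, which is the third alternative. -/
theorem δ_cases_of_lt (h : S.IsOrderedFS) {d s : S.face (k + 1)} (hds : S.UpLe d s)
    {q : S.face k} (hq : q ∈ S.δ d) :
    q ∈ S.δ s ∨ S.IntUnder q s ∨ (S.IsLoop d ∧ q = S.γ d ∧ q = S.γ s ∧ ¬ S.IsLoop s) := by
  suffices H : ∀ d : S.face (k + 1), S.UpLe d s → q ∈ S.δ d →
    q ∈ S.δ s ∨ S.IntUnder q s ∨ (S.IsLoop d ∧ q = S.γ d ∧ q = S.γ s ∧ ¬ S.IsLoop s) from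
    H d hds hq
  intro d
  induction d using (h.wf' _).induction with
  | _ d ih =>
    intro hds hq
    rcases hds with rfl | hds
    · exact .inl hq
    obtain ⟨α, hα, hdα, hαs⟩ := hds.head
    by_cases hm : q ∈ S.δ (S.γ α)
    · rcases ih _ (upLt_of_mem hα hdα) hαs hm with h' | h' | ⟨h₁, h₂, h₃, h₄⟩
      · exact .inl h'
      · exact .inr (.inl h')
      · have := h.loop_of_mem hdα h₁
        exact .inr (.inr ⟨this.1, h₂.trans this.2.symm, h₃, h₄⟩)
    · rw [h.mem_δγ] at hm
      push Not at hm
      obtain ⟨e, he, hel, rfl⟩ := hm (mem_domDom hdα hq)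
      by_cases hd : S.IsLoop d
      · have hγ := hd.eq hq
        rcases h.γ_eq_or_mem hdα with e' | ⟨x, hx, hl, hmx⟩
        · have hes : S.UpLt e s := (upLt_of_mem hα he).trans_le hαs
          by_cases hγs : S.γ e = S.γ s
          · exact .inr (.inr ⟨hd, hγ, hγs, h.not_loop_of_le hes.le hel⟩)
          · exact .inr (.inl (h.intUnder_of_lt hes hel hγs))
        · exact .inr (.inl ⟨α, hα, hαs, e, he, x, hx, hel, hl, rfl, hγ ▸ hmx⟩)
      · exact .inr (.inl ⟨α, hα, hαs, e, he, d, hdα, hel, hd, rfl, hq⟩)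

end OrdHypergraph.IsOrderedFS
namespace OrdHypergraph.IsOrderedFS

variable {S : OrdHypergraph.{u}} {k : ℕ}

/-! ### Minimal faces -/

theorem not_loop_of_min (h : S.IsOrderedFS) {d : S.face (k + 1)} (hd : S.IsMin d) :
    ¬ S.IsLoop d := fun hl => by
  obtain ⟨α, hα, e⟩ := h.loop_filling d hl
  exact hd ⟨α, hα, e⟩

theorem min_le_of_cmp {x y : S.face k} (hx : S.IsMin x) (hxy : S.UpCmp x y) : S.UpLe x y := by
  rcases hxy with e | e | e
  exacts [.inl e, .inr e, (hx.not_lt e).elim]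

theorem min_le_of_δ (h : S.IsOrderedFS) {d x : S.face (k + 1)} (hd : S.IsMin d)
    (hx : ¬ S.IsLoop x) {t : S.face k} (htd : t ∈ S.δ d) (htx : t ∈ S.δ x) : S.UpLe d x :=
  min_le_of_cmp hd (h.cmp_of_δ (h.not_loop_of_min hd) hx htd htx)

theorem min_le_of_γ (h : S.IsOrderedFS) {d x : S.face (k + 1)} (hd : S.IsMin d)
    (hx : ¬ S.IsLoop x) (e : S.γ d = S.γ x) : S.UpLe d x :=
  min_le_of_cmp hd (h.cmp_of_γ (h.not_loop_of_min hd) hx e)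

theorem min_eq_of_δ (h : S.IsOrderedFS) {d x : S.face (k + 1)} (hd : S.IsMin d)
    (hx : S.IsMin x) {t : S.face k} (htd : t ∈ S.δ d) (htx : t ∈ S.δ x) : d = x :=
  hx.eq_of_le (h.min_le_of_δ hd (h.not_loop_of_min hx) htd htx)

theorem min_eq_of_γ (h : S.IsOrderedFS) {d x : S.face (k + 1)} (hd : S.IsMin d)
    (hx : S.IsMin x) (e : S.γ d = S.γ x) : d = x :=
  hx.eq_of_le (h.min_le_of_γ hd (h.not_loop_of_min hx) e)

theorem exists_nonloop_δ (h : S.IsOrderedFS) {b : S.face (k + 2)} (hb : ¬ S.IsLoop (S.γ b))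
    {t : S.face k} (ht : t ∈ S.δ (S.γ b)) : ∃ x ∈ S.δ b, ¬ S.IsLoop x ∧ t ∈ S.δ x := by
  obtain ⟨x₀, hx₀, -⟩ := h.exists_nonloop hb
  obtain ⟨x, hx, htx⟩ := domDom_cases hx₀ (h.mem_δγ.1 ht).1
  by_cases hl : S.IsLoop x
  · have e := hl.eq htx
    rcases h.γ_eq_or_mem hx with e' | ⟨x', hx', hl', hm⟩
    · rw [e, e'] at ht
      exact (h.upLt_irrefl _ (upLt_of_mem hb ht)).elim
    · exact ⟨x', hx', hl', e ▸ hm⟩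
  · exact ⟨x, hx, hl, htx⟩

theorem exists_climb (h : S.IsOrderedFS) {b : S.face (k + 2)} (t : S.face k)
    {x : S.face (k + 1)} (hx : x ∈ S.δ b) (hl : ¬ S.IsLoop x) (ht : t ∈ S.δ x) :
    ∃ y ∈ S.δ b, ¬ S.IsLoop y ∧ S.γ y = S.γ (S.γ b) ∧ ∃ s ∈ S.δ y, S.UpLe t s := by
  induction t using (h.wf' k).induction generalizing x with
  | _ t ih =>
    rcases h.γ_eq_or_mem hx with e | ⟨x', hx', hl', hm⟩
    · exact ⟨x, hx, hl, e, t, ht, .refl t⟩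
    · obtain ⟨y, hy, hyl, e, s, hs, hle⟩ := ih _ (upLt_of_mem hl ht) hx' hl' hm
      exact ⟨y, hy, hyl, e, s, hs, (upLt_of_mem hl ht).le.trans hle⟩

/-- A witness that is not minimal is some `γ b`, and a non-loop of `δ b` with `x` in its domain is a
strictly lower replacement. So `<⁺` is generated by the minimal faces of the next dimension. -/
theorem exists_min_head (h : S.IsOrderedFS) {x y : S.face k} (hxy : S.UpLt x y) :
    ∃ d : S.face (k + 1), S.IsMin d ∧ x ∈ S.δ d ∧ S.UpLe (S.γ d) y := by
  obtain ⟨α, hα, hx, hy⟩ := hxy.head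
  clear hxy
  induction α using (h.wf _).induction with
  | _ α ih =>
    by_cases hm : S.IsMin α
    · exact ⟨α, hm, hx, hy⟩
    · obtain ⟨b, hb, rfl⟩ := not_not.1 hm
      obtain ⟨x', hx', hl, hm'⟩ := h.exists_nonloop_δ hα hx
      exact ih x' (upLt_of_mem hb hx') hl hm' ((h.γ_le hx').trans hy)

theorem exists_min_tail (h : S.IsOrderedFS) {x y : S.face k} (hxy : S.UpLt x y) :
    ∃ d : S.face (k + 1), S.IsMin d ∧ (∃ t ∈ S.δ d, S.UpLe x t) ∧ S.γ d = y := by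
  obtain ⟨α, hα, ⟨t, ht, hxt⟩, hy⟩ := hxy.tail
  clear hxy
  induction α using (h.wf _).induction generalizing t with
  | _ α ih =>
    by_cases hm : S.IsMin α
    · exact ⟨α, hm, ⟨t, ht, hxt⟩, hy⟩
    · obtain ⟨b, hb, rfl⟩ := not_not.1 hm
      obtain ⟨x', hx', hl, hm'⟩ := h.exists_nonloop_δ hα ht
      obtain ⟨z, hz, hzl, e, s, hs, hle⟩ := h.exists_climb t hx' hl hm'
      exact ih z (upLt_of_mem hb hz) hzl (e.trans hy) s hs (hxt.trans hle)

/-- By induction a face ending at `t` lies strictly below `s`; `exists_next` then gives a non-loop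
below `s` that starts at `t`, and minimality puts `d` under it. -/
theorem min_lt_of_γ_le (h : S.IsOrderedFS) {d d₀ s : S.face (k + 1)} (hd₀ : S.UpLe d₀ s)
    {t : S.face k} (ht : S.UpLe (S.γ d₀) t) (hd : S.IsMin d) (htd : t ∈ S.δ d)
    (hts : S.UpLt t (S.γ s)) : S.UpLt d s := by
  induction t using (h.wf k).induction generalizing d with
  | _ t ih =>
    obtain ⟨d₁, hd₁, rfl⟩ : ∃ d₁, S.UpLt d₁ s ∧ S.γ d₁ = t := by
      rcases ht with rfl | ht
      · refine ⟨d₀, hd₀.resolve_left ?_, rfl⟩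
        rintro rfl
        exact h.upLt_irrefl _ hts
      · obtain ⟨d₁, hd₁, ⟨t₁, ht₁, hle⟩, rfl⟩ := h.exists_min_tail ht
        have hlt := upLt_of_mem (h.not_loop_of_min hd₁) ht₁
        exact ⟨d₁, ih t₁ hlt hle hd₁ ht₁ (hlt.trans hts), rfl⟩
    obtain ⟨l, hl, hls, hm⟩ := h.exists_next hd₁ fun e => h.upLt_irrefl _ (e ▸ hts)
    exact (h.min_le_of_δ hd hl htd hm).trans_lt hls

theorem min_le_of_δ_le (h : S.IsOrderedFS) {d x : S.face (k + 1)} (hx : ¬ S.IsLoop x)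
    {t t' : S.face k} (ht : t ∈ S.δ x) (htt' : S.UpLe t t') (hd : S.IsMin d) (htd : t' ∈ S.δ d)
    (hts : S.UpLt t' (S.γ x)) : S.UpLe d x := by
  rcases htt' with rfl | htt'
  · exact h.min_le_of_δ hd hx htd ht
  · obtain ⟨n, hn, htn, hle⟩ := h.exists_min_head htt'
    exact (h.min_lt_of_γ_le (h.min_le_of_δ hn hx htn ht) hle hd htd hts).le

theorem exists_min_between (h : S.IsOrderedFS) {x : S.face (k + 1)} (hx : ¬ S.IsLoop x)
    {t v : S.face k} (ht : t ∈ S.δ x) (htv : S.UpLt t v) (hv : S.UpLt v (S.γ x)) :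
    ∃ d, S.IsMin d ∧ S.UpLt d x ∧ S.γ d = v := by
  obtain ⟨d, hd, ⟨t₁, ht₁, hle⟩, rfl⟩ := h.exists_min_tail htv
  refine ⟨d, hd, (h.min_le_of_δ_le hx ht hle hd ht₁
    ((upLt_of_mem (h.not_loop_of_min hd) ht₁).trans hv)).resolve_left ?_, rfl⟩
  rintro rfl
  exact h.upLt_irrefl _ hv

theorem exists_min_between' (h : S.IsOrderedFS) {d₀ s : S.face (k + 1)} (hd₀ : S.UpLe d₀ s)
    {v : S.face k} (htv : S.UpLt (S.γ d₀) v) (hv : S.UpLt v (S.γ s)) :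
    ∃ d, S.IsMin d ∧ S.UpLt d s ∧ S.γ d = v := by
  obtain ⟨d, hd, ⟨t₁, ht₁, hle⟩, rfl⟩ := h.exists_min_tail htv
  exact ⟨d, hd, h.min_lt_of_γ_le hd₀ hle hd ht₁
    ((upLt_of_mem (h.not_loop_of_min hd) ht₁).trans hv), rfl⟩

theorem not_γ_le_of_lt (h : S.IsOrderedFS) {a b : S.face (k + 1)} (hab : S.UpLt a b)
    (ha : ¬ S.IsLoop a) {t : S.face k} (ht : t ∈ S.δ b) : ¬ S.UpLe (S.γ a) t := by
  rintro (rfl | hlt)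
  · exact h.γ_not_mem_of_lt hab ha ht
  · obtain ⟨d, hd, hdb, rfl⟩ := h.exists_min_between' hab.le hlt
      (upLt_of_mem (h.not_loop_of_le hab.le ha) ht)
    exact h.γ_not_mem_of_lt hdb (h.not_loop_of_min hd) ht

/-! ### Comparability -/

theorem thetaDisjoint (_ : S.IsOrderedFS) : ∀ {k : ℕ} {a b : S.face (k + 1)},
    (S.δ b).Nonempty → Disjoint (S.θ a) (S.θ b) → S.ThetaDisjoint a b
  | 0, _, _, _, hd => hd
  | _ + 1, a, b, hb, hd => by
    refine ⟨hd, ?_⟩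
    rcases S.δ_cases b with ⟨-, e⟩ | ⟨e, -⟩
    · rw [e]
      exact Set.disjoint_empty _
    · exact (hb.ne_empty e).elim

/-- Comparability in one of the two orders, or equality. -/
def _root_.FaceStr.OrdHypergraph.Cmp (S : OrdHypergraph.{u}) {k : ℕ} (a b : S.face k) : Prop :=
  a = b ∨ S.lt a b ∨ S.lt b a ∨ S.UpLt a b ∨ S.UpLt b a

theorem _root_.FaceStr.OrdHypergraph.Cmp.symm {a b : S.face k} (hab : S.Cmp a b) : S.Cmp b a := by
  rcases hab with e | e | e | e | e
  exacts [.inl e.symm, .inr (.inr (.inl e)), .inr (.inl e), .inr (.inr (.inr (.inr e))),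
    .inr (.inr (.inr (.inl e)))]

theorem _root_.FaceStr.Hypergraph.UpCmp.cmp {a b : S.face k} (hab : S.UpCmp a b) : S.Cmp a b := by
  rcases hab with e | e | e
  exacts [.inl e, .inr (.inr (.inr (.inl e))), .inr (.inr (.inr (.inr e)))]

theorem _root_.FaceStr.Hypergraph.UpCmp.le_or_le {S : Hypergraph.{u}} {a b : S.face k}
    (hab : S.UpCmp a b) : S.UpLe a b ∨ S.UpLt b a := by
  rcases hab with e | e | e
  exacts [.inl (.inl e), .inl (.inr e), .inr e]

theorem cmp_of_mem (h : S.IsOrderedFS) {a b : S.face (k + 1)} (hab : (S.θ a ∩ S.θ b).Nonempty) :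
    S.Cmp a b := by
  by_cases e : a = b
  · exact .inl e
  rcases h.pencil a b e hab with (h' | h') | (h' | h')
  exacts [.inr (.inl h'), .inr (.inr (.inl h')), .inr (.inr (.inr (.inl h'))),
    .inr (.inr (.inr (.inr h')))]

/-- If `θ a` and `θ b` are disjoint, the disjointness axiom decides; otherwise pencil linearity
does. -/
theorem cmp_of_low (h : S.IsOrderedFS) {a b : S.face (k + 1)} (hab : S.LowLt a b) :
    S.Cmp a b := by
  by_cases hd : Disjoint (S.θ a) (S.θ b)
  · obtain ⟨t, ht, -⟩ := lowLt_iff.1 hab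
    exact .inr (.inl ((h.lt_iff_lowLt a b (h.thetaDisjoint ⟨t, ht⟩ hd)).2 hab))
  · exact h.cmp_of_mem (Set.not_disjoint_iff_nonempty_inter.1 hd)

theorem low_of_lt (h : S.IsOrderedFS) {a b : S.face (k + 1)} (hab : S.lt a b) :
    ∃ t ∈ S.δ b, S.UpLe (S.γ a) t :=
  lowLt_iff.1 (h.lowLt_of_lt _ _ hab)

/-- The hypotheses close a cycle of `≤⁺`, in which no strict step can occur. -/
theorem loop_of_low_low (h : S.IsOrderedFS) {a b : S.face (k + 1)} {t s : S.face k}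
    (ht : t ∈ S.δ b) (hat : S.UpLe (S.γ a) t) (hs : s ∈ S.δ a) (hbs : S.UpLe (S.γ b) s) :
    S.IsLoop a ∧ S.IsLoop b ∧ S.γ a = S.γ b := by
  have h₁ := upLe_of_mem ht
  have h₂ := upLe_of_mem hs
  refine ⟨?_, ?_, h.le_antisymm (hat.trans h₁) (hbs.trans h₂)⟩
  · by_contra hl
    exact h.upLt_irrefl _ ((hat.trans (h₁.trans hbs)).trans_lt (upLt_of_mem hl hs))
  · by_contra hl
    exact h.upLt_irrefl _ ((hbs.trans (h₂.trans hat)).trans_lt (upLt_of_mem hl ht))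

/-- Every other outcome of `cmp_of_low` closes a cycle or contradicts `not_γ_le_of_lt`. With its
companion for `b`, this forces `<~` between `<⁻`-related faces once one of them is a non-loop and
`<⁺` is excluded. -/
theorem lt_of_low_left (h : S.IsOrderedFS) {a b : S.face (k + 1)} (hab : S.LowLt a b)
    (ha : ¬ S.IsLoop a) : S.lt a b ∨ S.UpLt b a := by
  obtain ⟨t, ht, hat⟩ := lowLt_iff.1 hab
  rcases h.cmp_of_low hab with rfl | h' | h' | h' | h'
  · exact (h.not_lt_of_le hat (upLt_of_mem ha ht)).elim
  · exact .inl h'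
  · obtain ⟨s, hs, hbs⟩ := h.low_of_lt h'
    exact (ha (h.loop_of_low_low ht hat hs hbs).1).elim
  · exact (h.not_γ_le_of_lt h' ha ht hat).elim
  · exact .inr h'

theorem lt_of_low_right (h : S.IsOrderedFS) {a b : S.face (k + 1)} (hab : S.LowLt a b)
    (hb : ¬ S.IsLoop b) : S.lt a b ∨ S.UpLt a b := by
  obtain ⟨t, ht, hat⟩ := lowLt_iff.1 hab
  rcases h.cmp_of_low hab with rfl | h' | h' | h' | h'
  · exact (h.not_lt_of_le hat (upLt_of_mem hb ht)).elim
  · exact .inl h'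
  · obtain ⟨s, hs, hbs⟩ := h.low_of_lt h'
    exact (hb (h.loop_of_low_low ht hat hs hbs).2.1).elim
  · exact .inr h'
  · exact (h.not_lt_of_le ((h.γ_mono h').trans hat) (upLt_of_mem hb ht)).elim

/-- The filler of a loop has only loops in its domain, so loop-filling can be followed downwards
until a filler has empty domain. -/
theorem exists_empty (h : S.IsOrderedFS) {y : S.face (k + 1)} (hy : S.IsLoop y) :
    ∃ β : S.face (k + 2), S.δ β = ∅ ∧ S.UpLe (S.γ β) y := by
  induction y using (h.wf _).induction with
  | _ y ih =>
    obtain ⟨α, hα, rfl⟩ := h.loop_filling y hy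
    rcases S.δ_cases α with ⟨⟨x, hx⟩, -⟩ | ⟨he, -⟩
    · obtain ⟨β, hβ, hle⟩ := ih x (upLt_of_mem hα hx) (h.loop_of_mem hx hy).1
      exact ⟨β, hβ, hle.trans (upLt_of_mem hα hx).le⟩
    · exact ⟨α, he, .refl _⟩

theorem exists_empty_int (h : S.IsOrderedFS) {y : S.face (k + 1)} (hy : S.IsLoop y)
    {α : S.face (k + 2)} (hα : S.γ y ∈ S.ι α) :
    ∃ y', S.UpLe y' y ∧ S.UpLt y' (S.γ α) := by
  obtain ⟨β, hβ, hle⟩ := h.exists_empty hy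
  have hγ := (h.loop_of_le hle hy).2
  refine ⟨_, hle, ?_⟩
  rcases h.pencil_empty β α hβ (hγ ▸ hα) with h' | h'
  · obtain ⟨x, hx, hle'⟩ := h.low_of_lt h'
    exact hle'.trans_lt (upLt_of_mem (h.not_loop_of_int hα) hx)
  · refine (h.γ_mono h').resolve_left fun e => h.γ_not_loop_of_int hα (e ▸ (h.loop_of_le hle hy).1)

theorem cmp_of_loop_int (h : S.IsOrderedFS) {y s : S.face (k + 1)} (hy : S.IsLoop y)
    (hs : S.IntUnder (S.γ y) s) : S.UpCmp y s := by
  obtain ⟨α, -, hle, hα⟩ := hs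
  obtain ⟨y', hy', hlt⟩ := h.exists_empty_int hy hα
  exact h.cmp_of_le_le hy' (hlt.trans_le hle).le

/-- Two faces below which a common face is found are comparable. -/
theorem cmp_of_ge_ge (h : S.IsOrderedFS) {x y z : S.face k} (hy : S.UpLe x y) (hz : S.UpLe x z) :
    S.Cmp y z := (h.cmp_of_le_le hy hz).cmp

theorem cmp_of_low' (h : S.IsOrderedFS) {a b : S.face (k + 1)} {t : S.face k} (ht : t ∈ S.δ b)
    (hat : S.UpLe (S.γ a) t) : S.Cmp a b := h.cmp_of_low (lowLt_iff.2 ⟨t, ht, hat⟩)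

theorem cmp_of_γ_lt (h : S.IsOrderedFS) {a b : S.face (k + 1)} (hab : S.UpLt (S.γ a) (S.γ b)) :
    S.Cmp a b := by
  by_cases hb : S.IsLoop b
  · exact h.cmp_of_low' hb.mem hab.le
  -- The walk goes down the minimal faces `d ≤⁺ b`, starting from the one with codomain `γ b`, until
  -- a domain face above `γ a` lies in `δ b` or `γ a` itself is met as an internal face.
  suffices H : ∀ v : S.face k, ∀ d : S.face (k + 1), S.IsMin d → S.UpLe d b → S.γ d = v →
      S.UpLt (S.γ a) v → S.Cmp a b by
    obtain ⟨d, hd, -, e⟩ := h.exists_min_tail hab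
    exact H _ d hd (h.min_le_of_γ hd hb e) rfl (e ▸ hab)
  intro v
  induction v using (h.wf k).induction with
  | _ v ih =>
    rintro d hd hdb rfl hav
    obtain ⟨d', hd', ⟨t, ht, hat⟩, e⟩ := h.exists_min_tail hav
    obtain rfl := h.min_eq_of_γ hd' hd e
    have hdl := h.not_loop_of_min hd
    rcases h.δ_cases_of_lt hdb ht with hm | ⟨α, hα, hle, hm⟩ | ⟨h₁, -⟩
    · exact h.cmp_of_low' hm hat
    · obtain ⟨e, he, e', he', hel, hel', rfl, hm'⟩ := id hm
      have heb : S.UpLt e b := (upLt_of_mem hα he).trans_le hle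
      rcases hat with e₁ | hat
      · by_cases ha : S.IsLoop a
        · exact (h.cmp_of_loop_int ha ⟨α, hα, hle, e₁ ▸ hm⟩).cmp
        · rcases h.cmp_of_γ ha hel e₁ with rfl | h' | h'
          · exact .inr (.inr (.inr (.inl heb)))
          · exact .inr (.inr (.inr (.inl (h'.trans heb))))
          · exact h.cmp_of_ge_ge h'.le heb.le
      · obtain ⟨d₁, hd₁, -, e₂⟩ := h.exists_min_tail hat
        exact ih _ (upLt_of_mem hdl ht) d₁ hd₁
          ((h.min_le_of_γ hd₁ hel e₂).trans heb.le) e₂ hat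
    · exact (hdl h₁).elim

theorem cmp_of_γ_le (h : S.IsOrderedFS) {a b : S.face (k + 1)} (hab : S.UpLe (S.γ a) (S.γ b)) :
    S.Cmp a b := by
  rcases hab with e | hab
  · exact h.cmp_of_mem ⟨S.γ a, .inl rfl, .inl e⟩
  · exact h.cmp_of_γ_lt hab

theorem cmp_of_δ_δ (h : S.IsOrderedFS) {a b : S.face (k + 1)} {t t' : S.face k} (ht : t ∈ S.δ a)
    (ht' : t' ∈ S.δ b) (htt' : S.UpLt t t') : S.Cmp a b := by
  by_cases ha : S.IsLoop a
  · exact h.cmp_of_low' ht' (ha.eq ht ▸ htt'.le)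
  rcases (h.cmp_of_lt_lt (upLt_of_mem ha ht) htt').le_or_le with h' | h'
  · exact h.cmp_of_low' ht' h'
  · by_cases hb : S.IsLoop b
    · obtain ⟨d, hd, hda, e⟩ := h.exists_min_between ha ht htt' h'
      have hi := h.intUnder_of_lt hda (h.not_loop_of_min hd) fun e' =>
        h.upLt_irrefl _ (e ▸ e' ▸ h')
      rw [e, hb.eq ht'] at hi
      exact (h.cmp_of_loop_int hb hi).cmp.symm
    · obtain ⟨d, hd, htd, -⟩ := h.exists_min_head h'
      exact h.cmp_of_ge_ge (h.min_le_of_δ_le ha ht htt'.le hd htd h') (h.min_le_of_δ hd hb htd ht')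

theorem cmp_of_δ_γ (h : S.IsOrderedFS) {a b : S.face (k + 1)} {t : S.face k} (ht : t ∈ S.δ a)
    (htb : S.UpLe t (S.γ b)) : S.Cmp a b := by
  by_cases ha : S.IsLoop a
  · exact h.cmp_of_γ_le (ha.eq ht ▸ htb)
  rcases htb with rfl | htb
  · exact h.cmp_of_mem ⟨_, .inr ht, .inl rfl⟩
  rcases (h.cmp_of_lt_lt (upLt_of_mem ha ht) htb).le_or_le with h' | h'
  · exact h.cmp_of_γ_le h'
  by_cases hb : S.IsLoop b
  · exact h.cmp_of_δ_δ ht hb.mem htb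
  · obtain ⟨d, hd, hda, e⟩ := h.exists_min_between ha ht htb h'
    exact h.cmp_of_ge_ge hda.le (h.min_le_of_γ hd hb e)

/-- Faces with comparable codimension one faces are comparable. -/
theorem cmp_of_θ (h : S.IsOrderedFS) {a b : S.face (k + 1)} {t t' : S.face k} (ht : t ∈ S.θ a)
    (ht' : t' ∈ S.θ b) (htt' : S.UpLe t t') : S.Cmp a b := by
  rcases ht with rfl | ht <;> rcases ht' with rfl | ht'
  · exact h.cmp_of_γ_le htt'
  · exact h.cmp_of_low' ht' htt'
  · exact h.cmp_of_δ_γ ht htt'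
  · rcases htt' with rfl | htt'
    · exact h.cmp_of_mem ⟨_, .inr ht, .inr ht'⟩
    · exact h.cmp_of_δ_δ ht ht' htt'

theorem cmp_of_θ' (h : S.IsOrderedFS) {a b : S.face (k + 1)} {t t' : S.face k} (ht : t ∈ S.θ a)
    (ht' : t' ∈ S.θ b) (htt' : S.UpCmp t t') : S.Cmp a b := by
  rcases htt' with e | e | e
  exacts [h.cmp_of_θ ht ht' (.inl e), h.cmp_of_θ ht ht' (.inr e),
    (h.cmp_of_θ ht' ht (.inr e)).symm]

/-! ### Interaction of the two orders -/

theorem not_lt_and (h : S.IsOrderedFS) {a b : S.face (k + 1)} (h₁ : S.lt a b) :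
    ¬ S.UpLt a b ∧ ¬ S.UpLt b a :=
  ⟨fun h₂ => h.disjoint a b (.inl h₁) (.inl h₂), fun h₂ => h.disjoint a b (.inl h₁) (.inr h₂)⟩

theorem lt_asymm' (h : S.IsOrderedFS) {a b : S.face (k + 1)} (h₁ : S.lt a b) : ¬ S.lt b a :=
  fun h₂ => h.lt_irrefl a (h.lt_trans _ _ _ h₁ h₂)

/-- Monotonicity of `γ` makes `x` and `w` comparable, and every outcome but `x <~ w` conflicts with
disjointness or strictness. -/
theorem lt_of_upLt_lt (h : S.IsOrderedFS) {x z w : S.face (k + 1)} (hxz : S.UpLt x z)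
    (hzw : S.lt z w) : S.lt x w := by
  obtain ⟨t, ht, hle⟩ := h.low_of_lt hzw
  have hd := h.not_lt_and hzw
  rcases h.cmp_of_low' ht ((h.γ_mono hxz).trans hle) with rfl | h' | h' | h' | h'
  · exact (hd.2 hxz).elim
  · exact h'
  · exact ((h.not_lt_and (h.lt_trans _ _ _ hzw h')).2 hxz).elim
  · rcases h.cmp_of_lt_lt hxz h' with rfl | h'' | h''
    exacts [(h.lt_irrefl _ hzw).elim, (hd.1 h'').elim, (hd.2 h'').elim]
  · exact (hd.2 (h'.trans hxz)).elim

/-- Going down on the right, comparability of `w` and `x` is supplied by `<⁻`. The mixed clause `y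
<~ x` of the tensor carries the same condition. -/
theorem lt_of_lt_low (h : S.IsOrderedFS) {x z w : S.face (k + 1)} (hxz : S.UpLe x z)
    (hwz : S.lt w z) (hwx : S.LowLt w x) : S.lt w x := by
  rcases hxz with rfl | hxz
  · exact hwz
  have hd := h.not_lt_and hwz
  rcases h.cmp_of_low hwx with rfl | h' | h' | h' | h'
  · exact (hd.1 hxz).elim
  · exact h'
  · exact ((h.not_lt_and (h.lt_trans _ _ _ h' hwz)).1 hxz).elim
  · exact (hd.1 (h'.trans hxz)).elim
  · rcases h.cmp_of_lt_lt hxz h' with rfl | h'' | h''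
    exacts [(h.lt_irrefl _ hwz).elim, (hd.2 h'').elim, (hd.1 h'').elim]

theorem lt_or_of_upLt_lt (h : S.IsOrderedFS) {s z w : S.face (k + 1)} (hsz : S.UpLt s z)
    (hsw : S.lt s w) : S.lt z w ∨ S.UpLt w z := by
  obtain ⟨t, ht, hle⟩ := h.low_of_lt hsw
  have hd := h.not_lt_and hsw
  rcases h.cmp_of_θ' (.inl rfl) (.inr ht) (h.cmp_of_le_le (h.γ_mono hsz) hle) with
    rfl | h' | h' | h' | h'
  · exact (hd.1 hsz).elim
  · exact .inl h'
  · exact ((h.not_lt_and (h.lt_trans _ _ _ hsw h')).1 hsz).elim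
  · exact (hd.1 (hsz.trans h')).elim
  · exact .inr h'

theorem lt_or_of_lt_upLt (h : S.IsOrderedFS) {w x z : S.face (k + 1)} (hwx : S.lt w x)
    (hxz : S.UpLt x z) : S.lt w z ∨ S.UpLt w z := by
  obtain ⟨t, ht, hle⟩ := h.low_of_lt hwx
  have hd := h.not_lt_and hwx
  rcases h.cmp_of_γ_le (hle.trans ((upLe_of_mem ht).trans (h.γ_mono hxz))) with
    rfl | h' | h' | h' | h'
  · exact (hd.2 hxz).elim
  · exact .inl h'
  · exact ((h.not_lt_and (h.lt_trans _ _ _ h' hwx)).2 hxz).elim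
  · exact .inr h'
  · exact (hd.2 (hxz.trans h')).elim

end OrdHypergraph.IsOrderedFS
namespace OrdHypergraph.IsOrderedFS

variable {S : OrdHypergraph.{u}} {k : ℕ}

/-! ### Faces that are not internal -/

/-- Faces that are not internal to any face. -/
def _root_.FaceStr.Hypergraph.NonInt (S : Hypergraph.{u}) {k : ℕ} (x : S.face k) : Prop :=
  ¬ ∃ α : S.face (k + 2), x ∈ S.ι α

theorem _root_.FaceStr.Hypergraph.NonInt.not_under {S : Hypergraph.{u}} {x : S.face k}
    (hx : S.NonInt x) {y : S.face (k + 1)} : ¬ S.IntUnder x y := fun ⟨α, _, _, h⟩ => hx ⟨α, h⟩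

theorem nonInt_of_min (_ : S.IsOrderedFS) {x : S.face k} (hx : S.IsMin x) : S.NonInt x := by
  rintro ⟨α, e, -, e', -, hl, -, rfl, -⟩
  exact hx ⟨e, hl, rfl⟩

/-- If `α` is `γ b`, some non-loop of `δ b` has the same codomain, so the descent never changes it.
Loops thus remain filled when only minimal faces are kept. -/
theorem exists_min_γ (h : S.IsOrderedFS) {α : S.face (k + 1)} (hα : ¬ S.IsLoop α) :
    ∃ β : S.face (k + 1), ¬ S.IsLoop β ∧ S.γ β = S.γ α ∧ S.IsMin β := by
  induction α using (h.wf _).induction with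
  | _ α ih =>
    by_cases hm : S.IsMin α
    · exact ⟨α, hα, rfl, hm⟩
    · obtain ⟨b, hb, rfl⟩ := not_not.1 hm
      obtain ⟨x, hx, hl, e⟩ := h.exists_nonloop hα
      obtain ⟨β, h₁, h₂, h₃⟩ := ih x (upLt_of_mem hb hx) hl
      exact ⟨β, h₁, h₂.trans e, h₃⟩

theorem exists_max_γ (h : S.IsOrderedFS) {α : S.face (k + 1)} (hα : ¬ S.IsLoop α)
    (hn : S.NonInt (S.γ α)) :
    ∃ β : S.face (k + 1), ¬ S.IsLoop β ∧ S.γ β = S.γ α ∧ S.IsMax β := by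
  obtain ⟨β, hle, hm⟩ := h.exists_max α
  refine ⟨β, h.not_loop_of_le hle hα, ?_, hm⟩
  rcases hle with rfl | hlt
  · rfl
  · by_contra e
    exact hn.not_under (h.intUnder_of_lt hlt hα (Ne.symm e))

/-- If `γ a` were internal to `α`, then `a` would be comparable with `γ α` and so, being maximal,
above it; this gives `γγ(α) ≤⁺ γ a <⁺ γγ(α)`. Together with the next lemma it shows that `c⁽ᵏ⁾` is
closed under faces. -/
theorem nonInt_γ_of_max (h : S.IsOrderedFS) {a : S.face (k + 1)} (ha : S.IsMax a) :
    S.NonInt (S.γ a) := by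
  rintro ⟨α, hα⟩
  have hα' := h.not_loop_of_int hα
  have hγ := h.γ_not_loop_of_int hα
  have hcmp : S.UpCmp a (S.γ α) := by
    by_cases hl : S.IsLoop a
    · exact h.cmp_of_loop_int hl ⟨α, hα', .refl _, hα⟩
    · obtain ⟨e, he, e', he', hel, hel', heq, hm⟩ := id hα
      have := upLt_of_mem hα' he
      rcases h.cmp_of_γ hl hel heq.symm with rfl | h' | h'
      exacts [.inr (.inl this), .inr (.inl (h'.trans this)), h.cmp_of_lt_lt h' this]
  have hle : S.UpLe (S.γ α) a := by
    rcases hcmp with e | e | e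
    exacts [.inl e.symm, (ha.not_lt e).elim, .inr e]
  exact h.not_lt_of_le (h.γ_mono' hle) (h.γ_lt_of_int hα)

theorem nonInt_δ_of_max (h : S.IsOrderedFS) {a : S.face (k + 1)} (ha : S.IsMax a) {q : S.face k}
    (hq : q ∈ S.δ a) : S.NonInt q := by
  by_cases hl : S.IsLoop a
  · rw [hl.eq hq]
    exact h.nonInt_γ_of_max ha
  rintro ⟨α, hα⟩
  have hα' := h.not_loop_of_int hα
  obtain ⟨e, he, e', he', hel, hel', heq, hm⟩ := id hα
  have h₁ := upLt_of_mem hα' he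
  have h₂ := upLt_of_mem hα' he'
  have hle : S.UpLe (S.γ α) a := by
    rcases h.cmp_of_δ hl hel' hq hm with rfl | h' | h'
    · exact (ha.not_lt h₂).elim
    · exact (ha.not_lt h').elim
    · rcases h.cmp_of_lt_lt h' h₂ with rfl | h'' | h''
      exacts [.refl _, (ha.not_lt h'').elim, .inr h'']
  exact h.γ_not_mem_of_lt (h₁.trans_le hle) hel (heq ▸ hq)

theorem δ_cases_of_nonInt (h : S.IsOrderedFS) {d s : S.face (k + 1)} (hds : S.UpLe d s)
    {q : S.face k} (hn : S.NonInt q) (hq : q ∈ S.δ d) :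
    q ∈ S.δ s ∨ (S.IsLoop d ∧ q = S.γ d ∧ q = S.γ s) := by
  rcases h.δ_cases_of_lt hds hq with h' | h' | h'
  exacts [.inl h', (hn.not_under h').elim, .inr ⟨h'.1, h'.2.1, h'.2.2.1⟩]

theorem γ_eq_of_nonInt (h : S.IsOrderedFS) {d s : S.face (k + 1)} (hds : S.UpLe d s)
    (hn : S.NonInt (S.γ d)) (hd : ¬ S.IsLoop d) : S.γ d = S.γ s := by
  rcases hds with rfl | hds
  · rfl
  · by_contra e
    exact hn.not_under (h.intUnder_of_lt hds hd e)

theorem mem_θ_of_nonInt (h : S.IsOrderedFS) {d s : S.face (k + 1)} (hds : S.UpLe d s)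
    {q : S.face k} (hn : S.NonInt q) (hq : q ∈ S.θ d) : q ∈ S.θ s := by
  have key : q ∈ S.δ d → q ∈ S.θ s := fun hq => by
    rcases h.δ_cases_of_nonInt hds hn hq with h' | ⟨-, -, h'⟩
    exacts [.inr h', .inl h']
  rcases hq with rfl | hq
  · by_cases hl : S.IsLoop d
    · exact key hl.mem
    · exact .inl (h.γ_eq_of_nonInt hds hn hl)
  · exact key hq

/-- The counterpart of `exists_min_head`: between non-internal faces maximal faces generate `<⁺`,
since passing from a non-loop to a larger face loses only internal faces of its domain. -/
theorem exists_max_head (h : S.IsOrderedFS) {x y : S.face k} (hxy : S.UpLt x y)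
    (hx : S.NonInt x) (hy : S.NonInt y) :
    ∃ a : S.face (k + 1), S.IsMax a ∧ ¬ S.IsLoop a ∧ x ∈ S.δ a ∧ S.UpLe (S.γ a) y := by
  obtain ⟨a, hal, hxa, -⟩ := hxy.head
  obtain ⟨b, hle, hb⟩ := h.exists_max a
  have hbl := h.not_loop_of_le hle hal
  have hxb : x ∈ S.δ b := (h.δ_cases_of_nonInt hle hx hxa).resolve_right fun h' => hal h'.1
  refine ⟨b, hb, hbl, hxb, ?_⟩
  rcases (h.cmp_of_lt_lt (upLt_of_mem hbl hxb) hxy).le_or_le with h' | h'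
  · exact h'
  · obtain ⟨d, hd, hdb, rfl⟩ := h.exists_min_between hbl hxb hxy h'
    exact (hy.not_under (h.intUnder_of_lt hdb (h.not_loop_of_min hd) fun e =>
      h.upLt_irrefl _ (e ▸ h'))).elim

/-- A codimension two face of a face `a` is also one of every face above `a`. -/
theorem mem_εθ_step (h : S.IsOrderedFS) {α : S.face (k + 3)} {a : S.face (k + 2)}
    (ha : a ∈ S.δ α) {v : S.face k} (hv : v ∈ S.ε a ∨ ∃ x ∈ S.δ a, v ∈ S.θ x) :
    v ∈ S.ε (S.γ α) ∨ ∃ x ∈ S.δ (S.γ α), v ∈ S.θ x := by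
  have hε : ∀ a ∈ S.δ α, v ∈ S.ε a → v ∈ S.ε (S.γ α) ∨ ∃ x ∈ S.δ (S.γ α), v ∈ S.θ x := by
    intro a ha hv
    have : v ∈ S.ε (S.γ α) ∪ (⋃ x ∈ S.δ (S.γ α), S.θ x) := by
      rw [(h.glob_δ α).2]
      left
      simp only [Set.mem_iUnion]
      exact ⟨a, ha, hv⟩
    rcases this with h' | h'
    · exact .inl h'
    · simp only [Set.mem_iUnion] at h'
      obtain ⟨x, hx, hv⟩ := h'
      exact .inr ⟨x, hx, hv⟩
  rcases hv with hv | ⟨x, hx, hv⟩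
  · exact hε a ha hv
  induction x using (h.wf _).induction generalizing a with
  | _ x ih =>
    by_cases hm : x ∈ S.δ (S.γ α)
    · exact .inr ⟨x, hm, hv⟩
    · rw [h.mem_δγ] at hm
      push Not at hm
      obtain ⟨b, hb, hbl, rfl⟩ := hm (mem_domDom ha hx)
      have : v ∈ S.ε b ∨ ∃ y ∈ S.δ b, v ∈ S.θ y := by
        rcases hv with rfl | hv
        · rcases h.γγ_mem b with ⟨y, hy, e⟩ | h'
          · exact .inr ⟨y, hy, .inl e.symm⟩
          · exact .inl h'
        · rcases (h.mem_δγ.1 hv).1 with h' | h'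
          · simp only [Set.mem_iUnion] at h'
            obtain ⟨y, hy, hv⟩ := h'
            exact .inr ⟨y, hy, .inr hv⟩
          · exact .inl h'
      rcases this with h' | ⟨y, hy, h'⟩
      · exact hε b hb h'
      · exact ih y (upLt_of_mem hbl hy) hb hy h'

theorem mem_εθ_of_lt (h : S.IsOrderedFS) {a b : S.face (k + 2)} (hab : S.UpLt a b) {v : S.face k}
    (hv : v ∈ S.ε a ∨ ∃ x ∈ S.δ a, v ∈ S.θ x) : v ∈ S.ε b ∨ ∃ x ∈ S.δ b, v ∈ S.θ x := by
  induction hab with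
  | single h' =>
    obtain ⟨α, -, ha, rfl⟩ := h'
    exact h.mem_εθ_step ha hv
  | tail _ h' ih =>
    obtain ⟨α, -, ha, rfl⟩ := h'
    exact h.mem_εθ_step ha ih

/-- A non-loop in the domain of a member of `δ α` but missing from `δγ(α)` is the codomain of some
`c` in `δ α`. It can be replaced by a lower non-loop of `δ c` with the same codomain, or with the
same chosen domain face; the descent ends in `δγ(α)`. -/
theorem int_step (h : S.IsOrderedFS) {α : S.face (k + 3)} {b : S.face (k + 2)}
    (hb : b ∈ S.δ α) {u : S.face k} (hu : u ∈ S.ι b) : u ∈ S.ι (S.γ α) := by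
  obtain ⟨e, he, e', he', hel, hel', rfl, hm⟩ := hu
  have h₁ : ∃ x ∈ S.δ (S.γ α), ¬ S.IsLoop x ∧ S.γ x = S.γ e := by
    clear hm
    suffices H : ∀ x : S.face (k + 1), ∀ y ∈ S.δ α, x ∈ S.δ y → ¬ S.IsLoop x → S.γ x = S.γ e →
      ∃ x ∈ S.δ (S.γ α), ¬ S.IsLoop x ∧ S.γ x = S.γ e from H e b hb he hel rfl
    intro x
    induction x using (h.wf _).induction with
    | _ x ih =>
      intro y hy hxy hxl hx
      by_cases hm : x ∈ S.δ (S.γ α)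
      · exact ⟨x, hm, hxl, hx⟩
      · rw [h.mem_δγ] at hm
        push Not at hm
        obtain ⟨c, hc, hcl, rfl⟩ := hm (mem_domDom hy hxy)
        obtain ⟨z, hz, hzl, hze⟩ := h.exists_nonloop hxl
        exact ih z (upLt_of_mem hcl hz) c hc hz hzl (hze.trans hx)
  have h₂ : ∃ x ∈ S.δ (S.γ α), ¬ S.IsLoop x ∧ S.γ e ∈ S.δ x := by
    suffices H : ∀ x : S.face (k + 1), ∀ y ∈ S.δ α, x ∈ S.δ y → ¬ S.IsLoop x → S.γ e ∈ S.δ x →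
      ∃ x ∈ S.δ (S.γ α), ¬ S.IsLoop x ∧ S.γ e ∈ S.δ x from H e' b hb he' hel' hm
    intro x
    induction x using (h.wf _).induction with
    | _ x ih =>
      intro y hy hxy hxl hx
      by_cases hm : x ∈ S.δ (S.γ α)
      · exact ⟨x, hm, hxl, hx⟩
      · rw [h.mem_δγ] at hm
        push Not at hm
        obtain ⟨c, hc, hcl, rfl⟩ := hm (mem_domDom hy hxy)
        obtain ⟨z, hz, hzl, hze⟩ := h.exists_nonloop_δ hxl hx
        exact ih z (upLt_of_mem hcl hz) c hc hz hzl hze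
  obtain ⟨x, hx, hxl, hxe⟩ := h₁
  obtain ⟨y, hy, hyl, hye⟩ := h₂
  exact ⟨x, hx, y, hy, hxl, hyl, hxe, hye⟩

theorem int_of_lt (h : S.IsOrderedFS) {b c : S.face (k + 2)} (hbc : S.UpLt b c) {u : S.face k}
    (hu : u ∈ S.ι b) : u ∈ S.ι c := by
  induction hbc with
  | single h' =>
    obtain ⟨α, -, hb, rfl⟩ := h'
    exact h.int_step hb hu
  | tail _ h' ih =>
    obtain ⟨α, -, hb, rfl⟩ := h'
    exact h.int_step hb ih

end OrdHypergraph.IsOrderedFS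
-- Morphisms and the upper order.
namespace Hypergraph.Hom

variable {S T : Hypergraph.{u}} {k : ℕ}

theorem δ_map (f : Hom S T) (a : S.face (k + 1)) :
    T.δ (f.map (k + 1) a) = f.map k '' S.δ a := (f.bijOn_δ a).image_eq.symm

theorem mem_δ (f : Hom S T) {a : S.face (k + 1)} {x : S.face k} (hx : x ∈ S.δ a) :
    f.map k x ∈ T.δ (f.map (k + 1) a) := (f.bijOn_δ a).mapsTo hx

theorem isLoop (f : Hom S T) {a : S.face (k + 1)} (ha : S.IsLoop a) :
    T.IsLoop (f.map (k + 1) a) := by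
  rw [IsLoop] at *
  rw [f.δ_map, ha, Set.image_singleton, f.map_γ]

theorem isLoop_of_map (f : Hom S T) (hf : Function.Injective (f.map k)) {a : S.face (k + 1)}
    (ha : T.IsLoop (f.map (k + 1) a)) : S.IsLoop a := by
  rw [IsLoop] at *
  rw [f.δ_map, ← f.map_γ, ← Set.image_singleton] at ha
  exact hf.image_injective ha

/-- A morphism may turn a non-loop into a loop, so without injectivity only the reflexive order
survives. -/
theorem upLe (f : Hom S T) {x y : S.face k} (hxy : S.UpLe x y) :
    T.UpLe (f.map k x) (f.map k y) := by
  rcases hxy with rfl | hxy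
  · exact .refl _
  induction hxy with
  | single h =>
    obtain ⟨α, -, hx, rfl⟩ := h
    rw [f.map_γ]
    exact upLe_of_mem (f.mem_δ hx)
  | tail _ h ih =>
    obtain ⟨α, -, hx, rfl⟩ := h
    refine ih.trans ?_
    rw [f.map_γ]
    exact upLe_of_mem (f.mem_δ hx)

theorem upLt (f : Hom S T) (hf : Function.Injective (f.map k)) {x y : S.face k}
    (hxy : S.UpLt x y) : T.UpLt (f.map k x) (f.map k y) := by
  induction hxy with
  | single h =>
    obtain ⟨α, hα, hx, rfl⟩ := h
    rw [f.map_γ]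
    exact upLt_of_mem (fun h => hα (f.isLoop_of_map hf h)) (f.mem_δ hx)
  | tail _ h ih =>
    obtain ⟨α, hα, hx, rfl⟩ := h
    refine ih.trans ?_
    rw [f.map_γ]
    exact upLt_of_mem (fun h => hα (f.isLoop_of_map hf h)) (f.mem_δ hx)

theorem upCmp (f : Hom S T) (hf : Function.Injective (f.map k)) {x y : S.face k}
    (hxy : S.UpCmp x y) : T.UpCmp (f.map k x) (f.map k y) := by
  rcases hxy with rfl | h | h
  exacts [.inl rfl, .inr (.inl (f.upLt hf h)), .inr (.inr (f.upLt hf h))]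

theorem lowLt (f : Hom S T) {a b : S.face (k + 1)} (hab : S.LowLt a b) :
    T.LowLt (f.map (k + 1) a) (f.map (k + 1) b) := by
  obtain ⟨t, ht, hle⟩ := lowLt_iff.1 hab
  refine lowLt_iff.2 ⟨_, f.mem_δ ht, ?_⟩
  rw [← f.map_γ]
  exact f.upLe hle

end Hypergraph.Hom

/-! ### The glued hypergraph and its upper order. -/

/-- Two ordered face structures whose `k`-codomain and `k`-domain are identified with the same
ordered hypergraph `X`. -/
structure Gluing (k : ℕ) (S S' : OrdHypergraph.{u}) where
  hS : S.IsOrderedFS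
  hS' : S'.IsOrderedFS
  X : OrdHypergraph.{u}
  c : X ⟶ S
  d : X ⟶ S'
  lt_c : ∀ {l} (x y : X.face l), S.lt (c.map l x) (c.map l y) ↔ X.lt x y
  lt_d : ∀ {l} (x y : X.face l), S'.lt (d.map l x) (d.map l y) ↔ X.lt x y
  d_inj : ∀ l, Function.Injective (d.map l)
  d_surj : ∀ l, l < k → Function.Surjective (d.map l)
  d_range : ∀ y : S'.face k, y ∈ Set.range (d.map k) ↔ S'.IsMin y
  X_empty : ∀ l, k < l → IsEmpty (X.face l)
  c_inj : ∀ l, l + 1 ≠ k → Function.Injective (c.map l)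
  c_range : ∀ x : S.face k, x ∈ Set.range (c.map k) ↔ S.IsMax x
  c_nonInt : ∀ l, l + 1 = k → ∀ x : X.face l, S.NonInt (c.map l x)
  -- Only in dimension `k - 1` may several cuts lie over one face of `S`. These last two fields say
  -- that such cuts are `<⁺`-comparable and that strict relations between faces lift to the cuts.
  fibre : ∀ l, l + 1 = k → ∀ x y : X.face l, c.map l x = c.map l y → X.UpCmp x y
  reflect : ∀ l, l + 1 = k → ∀ x y : X.face l, S.UpLt (c.map l x) (c.map l y) → X.UpLt x y

namespace Gluing

variable {k : ℕ} {S S' : OrdHypergraph.{u}} (G : Gluing k S S') {l : ℕ}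

/-- Faces of the glued hypergraph: the faces of `S` and the faces of `S'` that are not in the
common part. -/
def Face (l : ℕ) : Type u := S.face l ⊕ {y : S'.face l // y ∉ Set.range (G.d.map l)}

/-- The inclusion of the faces of `S`. -/
def i (x : S.face l) : G.Face l := Sum.inl x

open Classical in
/-- The map from the faces of `S'`. -/
noncomputable def j (y : S'.face l) : G.Face l :=
  if h : ∃ z, G.d.map l z = y then Sum.inl (G.c.map l h.choose) else Sum.inr ⟨y, h⟩

theorem i_inj : Function.Injective (G.i (l := l)) := Sum.inl_injective

theorem j_d (z : G.X.face l) : G.j (G.d.map l z) = G.i (G.c.map l z) := by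
  have h : ∃ z', G.d.map l z' = G.d.map l z := ⟨z, rfl⟩
  have e : h.choose = z := G.d_inj l h.choose_spec
  refine (dif_pos h).trans ?_
  rw [e]
  rfl

theorem j_of_not_mem {y : S'.face l} (h : y ∉ Set.range (G.d.map l)) :
    G.j y = Sum.inr ⟨y, h⟩ := dif_neg h

theorem face_cases (p : G.Face l) :
    (∃ a, p = G.i a) ∨ ∃ b, b ∉ Set.range (G.d.map l) ∧ p = G.j b := by
  rcases p with a | ⟨b, hb⟩
  · exact .inl ⟨a, rfl⟩
  · exact .inr ⟨b, hb, (G.j_of_not_mem hb).symm⟩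

theorem j_eq_i {y : S'.face l} {x : S.face l} (h : G.j y = G.i x) :
    ∃ z, G.d.map l z = y ∧ G.c.map l z = x := by
  by_cases hy : y ∈ Set.range (G.d.map l)
  · obtain ⟨z, rfl⟩ := hy
    rw [G.j_d] at h
    exact ⟨z, rfl, G.i_inj h⟩
  · rw [G.j_of_not_mem hy] at h
    cases h

theorem j_eq_j {y y' : S'.face l} (h : G.j y = G.j y') :
    y = y' ∨ ∃ z z', G.d.map l z = y ∧ G.d.map l z' = y' ∧ G.c.map l z = G.c.map l z' := by
  by_cases hy : y ∈ Set.range (G.d.map l)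
  · obtain ⟨z, rfl⟩ := hy
    rw [G.j_d] at h
    obtain ⟨z', h₁, h₂⟩ := G.j_eq_i h.symm
    exact .inr ⟨z, z', rfl, h₁, h₂.symm⟩
  · by_cases hy' : y' ∈ Set.range (G.d.map l)
    · obtain ⟨z, rfl⟩ := hy'
      rw [G.j_d] at h
      obtain ⟨z', h₁, h₂⟩ := G.j_eq_i h
      exact (hy ⟨z', h₁⟩).elim
    · rw [G.j_of_not_mem hy, G.j_of_not_mem hy'] at h
      exact .inl (congrArg Subtype.val (Sum.inr_injective h))

theorem j_inj (hl : l + 1 ≠ k) : Function.Injective (G.j (l := l)) := by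
  intro y y' h
  rcases G.j_eq_j h with e | ⟨z, z', rfl, rfl, e⟩
  · exact e
  · rw [G.c_inj l hl e]

theorem cmp_of_j_eq (hl : l + 1 = k) {y y' : S'.face l} (h : G.j y = G.j y') :
    S'.UpCmp y y' := by
  rcases G.j_eq_j h with e | ⟨z, z', rfl, rfl, e⟩
  · exact .inl e
  · exact G.d.upCmp (G.d_inj l) (G.fibre l hl z z' e)

theorem le_of_not_mem {b : S'.face l} (hb : b ∉ Set.range (G.d.map l)) : k ≤ l := by
  by_contra h
  exact hb (G.d_surj l (by omega) b)

/-- Faces of dimension `k - 1` with the same image are `<⁺`-comparable, so they cannot share a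
domain; in other dimensions `j` is injective. -/
theorem injOn_j (b : S'.face (l + 1)) : Set.InjOn (G.j (l := l)) (S'.δ b) := by
  intro t ht t' ht' h
  by_cases hl : l + 1 = k
  · exact G.hS'.δ_unique ht ht' (G.cmp_of_j_eq hl h)
  · exact G.j_inj hl h

/-- The glued hypergraph. -/
noncomputable def PH : Hypergraph.{u} where
  face l := G.Face l
  finite_face l := by
    have := S.finite_face l
    have := S'.finite_face l
    unfold Face
    infer_instance
  bounded := by
    obtain ⟨n, hn⟩ := S.bounded
    obtain ⟨n', hn'⟩ := S'.bounded
    refine ⟨max n n', fun l hl => ⟨fun p => ?_⟩⟩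
    rcases p with a | ⟨b, -⟩
    · exact (hn l ((le_max_left _ _).trans_lt hl)).false a
    · exact (hn' l ((le_max_right _ _).trans_lt hl)).false b
  γ p := Sum.elim (fun a => G.i (S.γ a)) (fun b => G.j (S'.γ b.1)) p
  δ p := Sum.elim (fun a => G.i '' S.δ a) (fun b => G.j '' S'.δ b.1) p
  ε p := Sum.elim (fun a => G.i '' S.ε a) (fun b => G.j '' S'.ε b.1) p
  δ_one p := by
    rcases p with a | b
    · obtain ⟨x, hx⟩ := S.δ_one a
      exact ⟨G.i x, by simp [hx]⟩
    · obtain ⟨x, hx⟩ := S'.δ_one b.1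
      exact ⟨G.j x, by simp [hx]⟩
  δ_cases p := by
    rcases p with a | b
    · rcases S.δ_cases a with ⟨h₁, h₂⟩ | ⟨h₁, x, h₂⟩
      · exact .inl ⟨h₁.image _, by simp [h₂]⟩
      · exact .inr ⟨by simp [h₁], G.i x, by simp [h₂]⟩
    · rcases S'.δ_cases b.1 with ⟨h₁, h₂⟩ | ⟨h₁, x, h₂⟩
      · exact .inl ⟨h₁.image _, by simp [h₂]⟩
      · exact .inr ⟨by simp [h₁], G.j x, by simp [h₂]⟩

theorem γ_i (a : S.face (l + 1)) : G.PH.γ (G.i a) = G.i (S.γ a) := rfl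

theorem δ_i (a : S.face (l + 1)) : G.PH.δ (G.i a) = G.i '' S.δ a := rfl

theorem ε_i (a : S.face (l + 2)) : G.PH.ε (G.i a) = G.i '' S.ε a := rfl

theorem γ_j (b : S'.face (l + 1)) : G.PH.γ (G.j b) = G.j (S'.γ b) := by
  by_cases hb : b ∈ Set.range (G.d.map (l + 1))
  · obtain ⟨z, rfl⟩ := hb
    rw [G.j_d, γ_i, ← G.c.map_γ, ← G.d.map_γ, G.j_d]
  · rw [G.j_of_not_mem hb]
    rfl

theorem δ_j (b : S'.face (l + 1)) : G.PH.δ (G.j b) = G.j '' S'.δ b := by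
  by_cases hb : b ∈ Set.range (G.d.map (l + 1))
  · obtain ⟨z, rfl⟩ := hb
    rw [G.j_d, δ_i, G.c.δ_map, G.d.δ_map, Set.image_image, Set.image_image]
    simp only [G.j_d]
    rfl
  · rw [G.j_of_not_mem hb]
    rfl

theorem ε_j (b : S'.face (l + 2)) : G.PH.ε (G.j b) = G.j '' S'.ε b := by
  by_cases hb : b ∈ Set.range (G.d.map (l + 2))
  · obtain ⟨z, rfl⟩ := hb
    rw [G.j_d, ε_i, G.c.map_ε, G.d.map_ε, Set.image_image, Set.image_image]
    simp only [G.j_d]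
    rfl
  · rw [G.j_of_not_mem hb]
    rfl

/-- The inclusion of `S`. -/
noncomputable def iH : Hypergraph.Hom S.toHypergraph G.PH where
  map _ x := G.i x
  map_γ _ := rfl
  bijOn_δ _ := G.i_inj.injOn.bijOn_image
  map_ε _ := rfl

/-- The map from `S'`. -/
noncomputable def jH : Hypergraph.Hom S'.toHypergraph G.PH where
  map _ x := G.j x
  map_γ b := (G.γ_j b).symm
  bijOn_δ b := by
    rw [δ_j]
    exact (G.injOn_j b).bijOn_image
  map_ε b := G.ε_j b

theorem isLoop_i {a : S.face (l + 1)} : G.PH.IsLoop (G.i a) ↔ S.IsLoop a :=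
  ⟨fun h => G.iH.isLoop_of_map G.i_inj h, fun h => G.iH.isLoop h⟩

theorem isLoop_j {b : S'.face (l + 1)} (h : S'.IsLoop b) : G.PH.IsLoop (G.j b) :=
  G.jH.isLoop h

theorem isLoop_of_j (hl : l + 1 ≠ k) {b : S'.face (l + 1)} (h : G.PH.IsLoop (G.j b)) :
    S'.IsLoop b :=
  G.jH.isLoop_of_map (G.j_inj hl) h

theorem upLt_i {x y : S.face l} (h : S.UpLt x y) : G.PH.UpLt (G.i x) (G.i y) :=
  G.iH.upLt G.i_inj h

theorem upLe_i {x y : S.face l} (h : S.UpLe x y) : G.PH.UpLe (G.i x) (G.i y) :=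
  G.iH.upLe h

theorem upLe_j {x y : S'.face l} (h : S'.UpLe x y) : G.PH.UpLe (G.j x) (G.j y) :=
  G.jH.upLe h

theorem upLt_j (hl : l + 1 ≠ k) {x y : S'.face l} (h : S'.UpLt x y) :
    G.PH.UpLt (G.j x) (G.j y) :=
  G.jH.upLt (G.j_inj hl) h

theorem exists_i (hl : l < k) (p : G.Face l) : ∃ a, p = G.i a := by
  rcases G.face_cases p with h | ⟨b, hb, -⟩
  · exact h
  · exact absurd (G.le_of_not_mem hb) (by omega)

/-! ### Dimension `k - 1` -/

theorem isMin_d {z : G.X.face l} (hl : l = k) : S'.IsMin (G.d.map l z) := by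
  subst hl
  exact (G.d_range _).1 ⟨z, rfl⟩

theorem isMax_c {z : G.X.face l} (hl : l = k) : S.IsMax (G.c.map l z) := by
  subst hl
  exact (G.c_range _).1 ⟨z, rfl⟩

theorem exists_d {y : S'.face l} (hl : l = k) (hy : S'.IsMin y) : ∃ z, G.d.map l z = y := by
  subst hl
  exact (G.d_range _).2 hy

theorem exists_c {y : S.face l} (hl : l = k) (hy : S.IsMax y) : ∃ z, G.c.map l z = y := by
  subst hl
  exact (G.c_range _).2 hy

theorem mem_δ_of_d {w : G.X.face (l + 1)} {z : G.X.face l}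
    (h : G.d.map l z ∈ S'.δ (G.d.map (l + 1) w)) : z ∈ G.X.δ w := by
  rw [G.d.δ_map] at h
  obtain ⟨z', hz', e⟩ := h
  exact G.d_inj l e ▸ hz'

/-- Minimal faces generate `<⁺` in `S'`, and in dimension `k` these are the common faces, so a chain
of `S'` can be read in `S`. Strictness may be lost, since a common face may be a loop in `S`. -/
theorem upLe_c_of_upLt_d (hl : l + 1 = k) {z z' : G.X.face l}
    (h : S'.UpLt (G.d.map l z) (G.d.map l z')) : S.UpLe (G.c.map l z) (G.c.map l z') := by
  suffices H : ∀ y : S'.face l, ∀ z, G.d.map l z = y → S'.UpLt y (G.d.map l z') →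
    S.UpLe (G.c.map l z) (G.c.map l z') from H _ z rfl h
  intro y
  induction y using (G.hS'.wf' l).induction with
  | _ y ih =>
    rintro z rfl hz
    obtain ⟨m, hm, hzm, hle⟩ := G.hS'.exists_min_head hz
    obtain ⟨w, rfl⟩ := G.exists_d hl hm
    have h₁ : S.UpLe (G.c.map l z) (G.c.map l (G.X.γ w)) := by
      rw [G.c.map_γ]
      exact upLe_of_mem (G.c.mem_δ (G.mem_δ_of_d hzm))
    have h₂ := upLt_of_mem (G.hS'.not_loop_of_min hm) hzm
    rw [← G.d.map_γ] at h₂ hle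
    refine h₁.trans ?_
    rcases hle with e | hlt
    · rw [G.d_inj l e]
      exact .refl _
    · exact ih _ h₂ _ rfl hlt

theorem exists_upLe_of_upLe (hl : l + 1 = k) {t t' : S'.face l} (h : S'.UpLe t t') :
    ∃ x x', G.j t = G.i x ∧ G.j t' = G.i x' ∧ S.UpLe x x' := by
  obtain ⟨z, rfl⟩ := G.d_surj l (by omega) t
  obtain ⟨z', rfl⟩ := G.d_surj l (by omega) t'
  refine ⟨_, _, G.j_d z, G.j_d z', ?_⟩
  rcases h with e | h
  · rw [G.d_inj l e]
    exact .refl _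
  · exact G.upLe_c_of_upLt_d hl h

/-- Along a chain in `S'` between two faces with the same image, all faces have the same image. -/
theorem j_eq_of_between (hl : l + 1 = k) {t v t' : S'.face l} (h : S'.UpLe t v)
    (h' : S'.UpLe v t') (e : G.j t = G.j t') : G.j v = G.j t := by
  obtain ⟨x, x', h₁, h₂, h₃⟩ := G.exists_upLe_of_upLe hl h
  obtain ⟨y, y', h₄, h₅, h₆⟩ := G.exists_upLe_of_upLe hl h'
  have e₁ : x' = y := G.i_inj (h₂.symm.trans h₄)
  have e₂ : x = y' := G.i_inj (h₁.symm.trans (e.trans h₅))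
  subst e₁ e₂
  rw [h₁, h₂, G.hS.le_antisymm h₃ h₆]

/-- A minimal face of `S'` with codomain and some domain face having the same image has a single
domain face. -/
theorem δ_eq_of_min (hl : l + 1 = k) {m : S'.face (l + 1)} (hm : S'.IsMin m) {t : S'.face l}
    (ht : t ∈ S'.δ m) (e : G.j t = G.j (S'.γ m)) : S'.δ m = {t} ∧ G.PH.IsLoop (G.j m) := by
  obtain ⟨w, rfl⟩ := G.exists_d hl hm
  obtain ⟨z, rfl⟩ := G.d_surj l (by omega) t
  have hz := G.mem_δ_of_d ht
  rw [← G.d.map_γ, G.j_d, G.j_d] at e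
  have e := G.i_inj e
  rw [G.c.map_γ] at e
  have hloop : S.IsLoop (G.c.map (l + 1) w) := by
    by_contra hw
    exact G.hS.upLt_irrefl _ (e ▸ upLt_of_mem hw (G.c.mem_δ hz))
  constructor
  · refine Set.eq_singleton_iff_unique_mem.2 ⟨ht, fun t' ht' => ?_⟩
    rw [G.d.δ_map] at ht'
    obtain ⟨z', hz', rfl⟩ := ht'
    rw [(G.c.bijOn_δ w).injOn hz hz' ?_]
    rw [hloop.eq (G.c.mem_δ hz), hloop.eq (G.c.mem_δ hz')]
  · rw [G.j_d, isLoop_i]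
    exact hloop

/-- All minimal faces on the way from `t` to `γ y` collapse and have single domain faces, so the way
down from `γ y` is unique as far as `t`. Any other member of `δ y` is therefore comparable with `t`,
hence equal to it. -/
theorem δ_eq_of_j_eq (hl : l + 1 = k) {y : S'.face (l + 1)} {t : S'.face l} (ht : t ∈ S'.δ y)
    (e : G.j t = G.j (S'.γ y)) : S'.δ y = {t} := by
  by_cases hy : S'.IsLoop y
  · rw [hy.eq ht]
    exact hy
  refine Set.eq_singleton_iff_unique_mem.2 ⟨ht, fun t' ht' => ?_⟩
  refine G.hS'.δ_unique ht' ht ?_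
  have h' := upLt_of_mem hy ht'
  suffices H : ∀ w : S'.face l, S'.UpLe t w → S'.UpLe w (S'.γ y) → S'.UpLt t' w →
    S'.UpCmp t' t from H _ (upLe_of_mem ht) (.refl _) h'
  intro w
  induction w using (G.hS'.wf l).induction with
  | _ w ih =>
    intro htw hwy htw'
    rcases htw with rfl | htw
    · exact .inr (.inl htw')
    obtain ⟨m, hm, ⟨s, hs, hts⟩, rfl⟩ := G.hS'.exists_min_tail htw
    have hml := G.hS'.not_loop_of_min hm
    have hsm := upLt_of_mem hml hs
    have e₁ := G.j_eq_of_between hl htw.le hwy e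
    have e₂ := G.j_eq_of_between hl hts (hsm.le.trans hwy) e
    have hδ := (G.δ_eq_of_min hl hm hs (e₂.trans e₁.symm)).1
    obtain ⟨m', hm', ⟨s', hs', hts'⟩, e'⟩ := G.hS'.exists_min_tail htw'
    obtain rfl := G.hS'.min_eq_of_γ hm' hm e'
    rw [hδ] at hs'
    obtain rfl : s' = s := hs'
    rcases hts' with rfl | hts'
    · exact hts.elim (fun e => .inl e.symm) (fun e => .inr (.inr e))
    · exact ih _ hsm hts (hsm.le.trans hwy) hts'

theorem isLoop_j_of_eq (hl : l + 1 = k) {y : S'.face (l + 1)} {t : S'.face l} (ht : t ∈ S'.δ y)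
    (e : G.j t = G.j (S'.γ y)) : G.PH.IsLoop (G.j y) := by
  change G.PH.δ (G.j y) = {G.PH.γ (G.j y)}
  rw [δ_j, γ_j, G.δ_eq_of_j_eq hl ht e, Set.image_singleton, e]
  rfl

/-- New relations could come only from `k`-faces of `S'`, in dimension `k - 1`; by `isLoop_j_of_eq`
those that do not become loops give strict relations already present in `S`. -/
theorem upLt_below (hl : l < k) {p q : G.Face l} (h : G.PH.UpLt p q) :
    ∃ x y, p = G.i x ∧ q = G.i y ∧ S.UpLt x y := by
  have step : ∀ α : G.Face (l + 1), ¬ G.PH.IsLoop α → ∀ p ∈ G.PH.δ α,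
      ∃ x y, p = G.i x ∧ G.PH.γ α = G.i y ∧ S.UpLt x y := by
    intro α hα p hp
    rcases G.face_cases α with ⟨a, rfl⟩ | ⟨b, hb, rfl⟩
    · rw [δ_i] at hp
      obtain ⟨x, hx, rfl⟩ := hp
      exact ⟨x, _, rfl, rfl, upLt_of_mem (fun h => hα (G.isLoop_i.2 h)) hx⟩
    · have hl' : l + 1 = k := by
        have := G.le_of_not_mem hb
        omega
      rw [δ_j] at hp
      obtain ⟨t, ht, rfl⟩ := hp
      rw [γ_j]
      obtain ⟨x, x', h₁, h₂, h₃⟩ := G.exists_upLe_of_upLe hl' (upLe_of_mem ht)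
      refine ⟨x, x', h₁, h₂, h₃.resolve_left ?_⟩
      rintro rfl
      exact hα (G.isLoop_j_of_eq hl' ht (h₁.trans h₂.symm))
  induction h with
  | single h =>
    obtain ⟨α, hα, hp, rfl⟩ := h
    exact step α hα _ hp
  | tail _ h ih =>
    obtain ⟨α, hα, hp, rfl⟩ := h
    obtain ⟨x, y, rfl, rfl, hxy⟩ := ih
    obtain ⟨x', y', h₁, h₂, h₃⟩ := step α hα _ hp
    obtain rfl := G.i_inj h₁
    exact ⟨x, y', rfl, h₂, hxy.trans h₃⟩

theorem upLt_of_i_below (hl : l < k) {x y : S.face l} (h : G.PH.UpLt (G.i x) (G.i y)) :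
    S.UpLt x y := by
  obtain ⟨x', y', h₁, h₂, h₃⟩ := G.upLt_below hl h
  rwa [G.i_inj h₁, G.i_inj h₂]

theorem upLt_of_j_pred (hl : l + 1 = k) {x y : S'.face l} (h : G.PH.UpLt (G.j x) (G.j y)) :
    S'.UpLt x y := by
  obtain ⟨z, rfl⟩ := G.d_surj l (by omega) x
  obtain ⟨z', rfl⟩ := G.d_surj l (by omega) y
  rw [G.j_d, G.j_d] at h
  exact G.d.upLt (G.d_inj l) (G.reflect l hl _ _ (G.upLt_of_i_below (by omega) h))

/-! ### Dimensions at least `k` -/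

/-- After a strict step in `S'` a chain cannot return to `S`: a common face of dimension `k` is
minimal in `S'`, and there are no common faces above. So at most one crossing occurs. -/
theorem upLt_above (hl : k ≤ l) {p q : G.Face l} (h : G.PH.UpLt p q) :
    (∃ x y, p = G.i x ∧ q = G.i y ∧ S.UpLt x y) ∨ (∃ x y, p = G.j x ∧ q = G.j y ∧ S'.UpLt x y) ∨
    ∃ x z y, p = G.i x ∧ q = G.j y ∧ S.UpLt x (G.c.map l z) ∧ S'.UpLt (G.d.map l z) y := by
  have hlk : l + 1 ≠ k := by omega
  have noX : ∀ {x y : S'.face l} {s : S.face l}, S'.UpLt x y → G.j y ≠ G.i s := by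
    intro x y s hxy e
    obtain ⟨z, rfl, -⟩ := G.j_eq_i e
    rcases hl.eq_or_lt with hl | hl
    · exact (G.isMin_d hl.symm).not_lt hxy
    · exact (G.X_empty l hl).false z
  have step : ∀ α : G.Face (l + 1), ¬ G.PH.IsLoop α → ∀ p ∈ G.PH.δ α,
      (∃ x y, p = G.i x ∧ G.PH.γ α = G.i y ∧ S.UpLt x y) ∨
      (∃ x y, p = G.j x ∧ G.PH.γ α = G.j y ∧ S'.UpLt x y) := by
    intro α hα p hp
    rcases G.face_cases α with ⟨a, rfl⟩ | ⟨b, hb, rfl⟩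
    · rw [δ_i] at hp
      obtain ⟨x, hx, rfl⟩ := hp
      exact .inl ⟨x, _, rfl, rfl, upLt_of_mem (fun h => hα (G.isLoop_i.2 h)) hx⟩
    · rw [δ_j] at hp
      obtain ⟨t, ht, rfl⟩ := hp
      rw [γ_j]
      exact .inr ⟨t, _, rfl, rfl, upLt_of_mem (fun h => hα (G.isLoop_j h)) ht⟩
  induction h with
  | single h =>
    obtain ⟨α, hα, hp, rfl⟩ := h
    exact (step α hα _ hp).imp id .inl
  | tail _ h ih =>
    obtain ⟨α, hα, hp, rfl⟩ := h
    rcases step α hα _ hp with ⟨s, t, e₁, e₂, h'⟩ | ⟨s, t, e₁, e₂, h'⟩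
    · rcases ih with ⟨x, y, rfl, e, h⟩ | ⟨x, y, rfl, e, h⟩ | ⟨x, z, y, rfl, e, -, h⟩
      · obtain rfl := G.i_inj (e.symm.trans e₁)
        exact .inl ⟨x, t, rfl, e₂, h.trans h'⟩
      · exact (noX h (e.symm.trans e₁)).elim
      · exact (noX h (e.symm.trans e₁)).elim
    · rcases ih with ⟨x, y, rfl, e, h⟩ | ⟨x, y, rfl, e, h⟩ | ⟨x, z, y, rfl, e, h₁, h⟩
      · obtain ⟨z, rfl, rfl⟩ := G.j_eq_i (e₁.symm.trans e)
        exact .inr (.inr ⟨x, z, t, rfl, e₂, h, h'⟩)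
      · obtain rfl := G.j_inj hlk (e.symm.trans e₁)
        exact .inr (.inl ⟨x, t, rfl, e₂, h.trans h'⟩)
      · obtain rfl := G.j_inj hlk (e.symm.trans e₁)
        exact .inr (.inr ⟨x, z, t, rfl, e₂, h₁, h.trans h'⟩)

theorem upLt_of_ii (hl : k ≤ l) {x y : S.face l} (h : G.PH.UpLt (G.i x) (G.i y)) :
    S.UpLt x y := by
  rcases G.upLt_above hl h with ⟨x', y', e₁, e₂, h⟩ | ⟨x', y', e₁, e₂, h⟩ |
    ⟨x', z, y', e₁, e₂, h₁, h⟩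
  · rwa [G.i_inj e₁, G.i_inj e₂]
  all_goals
    obtain ⟨w, rfl, -⟩ := G.j_eq_i e₂.symm
    rcases hl.eq_or_lt with hl | hl
    · exact ((G.isMin_d hl.symm).not_lt h).elim
    · exact ((G.X_empty l hl).false w).elim

theorem upLt_of_jj (hl : k ≤ l) {x y : S'.face l} (h : G.PH.UpLt (G.j x) (G.j y)) :
    S'.UpLt x y := by
  have hlk : l + 1 ≠ k := by omega
  have noX : ∀ {x : S'.face l} {s s' : S.face l}, S.UpLt s s' → G.j x ≠ G.i s := by
    intro x y s hxy e
    obtain ⟨z, -, rfl⟩ := G.j_eq_i e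
    rcases hl.eq_or_lt with hl | hl
    · exact (G.isMax_c hl.symm).not_lt hxy
    · exact (G.X_empty l hl).false z
  rcases G.upLt_above hl h with ⟨x', y', e₁, e₂, h⟩ | ⟨x', y', e₁, e₂, h⟩ |
    ⟨x', z, y', e₁, e₂, h₁, h⟩
  · exact (noX h e₁).elim
  · rwa [G.j_inj hlk e₁, G.j_inj hlk e₂]
  · exact (noX h₁ e₁).elim

theorem upLt_of_ij (hl : k ≤ l) {x : S.face l} {y : S'.face l}
    (h : G.PH.UpLt (G.i x) (G.j y)) :
    ∃ z, S.UpLe x (G.c.map l z) ∧ S'.UpLe (G.d.map l z) y := by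
  have hlk : l + 1 ≠ k := by omega
  rcases G.upLt_above hl h with ⟨x', y', e₁, e₂, h⟩ | ⟨x', y', e₁, e₂, h⟩ |
    ⟨x', z, y', e₁, e₂, h₁, h⟩
  · obtain ⟨w, rfl, rfl⟩ := G.j_eq_i e₂
    obtain rfl := G.i_inj e₁
    exact ⟨w, h.le, .refl _⟩
  · obtain ⟨w, rfl, rfl⟩ := G.j_eq_i e₁.symm
    obtain rfl := G.j_inj hlk e₂
    exact ⟨w, .refl _, h.le⟩
  · obtain rfl := G.i_inj e₁
    obtain rfl := G.j_inj hlk e₂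
    exact ⟨z, h₁.le, h.le⟩

theorem exists_of_upLt_ji (hl : k ≤ l) {x : S.face l} {y : S'.face l}
    (h : G.PH.UpLt (G.j y) (G.i x)) : False := by
  have noX : ∀ z : G.X.face l, l = k := by
    intro z
    rcases hl.eq_or_lt with hl | hl
    · exact hl.symm
    · exact ((G.X_empty l hl).false z).elim
  rcases G.upLt_above hl h with ⟨x', y', e₁, e₂, h⟩ | ⟨x', y', e₁, e₂, h⟩ |
    ⟨x', z, y', e₁, e₂, h₁, h⟩
  · obtain ⟨z, -, rfl⟩ := G.j_eq_i e₁
    exact (G.isMax_c (noX z)).not_lt h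
  · obtain ⟨z, rfl, -⟩ := G.j_eq_i e₂.symm
    exact (G.isMin_d (noX z)).not_lt h
  · obtain ⟨z, rfl, -⟩ := G.j_eq_i e₂.symm
    exact (G.isMin_d (noX z)).not_lt h

theorem upLt_irrefl (p : G.Face l) : ¬ G.PH.UpLt p p := by
  intro h
  rcases lt_or_ge l k with hl | hl
  · obtain ⟨x, rfl⟩ := G.exists_i hl p
    exact G.hS.upLt_irrefl x (G.upLt_of_i_below hl h)
  · rcases G.face_cases p with ⟨x, rfl⟩ | ⟨y, -, rfl⟩
    · exact G.hS.upLt_irrefl x (G.upLt_of_ii hl h)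
    · exact G.hS'.upLt_irrefl y (G.upLt_of_jj hl h)

theorem upLt_of_i {x y : S.face l} (h : G.PH.UpLt (G.i x) (G.i y)) : S.UpLt x y := by
  rcases lt_or_ge l k with hl | hl
  exacts [G.upLt_of_i_below hl h, G.upLt_of_ii hl h]

theorem upLe_of_i {x y : S.face l} (h : G.PH.UpLe (G.i x) (G.i y)) : S.UpLe x y := by
  rcases h with h | h
  exacts [.inl (G.i_inj h), .inr (G.upLt_of_i h)]

end Gluing
-- Globularity, discreteness and loop-filling for the gluing.
namespace Hypergraph

variable {S T : Hypergraph.{u}} {k : ℕ}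

theorem Hom.codDom_map (f : Hom S T) (a : S.face (k + 2)) :
    T.codDom (f.map (k + 2) a) = f.map k '' S.codDom a := by
  simp only [codDom, f.δ_map, f.map_ε, Set.image_union, Set.image_image, f.map_γ]

theorem Hom.domDom_map (f : Hom S T) (a : S.face (k + 2)) :
    T.domDom (f.map (k + 2) a) = f.map k '' S.domDom a := by
  simp only [domDom, f.δ_map, f.map_ε, Set.image_union, Set.image_iUnion, Set.biUnion_image]

theorem Hom.θ_map (f : Hom S T) (a : S.face (k + 1)) :
    T.θ (f.map (k + 1) a) = f.map k '' S.θ a := by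
  rw [θ, θ, f.δ_map, Set.image_insert_eq, f.map_γ]

theorem Hom.mem_ι (f : Hom S T) (hf : Function.Injective (f.map k)) {a : S.face (k + 2)}
    {x : S.face k} (hx : x ∈ S.ι a) : f.map k x ∈ T.ι (f.map (k + 2) a) := by
  obtain ⟨e, he, e', he', hl, hl', rfl, hm⟩ := hx
  exact ⟨_, f.mem_δ he, _, f.mem_δ he', fun h => hl (f.isLoop_of_map hf h),
    fun h => hl' (f.isLoop_of_map hf h), (f.map_γ e).symm, f.mem_δ hm⟩

theorem Hom.exists_of_mem_ι (f : Hom S T) {a : S.face (k + 2)} {p : T.face k}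
    (hp : p ∈ T.ι (f.map (k + 2) a)) :
    ∃ e ∈ S.δ a, ∃ e' ∈ S.δ a, ¬ T.IsLoop (f.map (k + 1) e) ∧ ¬ T.IsLoop (f.map (k + 1) e') ∧
      f.map k (S.γ e) = p ∧ ∃ t ∈ S.δ e', f.map k t = p := by
  obtain ⟨e, he, e', he', hl, hl', rfl, hm⟩ := hp
  rw [f.δ_map] at he he'
  obtain ⟨e, he, rfl⟩ := he
  obtain ⟨e', he', rfl⟩ := he'
  rw [f.δ_map] at hm
  obtain ⟨t, ht, e₁⟩ := hm
  exact ⟨e, he, e', he', hl, hl', f.map_γ e, t, ht, e₁⟩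

theorem Hom.mem_ι_of_map (f : Hom S T) (hf : Function.Injective (f.map k)) {a : S.face (k + 2)}
    {p : T.face k} (hp : p ∈ T.ι (f.map (k + 2) a)) : ∃ x ∈ S.ι a, f.map k x = p := by
  obtain ⟨e, he, e', he', hl, hl', rfl, t, ht, e₁⟩ := f.exists_of_mem_ι hp
  exact ⟨_, ⟨e, he, e', he', fun h => hl (f.isLoop h), fun h => hl' (f.isLoop h), rfl,
    hf e₁ ▸ ht⟩, rfl⟩

theorem glob_γ_of {a : S.face (k + 2)} (h₁ : S.γ (S.γ a) ∈ S.codDom a)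
    (h₂ : ∀ x ∈ S.δ a, ¬ S.IsLoop x → S.γ (S.γ a) ∉ S.δ x)
    (h₃ : ∀ v ∈ S.codDom a, v = S.γ (S.γ a) ∨ ∃ x ∈ S.δ a, ¬ S.IsLoop x ∧ v ∈ S.δ x) :
    {S.γ (S.γ a)} = S.codDom a \ ⋃ x ∈ S.domNonloop a, S.δ x := by
  ext v
  simp only [Set.mem_singleton_iff, Set.mem_sdiff, Set.mem_iUnion, not_exists]
  constructor
  · rintro rfl
    exact ⟨h₁, fun x hx => h₂ x hx.1 hx.2⟩
  · rintro ⟨hv, hv'⟩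
    rcases h₃ v hv with e | ⟨x, hx, hl, hm⟩
    exacts [e, (hv' x ⟨hx, hl⟩ hm).elim]

theorem glob_δ_of {a : S.face (k + 2)} (h₁ : ∀ t ∈ S.δ (S.γ a), t ∈ S.domDom a)
    (h₂ : ∀ t ∈ S.δ (S.γ a), ∀ x ∈ S.δ a, ¬ S.IsLoop x → S.γ x ≠ t)
    (h₃ : ∀ t ∈ S.domDom a, t ∈ S.δ (S.γ a) ∨ ∃ x ∈ S.δ a, ¬ S.IsLoop x ∧ S.γ x = t) :
    S.δ (S.γ a) = S.domDom a \ S.γ '' S.domNonloop a := by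
  ext t
  constructor
  · intro ht
    refine ⟨h₁ t ht, ?_⟩
    rintro ⟨x, hx, rfl⟩
    exact h₂ _ ht x hx.1 hx.2 rfl
  · rintro ⟨ht, ht'⟩
    rcases h₃ t ht with h | ⟨x, hx, hl, rfl⟩
    exacts [h, (ht' ⟨x, ⟨hx, hl⟩, rfl⟩).elim]

/-- A morphism that is injective in dimension `k` transports globularity. -/
theorem Hom.glob_γ_map {S : OrdHypergraph.{u}} (hS : S.IsOrderedFS) (f : Hom S.toHypergraph T)
    (hf : Function.Injective (f.map k)) (a : S.face (k + 2)) :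
    {T.γ (T.γ (f.map (k + 2) a))} = T.codDom (f.map (k + 2) a) \
      ⋃ x ∈ T.domNonloop (f.map (k + 2) a), T.δ x := by
  apply glob_γ_of
  · rw [f.codDom_map, ← f.map_γ, ← f.map_γ]
    exact ⟨_, hS.γγ_mem a, rfl⟩
  · intro x hx hl hm
    rw [f.δ_map] at hx
    obtain ⟨x, hx, rfl⟩ := hx
    rw [← f.map_γ, ← f.map_γ, f.δ_map] at hm
    obtain ⟨t, ht, e⟩ := hm
    exact hS.γγ_not_mem hx (fun h => hl (f.isLoop h)) (hf e ▸ ht)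
  · intro v hv
    rw [f.codDom_map] at hv
    obtain ⟨v, hv, rfl⟩ := hv
    rw [← f.map_γ, ← f.map_γ]
    rcases hS.eq_or_mem a hv with rfl | ⟨x, hx, hl, hm⟩
    · exact .inl rfl
    · exact .inr ⟨_, f.mem_δ hx, fun h => hl (f.isLoop_of_map hf h), f.mem_δ hm⟩

theorem Hom.glob_δ_map {S : OrdHypergraph.{u}} (hS : S.IsOrderedFS) (f : Hom S.toHypergraph T)
    (hf : Function.Injective (f.map k)) (a : S.face (k + 2)) :
    T.δ (T.γ (f.map (k + 2) a)) = T.domDom (f.map (k + 2) a) \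
      T.γ '' T.domNonloop (f.map (k + 2) a) := by
  apply glob_δ_of
  · rw [f.domDom_map, ← f.map_γ, f.δ_map]
    rintro _ ⟨t, ht, rfl⟩
    exact ⟨t, (hS.mem_δγ.1 ht).1, rfl⟩
  · rw [← f.map_γ, f.δ_map, f.δ_map]
    rintro _ ⟨t, ht, rfl⟩ _ ⟨x, hx, rfl⟩ hl e
    rw [← f.map_γ] at e
    exact (hS.mem_δγ.1 ht).2 x hx (fun h => hl (f.isLoop h)) (hf e)
  · rw [f.domDom_map, ← f.map_γ, f.δ_map, f.δ_map]
    rintro _ ⟨t, ht, rfl⟩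
    by_cases hm : t ∈ S.δ (S.γ a)
    · exact .inl ⟨t, hm, rfl⟩
    · rw [hS.mem_δγ] at hm
      push Not at hm
      obtain ⟨x, hx, hl, rfl⟩ := hm ht
      exact .inr ⟨_, ⟨x, hx, rfl⟩, fun h => hl (f.isLoop_of_map hf h), (f.map_γ x).symm⟩

/-- Images commute with unions, so the clause on empty faces transfers without injectivity; only the
equality of non-empty faces is left as a hypothesis. -/
theorem Hom.oneEq_map {S : OrdHypergraph.{u}} (hS : S.IsOrderedFS) (f : Hom S.toHypergraph T)
    (a : S.face (k + 3))
    (h : T.δ (T.γ (f.map (k + 3) a)) = T.domDom (f.map (k + 3) a) \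
      T.γ '' T.domNonloop (f.map (k + 3) a)) :
    T.OneEq (T.δ (T.γ (f.map (k + 3) a))) (T.ε (T.γ (f.map (k + 3) a)))
      (T.domDom (f.map (k + 3) a) \ T.γ '' T.domNonloop (f.map (k + 3) a))
      (⋃ x ∈ T.δ (f.map (k + 3) a), T.ε x) := by
  refine ⟨h, ?_⟩
  rw [← h]
  have h₂ := (hS.glob_δ a).2
  rw [← (hS.glob_δ a).1] at h₂
  have h₃ := congrArg (fun s => f.map k '' s) h₂
  simp only [Set.image_union, Set.image_iUnion] at h₃
  rw [← f.map_γ, f.δ_map, f.δ_map, f.map_ε]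
  simp only [Set.biUnion_image, f.map_ε, f.θ_map]
  exact h₃

end Hypergraph

namespace Gluing

variable {k : ℕ} {S S' : OrdHypergraph.{u}} (G : Gluing k S S') {l : ℕ}

/-- The minimal faces on the way from `v` to `γ x` collapse, and induction from the top puts each of
them under `x`. Their domain face `v` is not in `δ x`, or `x` would collapse too, so it is internal
below `x`. -/
theorem exists_inside (hl : l + 1 = k) {x : S'.face (l + 1)} (hx : ¬ G.PH.IsLoop (G.j x))
    {v : S'.face l} (e : G.j v = G.j (S'.γ x)) (hv : S'.UpLt v (S'.γ x)) :
    ∃ y, ¬ S'.IsLoop y ∧ S'.UpLt y x ∧ S'.γ y = v := by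
  have hxl : ¬ S'.IsLoop x := fun h => hx (G.isLoop_j h)
  induction v using (G.hS'.wf' l).induction with
  | _ v ih =>
    obtain ⟨m, hm, hvm, hle⟩ := G.hS'.exists_min_head hv
    have hml := G.hS'.not_loop_of_min hm
    have hvm' := upLt_of_mem hml hvm
    have e₁ := G.j_eq_of_between hl hvm'.le hle e
    have hmx : S'.UpLe m x := by
      rcases hle with e₂ | hlt
      · exact G.hS'.min_le_of_γ hm hxl e₂
      · obtain ⟨y, hy, hyx, e₂⟩ := ih _ hvm' (e₁.trans e) hlt
        exact (G.hS'.min_le_of_γ hm hy e₂.symm).trans hyx.le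
    rcases G.hS'.δ_cases_of_lt hmx hvm with h | ⟨α, hα, hle', y, hy, -, -, hyl, -, rfl, -⟩ | h
    · exact (hx (G.isLoop_j_of_eq hl h e)).elim
    · exact ⟨y, hyl, (upLt_of_mem hα hy).trans_le hle', rfl⟩
    · exact (hml h.1).elim

theorem lt_γ_of_j_eq (hl : l + 1 = k) {x : S'.face (l + 1)} (hx : ¬ G.PH.IsLoop (G.j x))
    {t v : S'.face l} (ht : t ∈ S'.δ x) (e : G.j t = G.j v) (htv : S'.UpLt t v) :
    S'.UpLt v (S'.γ x) := by
  have hxl : ¬ S'.IsLoop x := fun h => hx (G.isLoop_j h)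
  rcases (G.hS'.cmp_of_lt_lt (upLt_of_mem hxl ht) htv).le_or_le with h | h
  · exact (hx (G.isLoop_j_of_eq hl ht (G.j_eq_of_between hl (upLe_of_mem ht) h e).symm)).elim
  · exact h

/-- The exceptional dimension. A non-loop `x` of `δ b` that collapses no longer removes its domain
faces, but a face `v` of its domain then has the same image as `γ x`, and the search continues
upwards from there. -/
theorem glob_γ_pred (hl : l + 1 = k) (b : S'.face (l + 2)) :
    {G.PH.γ (G.PH.γ (G.j b))} = G.PH.codDom (G.j b) \
      ⋃ x ∈ G.PH.domNonloop (G.j b), G.PH.δ x := by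
  have hc : G.PH.codDom (G.j b) = G.j '' S'.codDom b := G.jH.codDom_map b
  apply glob_γ_of
  · rw [hc, γ_j, γ_j]
    exact ⟨_, G.hS'.γγ_mem b, rfl⟩
  · rw [δ_j, γ_j, γ_j]
    rintro _ ⟨x, hx, rfl⟩ hlp hm
    rw [δ_j] at hm
    obtain ⟨t, ht, e⟩ := hm
    exact hlp (G.isLoop_j_of_eq hl ht
      (G.j_eq_of_between hl (upLe_of_mem ht) (G.hS'.γ_le hx) e).symm)
  · rw [hc, γ_j, γ_j, δ_j]
    rintro _ ⟨v, hv, rfl⟩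
    induction v using (G.hS'.wf' l).induction with
    | _ v ih =>
      rcases G.hS'.eq_or_mem b hv with rfl | ⟨x, hx, hlp, hm⟩
      · exact .inl rfl
      · by_cases hx' : G.PH.IsLoop (G.j x)
        · have e : G.j v = G.j (S'.γ x) := by
            rw [← γ_j]
            refine hx'.eq ?_
            rw [δ_j]
            exact ⟨v, hm, rfl⟩
          rw [e]
          exact ih _ (upLt_of_mem hlp hm) (Or.inl ⟨x, hx, rfl⟩)
        · refine .inr ⟨_, ⟨x, hx, rfl⟩, hx', ?_⟩
          rw [δ_j]
          exact ⟨v, hm, rfl⟩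

/-- The search now goes down through collapsed faces. A new danger is that `γ x` and a face of
`δγ(b)` acquire the same image. They are then comparable in `S'`, and both directions are excluded
because codomains of non-loops strictly below a face are never in its domain, nor `≤⁺` a member of
it. -/
theorem glob_δ_pred (hl : l + 1 = k) (b : S'.face (l + 2)) :
    G.PH.δ (G.PH.γ (G.j b)) = G.PH.domDom (G.j b) \ G.PH.γ '' G.PH.domNonloop (G.j b) := by
  have hd : G.PH.domDom (G.j b) = G.j '' S'.domDom b := G.jH.domDom_map b
  apply glob_δ_of
  · rw [hd, γ_j, δ_j]
    rintro _ ⟨t, ht, rfl⟩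
    exact ⟨t, (G.hS'.mem_δγ.1 ht).1, rfl⟩
  · rw [γ_j, δ_j, δ_j]
    rintro _ ⟨t, ht, rfl⟩ _ ⟨x, hx, rfl⟩ hxl e
    rw [γ_j] at e
    have hxl' : ¬ S'.IsLoop x := fun h => hxl (G.isLoop_j h)
    have hle : S'.UpLe x (S'.γ b) := upLe_of_mem hx
    rcases G.cmp_of_j_eq hl e with e' | h | h
    · exact (G.hS'.mem_δγ.1 ht).2 x hx hxl' e'
    · rcases hle with rfl | hlt
      · exact G.hS'.not_lt_of_le (upLe_of_mem ht) h
      · exact G.hS'.not_γ_le_of_lt hlt hxl' ht h.le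
    · obtain ⟨y, hyl, hyx, rfl⟩ := G.exists_inside hl hxl e.symm h
      exact G.hS'.γ_not_mem_of_lt (hyx.trans_le hle) hyl ht
  · rw [hd, γ_j, δ_j, δ_j]
    rintro _ ⟨t, ht, rfl⟩
    induction t using (G.hS'.wf l).induction with
    | _ t ih =>
      by_cases hm : t ∈ S'.δ (S'.γ b)
      · exact .inl ⟨t, hm, rfl⟩
      · rw [G.hS'.mem_δγ] at hm
        push Not at hm
        obtain ⟨x, hx, hxl, rfl⟩ := hm ht
        by_cases hx' : G.PH.IsLoop (G.j x)
        · have := hx'.mem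
          rw [γ_j, δ_j] at this
          obtain ⟨t', ht', e⟩ := this
          rw [← e]
          exact ih t' (upLt_of_mem hxl ht') (OrdHypergraph.IsOrderedFS.mem_domDom hx ht')
        · exact .inr ⟨_, ⟨x, hx, rfl⟩, hx', G.γ_j x⟩

theorem glob_γ (p : G.PH.face (l + 2)) :
    {G.PH.γ (G.PH.γ p)} = G.PH.codDom p \ ⋃ x ∈ G.PH.domNonloop p, G.PH.δ x := by
  rcases G.face_cases p with ⟨a, rfl⟩ | ⟨b, -, rfl⟩
  · exact G.iH.glob_γ_map G.hS G.i_inj a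
  · by_cases hl : l + 1 = k
    · exact G.glob_γ_pred hl b
    · exact G.jH.glob_γ_map G.hS' (G.j_inj hl) b

theorem glob_δ' (p : G.PH.face (l + 2)) :
    G.PH.δ (G.PH.γ p) = G.PH.domDom p \ G.PH.γ '' G.PH.domNonloop p := by
  rcases G.face_cases p with ⟨a, rfl⟩ | ⟨b, -, rfl⟩
  · exact G.iH.glob_δ_map G.hS G.i_inj a
  · by_cases hl : l + 1 = k
    · exact G.glob_δ_pred hl b
    · exact G.jH.glob_δ_map G.hS' (G.j_inj hl) b

theorem glob_δ (p : G.PH.face (l + 3)) :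
    G.PH.OneEq (G.PH.δ (G.PH.γ p)) (G.PH.ε (G.PH.γ p))
      (G.PH.domDom p \ G.PH.γ '' G.PH.domNonloop p) (⋃ x ∈ G.PH.δ p, G.PH.ε x) := by
  have h := G.glob_δ' p
  rcases G.face_cases p with ⟨a, rfl⟩ | ⟨b, -, rfl⟩
  · exact G.iH.oneEq_map G.hS a h
  · exact G.jH.oneEq_map G.hS' b h

theorem discrete (p : G.PH.face (l + 1)) : ∀ x ∈ G.PH.δ p, ∀ y ∈ G.PH.δ p, ¬ G.PH.UpLt x y := by
  rcases G.face_cases p with ⟨a, rfl⟩ | ⟨b, hb, rfl⟩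
  · rw [δ_i]
    rintro _ ⟨x, hx, rfl⟩ _ ⟨y, hy, rfl⟩ h
    exact G.hS.discrete a x hx y hy (G.upLt_of_i h)
  · rw [δ_j]
    rintro _ ⟨x, hx, rfl⟩ _ ⟨y, hy, rfl⟩ h
    refine G.hS'.discrete b x hx y hy ?_
    have := G.le_of_not_mem hb
    by_cases hl : l + 1 = k
    · exact G.upLt_of_j_pred hl h
    · exact G.upLt_of_jj (by omega) h

theorem loop_filling (p : G.PH.face (l + 1)) (hp : G.PH.IsLoop p) :
    ∃ α : G.PH.face (l + 2), ¬ G.PH.IsLoop α ∧ G.PH.γ α = p := by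
  rcases G.face_cases p with ⟨a, rfl⟩ | ⟨b, hb, rfl⟩
  · obtain ⟨α, hα, rfl⟩ := G.hS.loop_filling a (G.isLoop_i.1 hp)
    exact ⟨G.i α, fun h => hα (G.isLoop_i.1 h), rfl⟩
  · have hle := G.le_of_not_mem hb
    obtain ⟨α, hα, rfl⟩ : ∃ α, ¬ S'.IsLoop α ∧ S'.γ α = b := by
      -- In dimension `k` the image may be a loop although `b` is not. But `b` is outside the common
      -- part, hence not minimal, and so is the codomain of a non-loop anyway.
      by_cases hl : l + 1 = k
      · by_contra hn
        obtain ⟨z, hz⟩ := G.exists_d hl hn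
        exact hb ⟨z, hz⟩
      · exact G.hS'.loop_filling b (G.isLoop_of_j hl hp)
    exact ⟨G.j α, fun h => hα (G.isLoop_of_j (by omega) h), G.γ_j α⟩

theorem upLt_linear (p q : G.PH.face 0) (hpq : p ≠ q) : G.PH.UpLt p q ∨ G.PH.UpLt q p := by
  -- For `k = 0` the gluing is at one vertex, the last of `S` and the first of `S'`.
  have key : ∀ x (y : S'.face 0), k = 0 → G.PH.UpLe (G.i x) (G.j y) := by
    intro x y hk
    obtain ⟨m, hxm, hm⟩ := G.hS.exists_max x
    obtain ⟨z, rfl⟩ := G.exists_c hk.symm hm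
    refine (G.upLe_i hxm).trans ?_
    rw [← j_d]
    apply G.upLe_j
    by_cases e : G.d.map 0 z = y
    · exact .inl e
    · exact .inr ((G.hS'.upLt_linear _ _ e).resolve_right (G.isMin_d hk.symm).not_lt)
  rcases G.face_cases p with ⟨x, rfl⟩ | ⟨y, hy, rfl⟩ <;>
    rcases G.face_cases q with ⟨x', rfl⟩ | ⟨y', hy', rfl⟩
  · exact (G.hS.upLt_linear x x' fun e => hpq (e ▸ rfl)).imp G.upLt_i G.upLt_i
  · have := G.le_of_not_mem hy'
    exact .inl ((key x y' (by omega)).resolve_left hpq)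
  · have := G.le_of_not_mem hy
    exact .inr ((key x' y (by omega)).resolve_left hpq.symm)
  · have := G.le_of_not_mem hy
    exact (G.hS'.upLt_linear y y' fun e => hpq (e ▸ rfl)).imp (G.upLt_j (by omega))
      (G.upLt_j (by omega))

end Gluing
-- Maximal faces, internal faces and the lower order.
namespace OrdHypergraph.IsOrderedFS

variable {S : OrdHypergraph.{u}} {k : ℕ}

theorem not_lt_zero (h : S.IsOrderedFS) {a b : S.face 0} : ¬ S.lt a b := fun hab => by
  obtain ⟨c, hc, -⟩ := Relation.TransGen.head'_iff.1 (h.lowLt_of_lt a b hab)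
  exact hc

theorem _root_.FaceStr.Hypergraph.LowLt.of_le {S : Hypergraph.{u}} {a b c : S.face (k + 1)}
    (hab : S.UpLe (S.γ a) (S.γ b)) (hbc : S.LowLt b c) : S.LowLt a c := by
  obtain ⟨t, ht, hle⟩ := lowLt_iff.1 hbc
  exact lowLt_iff.2 ⟨t, ht, hab.trans hle⟩

theorem eq_of_max (h : S.IsOrderedFS) {x y z : S.face k} (hxy : S.UpLe x y) (hy : S.IsMax y)
    (hxz : S.UpLe x z) (hz : S.IsMax z) : y = z := by
  rcases h.cmp_of_le_le hxy hxz with e | e | e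
  exacts [e, (hy.not_lt e).elim, (hz.not_lt e).elim]

/-- Climbing on either side keeps `<~` unless a `<⁺`-relation appears; then maximality makes the two
upper faces equal or excludes the case. -/
theorem lt_max_of_lt (h : S.IsOrderedFS) {a b m n : S.face (k + 1)} (ham : S.UpLe a m)
    (hm : S.IsMax m) (hbn : S.UpLe b n) (hn : S.IsMax n) (hab : S.lt a b) :
    m = n ∨ S.lt m n := by
  have h₁ : S.lt a n ∨ S.UpLt a n := by
    rcases hbn with rfl | hbn
    exacts [.inl hab, h.lt_or_of_lt_upLt hab hbn]
  rcases h₁ with h₁ | h₁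
  · rcases ham with rfl | ham
    · exact .inr h₁
    · exact .inr ((h.lt_or_of_upLt_lt ham h₁).resolve_right hn.not_lt)
  · exact .inl (h.eq_of_max ham hm h₁.le hn)

theorem exists_max_tail (h : S.IsOrderedFS) {x y : S.face k} (hxy : S.UpLt x y)
    (hx : S.NonInt x) (hy : S.NonInt y) :
    ∃ a : S.face (k + 1), S.IsMax a ∧ ¬ S.IsLoop a ∧ S.γ a = y ∧ ∃ t ∈ S.δ a, S.UpLe x t := by
  induction x using (h.wf' k).induction with
  | _ x ih =>
    obtain ⟨a, ha, hal, hxa, hle⟩ := h.exists_max_head hxy hx hy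
    rcases hle with e | hlt
    · exact ⟨a, ha, hal, e, x, hxa, .refl x⟩
    · have := upLt_of_mem hal hxa
      obtain ⟨m, hm, hml, e, t, ht, hle⟩ := ih _ this hlt (h.nonInt_γ_of_max ha)
      exact ⟨m, hm, hml, e, t, ht, this.le.trans hle⟩

/-- A non-internal face below some domain face of `s` is below some domain face of every maximal
face above `s`. -/
theorem exists_le_δ_max (h : S.IsOrderedFS) {s m : S.face (k + 1)} (hsm : S.UpLe s m)
    (hm : S.IsMax m) {q r : S.face k} (hq : S.NonInt q) (hr : r ∈ S.δ s) (hqr : S.UpLt q r) :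
    ∃ r' ∈ S.δ m, S.UpLe q r' := by
  have hlt : S.UpLt q (S.γ m) := hqr.trans_le ((upLe_of_mem hr).trans (h.γ_mono' hsm))
  by_cases hl : S.IsLoop m
  · exact ⟨_, hl.mem, hlt.le⟩
  · obtain ⟨a, ha, hal, e, t, ht, hle⟩ := h.exists_max_tail hlt hq (h.nonInt_γ_of_max hm)
    have : a = m := by
      rcases h.cmp_of_γ hal hl e with e | e | e
      exacts [e, (ha.not_lt e).elim, (hm.not_lt e).elim]
    exact ⟨t, this ▸ ht, hle⟩

theorem lt_γ_of_loop (h : S.IsOrderedFS) {q y' : S.face (k + 1)} (hq : S.IsLoop q)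
    {y : S.face (k + 2)} (hy : S.γ q ∈ S.ι y) (h₁ : S.UpLe y' q) (h₂ : S.UpLe y' (S.γ y)) :
    S.UpLt q (S.γ y) := by
  have hn := h.γ_not_loop_of_int hy
  rcases h.cmp_of_le_le h₁ h₂ with rfl | e | e
  exacts [(hn hq).elim, e, (hn (h.loop_of_le e.le hq).1).elim]

/-- A minimal face with a codimension two face internal to `y`. -/
theorem lt_or_le_of_int (h : S.IsOrderedFS) {m y : S.face (k + 2)} (hm : S.IsMin m)
    {f : S.face (k + 1)} (hf : f ∈ S.δ m) {v : S.face k} (hv : v ∈ S.θ f) (hy : v ∈ S.ι y) :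
    S.lt m y ∨ S.UpLe m y := by
  have hml := h.not_loop_of_min hm
  have hyl := h.not_loop_of_int hy
  -- `m` is the only minimal face with `f` in its domain, so a chain leaving `f` can be taken to
  -- start with it.
  have above : ∀ r ∈ S.δ y, S.UpLt f r → S.lt m y ∨ S.UpLe m y := by
    intro r hr hfr
    obtain ⟨m', hm', hfm, hle⟩ := h.exists_min_head hfr
    obtain rfl := h.min_eq_of_δ hm' hm hfm hf
    exact .inl ((h.lt_of_low_left (lowLt_iff.2 ⟨r, hr, hle⟩) hml).resolve_right hm.not_lt)
  have below : ∀ r ∈ S.δ y, S.UpLe r f → S.UpLt f (S.γ y) → S.lt m y ∨ S.UpLe m y :=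
    fun r hr hrf hlt => .inr (h.min_le_of_δ_le hyl hr hrf hm hf hlt)
  by_cases hfl : S.IsLoop f
  · have hγ : v = S.γ f := hv.elim id fun hv => hfl.eq hv
    rw [hγ] at hy
    obtain ⟨β, hβ, hle⟩ := h.exists_empty hfl
    rcases h.pencil_empty β y hβ ((h.loop_of_le hle hfl).2 ▸ hy) with h' | h'
    · obtain ⟨r, hr, hle'⟩ := h.low_of_lt h'
      have hlt := h.lt_γ_of_loop hfl hy hle (hle'.trans (upLe_of_mem hr))
      rcases h.cmp_of_le_le hle hle' with e | e | e
      exacts [below r hr (.inl e.symm) hlt, above r hr e, below r hr e.le hlt]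
    · have hlt := h.lt_γ_of_loop hfl hy hle (h.γ_mono h')
      exact .inr (h.min_lt_of_γ_le h'.le hle hm hf hlt).le
  · obtain ⟨e, he, e', he', hel, hel', rfl, hm'⟩ := id hy
    rcases hv with hv | hv
    · have hlt : S.UpLt e f → S.UpLt f (S.γ y) := fun hef => by
        rcases (h.cmp_of_lt_lt hef (upLt_of_mem hyl he)) with e₁ | e₁ | e₁
        · exact (h.upLt_irrefl _ (e₁ ▸ hv ▸ h.γ_lt_of_int hy)).elim
        · exact e₁
        · exact (h.not_lt_of_le (h.γ_mono e₁) (hv ▸ h.γ_lt_of_int hy)).elim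
      rcases h.cmp_of_γ hfl hel hv.symm with rfl | e₁ | e₁
      · exact .inr (h.min_le_of_δ hm hyl hf he)
      · exact above e he e₁
      · exact below e he e₁.le (hlt e₁)
    · have hlt : S.UpLt e' f → S.UpLt f (S.γ y) := fun hef => by
        have := upLt_of_mem hyl he
        rcases (h.cmp_of_lt_lt hef (upLt_of_mem hyl he')) with e₁ | e₁ | e₁
        · exact (h.γ_not_mem_of_lt this hel (e₁ ▸ hv)).elim
        · exact e₁
        · exact (h.γ_not_mem_of_lt (this.trans e₁) hel hv).elim
      rcases h.cmp_of_δ hfl hel' hv hm' with rfl | e₁ | e₁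
      · exact .inr (h.min_le_of_δ hm hyl hf he')
      · exact above e' he' e₁
      · exact below e' he' e₁.le (hlt e₁)

/-- The second pencil axiom compares `y` with an empty-domain face under `q`. If `q` were not under
a member of `δ y`, it would be the codomain of a non-loop strictly below `y`, and so internal. -/
theorem exists_le_δ_of_int (h : S.IsOrderedFS) {q : S.face (k + 1)} {y : S.face (k + 2)}
    (hn : S.NonInt q) (hq : S.IsLoop q) (hy : S.γ q ∈ S.ι y) : ∃ r ∈ S.δ y, S.UpLe q r := by
  have hyl := h.not_loop_of_int hy
  obtain ⟨β, hβ, hle⟩ := h.exists_empty hq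
  have hβl : ¬ S.IsLoop β := fun hl => by
    have := hl.mem
    rw [hβ] at this
    exact this
  rcases h.pencil_empty β y hβ ((h.loop_of_le hle hq).2 ▸ hy) with h' | h'
  · obtain ⟨r, hr, hle'⟩ := h.low_of_lt h'
    have hlt := h.lt_γ_of_loop hq hy hle (hle'.trans (upLe_of_mem hr))
    rcases (h.cmp_of_le_le hle hle').le_or_le with e | e
    · exact ⟨r, hr, e⟩
    · obtain ⟨d, hd, hdy, rfl⟩ := h.exists_min_between hyl hr e hlt
      exact (hn.not_under (h.intUnder_of_lt hdy (h.not_loop_of_min hd) fun e =>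
        h.upLt_irrefl _ (e ▸ hlt))).elim
  · have hlt := h.lt_γ_of_loop hq hy hle (h.γ_mono h')
    exfalso
    rcases hle with rfl | hle
    · exact hn.not_under (h.intUnder_of_lt h' hβl fun e => h.upLt_irrefl _ (e ▸ hlt))
    · obtain ⟨d, hd, hdy, rfl⟩ := h.exists_min_between' h'.le hle hlt
      exact hn.not_under (h.intUnder_of_lt hdy (h.not_loop_of_min hd) fun e =>
        h.upLt_irrefl _ (e ▸ hlt))

end OrdHypergraph.IsOrderedFS

/-! ### The lower order of the gluing. -/

namespace Gluing

variable {k : ℕ} {S S' : OrdHypergraph.{u}} (G : Gluing k S S') {l : ℕ}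

/-- The face `a` is not maximal, the face `b` is not minimal, and `a ≤⁺ z`. -/
def MixedAt (a : S.face l) (b : S'.face l) (z : G.X.face l) : Prop :=
  ¬ S.IsMax a ∧ ¬ S'.IsMin b ∧ S.UpLe a (G.c.map l z)

/-- The relation `<~` on the glued hypergraph. -/
def PLt (p q : G.PH.face l) : Prop :=
  (∃ a b, S.lt a b ∧ G.i a = p ∧ G.i b = q) ∨ (∃ a b, S'.lt a b ∧ G.j a = p ∧ G.j b = q) ∨
  (l = k ∧ ∃ a b z, G.MixedAt a b z ∧ G.i a = p ∧ G.j b = q ∧ S'.lt (G.d.map l z) b) ∨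
  (l = k ∧ ∃ a b z, G.MixedAt a b z ∧ G.j b = p ∧ G.i a = q ∧ S'.lt b (G.d.map l z) ∧
    G.PH.LowLt p q) ∨
  (l = k + 1 ∧ ∃ a b, G.i a = p ∧ G.j b = q ∧ G.PH.LowLt p q)

theorem lowLt_of_i {a b : S.face (l + 1)} (h : G.PH.LowLt (G.i a) (G.i b)) : S.LowLt a b := by
  obtain ⟨t, ht, hle⟩ := lowLt_iff.1 h
  rw [δ_i] at ht
  obtain ⟨t, ht, rfl⟩ := ht
  exact lowLt_iff.2 ⟨t, ht, G.upLe_of_i hle⟩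

theorem not_i_eq_j (hl : k < l) {a : S.face l} {b : S'.face l} : G.i a ≠ G.j b := fun e => by
  obtain ⟨z, -, -⟩ := G.j_eq_i e.symm
  exact (G.X_empty l hl).false z

theorem not_i_eq_j_max (hl : l = k) {a : S.face l} {b : S'.face l} (ha : ¬ S.IsMax a) :
    G.i a ≠ G.j b := fun e => by
  obtain ⟨z, -, rfl⟩ := G.j_eq_i e.symm
  exact ha (G.isMax_c hl)

theorem not_i_eq_j_min (hl : l = k) {a : S.face l} {b : S'.face l} (hb : ¬ S'.IsMin b) :
    G.i a ≠ G.j b := fun e => by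
  obtain ⟨z, rfl, -⟩ := G.j_eq_i e.symm
  exact hb (G.isMin_d hl)

/-- The mixed clauses do not interfere: in dimension `k` their face of `S` is not maximal and their
face of `S'` not minimal, so neither is common, and in dimension `k + 1` nothing is common. -/
theorem lt_ii {a b : S.face l} : G.PLt (G.i a) (G.i b) ↔ S.lt a b := by
  refine ⟨fun h => ?_, fun h => .inl ⟨a, b, h, rfl, rfl⟩⟩
  rcases h with ⟨a', b', h, e, e'⟩ | ⟨a', b', h, e, e'⟩ | ⟨hl, a', b', z, hm, -, e', -⟩ |
    ⟨hl, a', b', z, hm, e, -⟩ | ⟨hl, a', b', -, e, -⟩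
  · rwa [← G.i_inj e, ← G.i_inj e']
  · obtain ⟨z, rfl, rfl⟩ := G.j_eq_i e
    obtain ⟨z', rfl, rfl⟩ := G.j_eq_i e'
    rwa [G.lt_c, ← G.lt_d]
  · exact (G.not_i_eq_j_min hl hm.2.1 e'.symm).elim
  · exact (G.not_i_eq_j_min hl hm.2.1 e.symm).elim
  · exact (G.not_i_eq_j (by omega) e.symm).elim

theorem lt_jj {a b : S'.face l} : G.PLt (G.j a) (G.j b) ↔ S'.lt a b := by
  refine ⟨fun h => ?_, fun h => .inr (.inl ⟨a, b, h, rfl, rfl⟩)⟩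
  rcases h with ⟨a', b', h, e, e'⟩ | ⟨a', b', h, e, e'⟩ | ⟨hl, a', b', z, hm, e, -⟩ |
    ⟨hl, a', b', z, hm, -, e', -⟩ | ⟨hl, a', b', e, -⟩
  · obtain ⟨z, rfl, rfl⟩ := G.j_eq_i e.symm
    obtain ⟨z', rfl, rfl⟩ := G.j_eq_i e'.symm
    rwa [G.lt_d, ← G.lt_c]
  · by_cases hl : l + 1 = k
    · obtain ⟨z, rfl⟩ := G.d_surj l (by omega) a
      obtain ⟨w, rfl⟩ := G.d_surj l (by omega) b
      obtain ⟨z', rfl⟩ := G.d_surj l (by omega) a'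
      obtain ⟨w', rfl⟩ := G.d_surj l (by omega) b'
      rw [j_d, j_d] at e e'
      rwa [G.lt_d, ← G.lt_c, ← G.i_inj e, ← G.i_inj e', G.lt_c, ← G.lt_d]
    · rwa [← G.j_inj hl e, ← G.j_inj hl e']
  · exact (G.not_i_eq_j_max hl hm.1 e).elim
  · exact (G.not_i_eq_j_max hl hm.1 e').elim
  · exact (G.not_i_eq_j (by omega) e).elim

/-- Only one maximal face lies above `a`, so the existential in the definition has no freedom. The
rule also covers maximal `a` and minimal `b`, because `<~` is inherited along `a ≤⁺ z`; this uniform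
form is what arguments in dimension `k` use. -/
theorem lt_ij (hl : l + 1 = k) {a : S.face (l + 1)} {b : S'.face (l + 1)} {z : G.X.face (l + 1)}
    (haz : S.UpLe a (G.c.map (l + 1) z)) :
    G.PLt (G.i a) (G.j b) ↔ S'.lt (G.d.map (l + 1) z) b := by
  have hz : S.IsMax (G.c.map (l + 1) z) := G.isMax_c hl
  constructor
  · rintro (⟨a', b', h, e, e'⟩ | ⟨a', b', h, e, e'⟩ | ⟨-, a', b', z', hm, e, e', h⟩ |
      ⟨-, a', b', z', hm, e, -⟩ | ⟨hl, -⟩)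
    · obtain rfl := G.i_inj e
      obtain ⟨w, rfl, rfl⟩ := G.j_eq_i e'.symm
      rw [G.lt_d, ← G.lt_c]
      rcases haz with rfl | haz
      · exact h
      · exact (G.hS.lt_or_of_upLt_lt haz h).resolve_right (G.isMax_c hl).not_lt
    · obtain ⟨w, rfl, rfl⟩ := G.j_eq_i e
      have e₁ := G.c_inj (l + 1) (by omega) ((G.isMax_c hl).eq_of_le haz)
      rwa [← e₁, ← G.j_inj (by omega) e']
    · obtain rfl := G.i_inj e
      obtain rfl := G.j_inj (by omega) e'
      have e₁ := G.c_inj (l + 1) (by omega) (G.hS.eq_of_max haz hz hm.2.2 (G.isMax_c hl))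
      rwa [e₁]
    · exact (G.not_i_eq_j_min hl hm.2.1 e.symm).elim
    · omega
  · intro h
    by_cases hb : S'.IsMin b
    · obtain ⟨w, rfl⟩ := G.exists_d hl hb
      rw [G.lt_d, ← G.lt_c] at h
      rw [j_d, lt_ii]
      rcases haz with rfl | haz
      exacts [h, G.hS.lt_of_upLt_lt haz h]
    · by_cases ha : S.IsMax a
      · rw [ha.eq_of_le haz, ← j_d, lt_jj]
        exact h
      · exact .inr (.inr (.inl ⟨hl, a, b, z, ⟨ha, hb, haz⟩, rfl, rfl, h⟩))

theorem lt_ji (hl : l + 1 = k) {a : S.face (l + 1)} {b : S'.face (l + 1)} {z : G.X.face (l + 1)}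
    (haz : S.UpLe a (G.c.map (l + 1) z)) :
    G.PLt (G.j b) (G.i a) ↔ S'.lt b (G.d.map (l + 1) z) ∧ G.PH.LowLt (G.j b) (G.i a) := by
  have hz : S.IsMax (G.c.map (l + 1) z) := G.isMax_c hl
  constructor
  · rintro (⟨a', b', h, e, e'⟩ | ⟨a', b', h, e, e'⟩ | ⟨-, a', b', z', hm, e, -⟩ |
      ⟨-, a', b', z', hm, e, e', h, hlow⟩ | ⟨hl, -⟩)
    · obtain rfl := G.i_inj e'
      obtain ⟨w, rfl, rfl⟩ := G.j_eq_i e.symm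
      rw [G.lt_d, ← G.lt_c, j_d]
      refine ⟨?_, G.iH.lowLt (G.hS.lowLt_of_lt _ _ h)⟩
      rcases haz with rfl | haz
      · exact h
      · exact (G.hS.lt_or_of_lt_upLt h haz).resolve_right (G.isMax_c hl).not_lt
    · obtain ⟨w, rfl, rfl⟩ := G.j_eq_i e'
      obtain rfl := G.c_inj (l + 1) (by omega) ((G.isMax_c hl).eq_of_le haz)
      obtain rfl := G.j_inj (by omega) e
      rw [← j_d]
      exact ⟨h, G.jH.lowLt (G.hS'.lowLt_of_lt _ _ h)⟩
    · exact (G.not_i_eq_j_max hl hm.1 e).elim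
    · obtain rfl := G.i_inj e'
      obtain rfl := G.j_inj (by omega) e
      obtain rfl := G.c_inj (l + 1) (by omega)
        (G.hS.eq_of_max haz hz hm.2.2 (G.isMax_c hl))
      exact ⟨h, hlow⟩
    · omega
  · rintro ⟨h, hlow⟩
    by_cases hb : S'.IsMin b
    · obtain ⟨w, rfl⟩ := G.exists_d hl hb
      rw [G.lt_d, ← G.lt_c] at h
      rw [j_d] at hlow ⊢
      rw [lt_ii]
      exact G.hS.lt_of_lt_low haz h (G.lowLt_of_i hlow)
    · by_cases ha : S.IsMax a
      · rw [ha.eq_of_le haz, ← j_d, lt_jj]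
        exact h
      · exact .inr (.inr (.inr (.inl ⟨hl, a, b, z, ⟨ha, hb, haz⟩, rfl, rfl, h, hlow⟩)))

theorem lt_ij_above (hl : k < l) {a : S.face l} {b : S'.face l} :
    G.PLt (G.i a) (G.j b) ↔ l = k + 1 ∧ G.PH.LowLt (G.i a) (G.j b) := by
  constructor
  · rintro (⟨a', b', h, e, e'⟩ | ⟨a', b', h, e, e'⟩ | ⟨hl, -⟩ | ⟨hl, -⟩ | ⟨hl, a', b', -, -, h⟩)
    · exact (G.not_i_eq_j hl e').elim
    · exact (G.not_i_eq_j hl e.symm).elim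
    · omega
    · omega
    · exact ⟨hl, h⟩
  · rintro ⟨hl, h⟩
    exact .inr (.inr (.inr (.inr ⟨hl, a, b, rfl, rfl, h⟩)))

theorem not_lt_ji_above (hl : k < l) {a : S.face l} {b : S'.face l} :
    ¬ G.PLt (G.j b) (G.i a) := by
  rintro (⟨a', b', h, e, e'⟩ | ⟨a', b', h, e, e'⟩ | ⟨hl, -⟩ | ⟨hl, -⟩ | ⟨hl, a', b', e, -, h⟩)
  · exact G.not_i_eq_j hl e
  · exact G.not_i_eq_j hl e'.symm
  · omega
  · omega
  · exact G.not_i_eq_j (by omega) e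

theorem exists_z (hl : l = k) (a : S.face l) : ∃ z, S.UpLe a (G.c.map l z) := by
  obtain ⟨m, ham, hm⟩ := G.hS.exists_max a
  obtain ⟨z, rfl⟩ := G.exists_c hl hm
  exact ⟨z, ham⟩

theorem lowLt_of_lt : ∀ {l : ℕ} (p q : G.PH.face l), G.PLt p q → G.PH.LowLt p q
  | 0, p, q, h => by
    rcases h with ⟨a', b', h, -⟩ | ⟨a', b', h, -⟩ | ⟨-, a', b', z, -, -, -, h⟩ |
      ⟨-, a', b', z, -, -, -, h, -⟩ | ⟨hl, -⟩
    · exact (G.hS.not_lt_zero h).elim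
    · exact (G.hS'.not_lt_zero h).elim
    · exact (G.hS'.not_lt_zero h).elim
    · exact (G.hS'.not_lt_zero h).elim
    · omega
  | l + 1, p, q, h => by
    rcases h with ⟨a, b, h, rfl, rfl⟩ | ⟨a, b, h, rfl, rfl⟩ | ⟨-, a, b, z, hm, rfl, rfl, h⟩ |
      ⟨-, a, b, z, -, -, -, -, h⟩ | ⟨-, a, b, -, -, h⟩
    · exact G.iH.lowLt (G.hS.lowLt_of_lt _ _ h)
    · exact G.jH.lowLt (G.hS'.lowLt_of_lt _ _ h)
    · refine LowLt.of_le ?_ (G.jH.lowLt (G.hS'.lowLt_of_lt _ _ h))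
      change G.PH.UpLe _ (G.PH.γ (G.j _))
      rw [j_d]
      exact G.upLe_i (G.hS.γ_mono' hm.2.2)
    · exact h
    · exact h

end Gluing
-- Strictness and disjointness for the gluing.
theorem Hypergraph.ThetaDisjoint.disjoint {S : Hypergraph.{u}} : ∀ {k : ℕ} {a b : S.face (k + 1)},
    S.ThetaDisjoint a b → Disjoint (S.θ a) (S.θ b)
  | 0, _, _, h => h
  | _ + 1, _, _, h => h.1

namespace Gluing

variable {k : ℕ} {S S' : OrdHypergraph.{u}} (G : Gluing k S S') {l : ℕ}

theorem PLt_irrefl (p : G.PH.face (l + 1)) : ¬ G.PLt p p := by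
  rcases G.face_cases p with ⟨a, rfl⟩ | ⟨b, -, rfl⟩
  · rw [lt_ii]
    exact G.hS.lt_irrefl a
  · rw [lt_jj]
    exact G.hS'.lt_irrefl b

theorem PLt_trans_mid (hl : l + 1 = k) (p q r : G.PH.face (l + 1)) (h₁ : G.PLt p q)
    (h₂ : G.PLt q r) : G.PLt p r := by
  -- This supplies the `<⁻` condition whenever the composite runs from `S'` to `S`.
  have low := (G.lowLt_of_lt _ _ h₁).trans (G.lowLt_of_lt _ _ h₂)
  -- A relation in `S` passes to the common faces above, where it can be read in `S'`.
  have cmp : ∀ {a b : S.face (l + 1)} {z w}, S.UpLe a (G.c.map _ z) → S.UpLe b (G.c.map _ w) →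
      S.lt a b → z = w ∨ S'.lt (G.d.map _ z) (G.d.map _ w) := by
    intro a b z w hz hw hab
    rcases G.hS.lt_max_of_lt hz (G.isMax_c hl) hw (G.isMax_c hl) hab with e | e
    · exact .inl (G.c_inj _ (by omega) e)
    · right
      rwa [G.lt_d, ← G.lt_c]
  rcases G.face_cases p with ⟨a, rfl⟩ | ⟨a, ha, rfl⟩ <;>
    rcases G.face_cases q with ⟨b, rfl⟩ | ⟨b, hb, rfl⟩ <;>
    rcases G.face_cases r with ⟨c, rfl⟩ | ⟨c, hc, rfl⟩
  · rw [lt_ii] at *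
    exact G.hS.lt_trans _ _ _ h₁ h₂
  · obtain ⟨z, hz⟩ := G.exists_z hl a
    obtain ⟨w, hw⟩ := G.exists_z hl b
    rw [G.lt_ij hl hw] at h₂
    rw [G.lt_ij hl hz]
    rcases cmp hz hw (G.lt_ii.1 h₁) with rfl | h
    exacts [h₂, G.hS'.lt_trans _ _ _ h h₂]
  · obtain ⟨z, hz⟩ := G.exists_z hl a
    obtain ⟨w, hw⟩ := G.exists_z hl c
    rw [G.lt_ij hl hz] at h₁
    rw [G.lt_ji hl hw] at h₂
    have h := G.hS'.lt_trans _ _ _ h₁ h₂.1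
    rw [G.lt_d, ← G.lt_c] at h
    have h' : S.lt a (G.c.map _ w) := by
      rcases hz with rfl | hz
      exacts [h, G.hS.lt_of_upLt_lt hz h]
    rw [lt_ii]
    exact G.hS.lt_of_lt_low hw h' (G.lowLt_of_i low)
  · obtain ⟨z, hz⟩ := G.exists_z hl a
    rw [G.lt_ij hl hz] at h₁ ⊢
    rw [lt_jj] at h₂
    exact G.hS'.lt_trans _ _ _ h₁ h₂
  · obtain ⟨z, hz⟩ := G.exists_z hl b
    obtain ⟨w, hw⟩ := G.exists_z hl c
    rw [G.lt_ji hl hz] at h₁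
    rw [G.lt_ji hl hw]
    refine ⟨?_, low⟩
    rcases cmp hz hw (G.lt_ii.1 h₂) with rfl | h
    exacts [h₁.1, G.hS'.lt_trans _ _ _ h₁.1 h]
  · obtain ⟨z, hz⟩ := G.exists_z hl b
    rw [G.lt_ji hl hz] at h₁
    rw [G.lt_ij hl hz] at h₂
    rw [lt_jj]
    exact G.hS'.lt_trans _ _ _ h₁.1 h₂
  · obtain ⟨z, hz⟩ := G.exists_z hl c
    rw [lt_jj] at h₁
    rw [G.lt_ji hl hz] at h₂ ⊢
    exact ⟨G.hS'.lt_trans _ _ _ h₁ h₂.1, low⟩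
  · rw [lt_jj] at *
    exact G.hS'.lt_trans _ _ _ h₁ h₂

theorem PLt_trans (p q r : G.PH.face (l + 1)) (h₁ : G.PLt p q) (h₂ : G.PLt q r) :
    G.PLt p r := by
  by_cases hl : l + 1 = k
  · exact G.PLt_trans_mid hl p q r h₁ h₂
  have low := (G.lowLt_of_lt _ _ h₁).trans (G.lowLt_of_lt _ _ h₂)
  have hk : ∀ {b : S'.face (l + 1)}, b ∉ Set.range (G.d.map (l + 1)) → k < l + 1 := fun hb => by
    have := G.le_of_not_mem hb
    omega
  rcases G.face_cases p with ⟨a, rfl⟩ | ⟨a, ha, rfl⟩ <;>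
    rcases G.face_cases q with ⟨b, rfl⟩ | ⟨b, hb, rfl⟩ <;>
    rcases G.face_cases r with ⟨c, rfl⟩ | ⟨c, hc, rfl⟩
  · rw [lt_ii] at *
    exact G.hS.lt_trans _ _ _ h₁ h₂
  · rw [G.lt_ij_above (hk hc)] at *
    exact ⟨h₂.1, low⟩
  · exact (G.not_lt_ji_above (hk hb) h₂).elim
  · rw [G.lt_ij_above (hk hb)] at *
    exact ⟨h₁.1, low⟩
  · exact (G.not_lt_ji_above (hk ha) h₁).elim
  · exact (G.not_lt_ji_above (hk ha) h₁).elim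
  · exact (G.not_lt_ji_above (hk hb) h₂).elim
  · rw [lt_jj] at *
    exact G.hS'.lt_trans _ _ _ h₁ h₂

theorem PLt_disjoint (p q : G.PH.face (l + 1)) (h : G.PLt p q) :
    ¬ G.PH.UpLt p q ∧ ¬ G.PH.UpLt q p := by
  have mid : ∀ {a : S.face (l + 1)} {b : S'.face (l + 1)}, b ∉ Set.range (G.d.map (l + 1)) →
      G.PLt (G.i a) (G.j b) ∨ G.PLt (G.j b) (G.i a) →
      ¬ G.PH.UpLt (G.i a) (G.j b) ∧ ¬ G.PH.UpLt (G.j b) (G.i a) := by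
    intro a b hb h
    have hk := G.le_of_not_mem hb
    refine ⟨fun hu => ?_, G.exists_of_upLt_ji hk⟩
    obtain ⟨z, h₁, h₂⟩ := G.upLt_of_ij hk hu
    rcases hk.eq_or_lt with hk | hk
    · have h' : S'.lt (G.d.map (l + 1) z) b ∨ S'.lt b (G.d.map (l + 1) z) := by
        rw [G.lt_ij hk.symm h₁, G.lt_ji hk.symm h₁] at h
        exact h.imp id And.left
      rcases h₂ with rfl | h₂
      · exact G.hS'.lt_irrefl _ (h'.elim id id)
      · exact G.hS'.disjoint _ _ h' (.inl h₂)
    · exact (G.X_empty _ hk).false z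
  rcases G.face_cases p with ⟨a, rfl⟩ | ⟨a, ha, rfl⟩ <;>
    rcases G.face_cases q with ⟨b, rfl⟩ | ⟨b, hb, rfl⟩
  · have := G.hS.not_lt_and (G.lt_ii.1 h)
    exact ⟨fun h => this.1 (G.upLt_of_i h), fun h => this.2 (G.upLt_of_i h)⟩
  · exact mid hb (.inl h)
  · exact (mid ha (.inr h)).symm
  · have := G.hS'.not_lt_and (G.lt_jj.1 h)
    have hk := G.le_of_not_mem ha
    exact ⟨fun h => this.1 (G.upLt_of_jj hk h), fun h => this.2 (G.upLt_of_jj hk h)⟩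

theorem θ_i (a : S.face (l + 1)) : G.PH.θ (G.i a) = G.i '' S.θ a := G.iH.θ_map a

theorem θ_j (b : S'.face (l + 1)) : G.PH.θ (G.j b) = G.j '' S'.θ b := G.jH.θ_map b

theorem disjoint_of_image {α β : Type*} {f : α → β} {s t : Set α}
    (h : Disjoint (f '' s) (f '' t)) : Disjoint s t :=
  Set.disjoint_left.2 fun x hs ht => Set.disjoint_left.1 h ⟨x, hs, rfl⟩ ⟨x, ht, rfl⟩

/-- The common face `z` is a loop in `S` if its codomain has the same image as a domain face. -/
theorem isLoop_c (hl : l + 1 = k) {z : G.X.face (l + 1)} {s : S'.face l}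
    (hs : s ∈ S'.δ (G.d.map (l + 1) z)) (e : G.j s = G.j (S'.γ (G.d.map (l + 1) z))) :
    S.IsLoop (G.c.map (l + 1) z) := by
  have := (G.δ_eq_of_min hl (G.isMin_d hl) hs e).2
  rwa [j_d, isLoop_i] at this

/-- It suffices to have `z <⁻ b` in `S'`. The domain face `τ` of `b` above `γ a` is not internal in
`S`, so it cannot fall strictly between `γ a` and `γ z`; hence `γ z ≤⁺ τ` in `S`, and this is lifted
to the common part by `fibre` and `reflect`. -/
theorem lt_ij_of_low (hl : l + 1 = k) {a : S.face (l + 1)} {b : S'.face (l + 1)}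
    (hd : Disjoint (G.PH.θ (G.i a)) (G.PH.θ (G.j b))) (h : G.PH.LowLt (G.i a) (G.j b)) :
    G.PLt (G.i a) (G.j b) := by
  have hlk : l < k := by omega
  obtain ⟨z, hz⟩ := G.exists_z hl a
  rw [G.lt_ij hl hz]
  have hmin : S'.IsMin (G.d.map (l + 1) z) := G.isMin_d hl
  suffices hlow : S'.LowLt (G.d.map (l + 1) z) b from
    (G.hS'.lt_of_low_left hlow (G.hS'.not_loop_of_min hmin)).resolve_right hmin.not_lt
  obtain ⟨t, ht, hle⟩ := lowLt_iff.1 h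
  rw [γ_i] at hle
  rw [δ_j] at ht
  obtain ⟨t, ht, rfl⟩ := ht
  obtain ⟨τ, rfl⟩ := G.d_surj l hlk t
  rw [j_d] at hle
  have hne : S.γ a ≠ G.c.map l τ := fun e => by
    have h₁ : G.i (S.γ a) ∈ G.PH.θ (G.i a) := .inl rfl
    refine Set.disjoint_left.1 hd h₁ (Set.mem_insert_of_mem _ ?_)
    rw [e, ← j_d, δ_j]
    exact ⟨_, ht, rfl⟩
  have hlt : S.UpLt (S.γ a) (G.c.map l τ) := (G.upLe_of_i hle).resolve_left hne
  have hle' : S.UpLe (S.γ (G.c.map (l + 1) z)) (G.c.map l τ) := by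
    rcases (G.hS.cmp_of_le_le (G.hS.γ_mono' hz) hlt.le).le_or_le with h' | h'
    · exact h'
    · obtain ⟨m, hm, hmz, e⟩ := G.hS.exists_min_between' hz hlt h'
      have := G.hS.intUnder_of_lt hmz (G.hS.not_loop_of_min hm)
        fun e' => G.hS.upLt_irrefl _ (e.symm.trans e' ▸ h')
      rw [e] at this
      exact ((G.c_nonInt l hl τ).not_under this).elim
  rw [← G.c.map_γ] at hle'
  suffices hc : S'.UpLe (G.d.map l (G.X.γ z)) (G.d.map l τ) by
    refine lowLt_iff.2 ⟨_, ht, ?_⟩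
    rwa [← G.d.map_γ]
  rcases hle' with e | hlt'
  · rcases G.fibre l hl _ _ e with e' | e' | e'
    · exact .inl (congrArg _ e')
    · exact .inr (G.d.upLt (G.d_inj l) e')
    -- The wrong direction inside a fibre makes `z` a loop of `S`. Then `a`, lying below it, has the
    -- same codomain as `z`, which contradicts the strictness in `hlt`.
    · exfalso
      obtain ⟨m, hm, ⟨s, hs, hts⟩, e₁⟩ := G.hS'.exists_min_tail (G.d.upLt (G.d_inj l) e')
      rw [G.d.map_γ] at e₁
      obtain rfl := G.hS'.min_eq_of_γ hm hmin e₁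
      have hjs := G.j_eq_of_between hl hts (upLe_of_mem hs)
        (by rw [← G.d.map_γ, j_d, j_d, e])
      have hloop := G.isLoop_c hl hs (by rw [hjs, ← G.d.map_γ, j_d, j_d, e])
      rw [(G.hS.loop_of_le hz hloop).2, ← G.c.map_γ, e] at hlt
      exact G.hS.upLt_irrefl _ hlt
  · exact .inr (G.d.upLt (G.d_inj l) (G.reflect l hl _ _ hlt'))

theorem lt_ji_of_low (hl : l + 1 = k) {a : S.face (l + 1)} {b : S'.face (l + 1)}
    (hd : Disjoint (G.PH.θ (G.j b)) (G.PH.θ (G.i a))) (h : G.PH.LowLt (G.j b) (G.i a)) :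
    G.PLt (G.j b) (G.i a) := by
  have hlk : l < k := by omega
  obtain ⟨z, hz⟩ := G.exists_z hl a
  rw [G.lt_ji hl hz]
  refine ⟨?_, h⟩
  have hmin : S'.IsMin (G.d.map (l + 1) z) := G.isMin_d hl
  suffices hlow : S'.LowLt b (G.d.map (l + 1) z) from
    (G.hS'.lt_of_low_right hlow (G.hS'.not_loop_of_min hmin)).resolve_right hmin.not_lt
  obtain ⟨r, hr, hle⟩ := lowLt_iff.1 h
  rw [γ_j] at hle
  rw [δ_i] at hr
  obtain ⟨r, hr, rfl⟩ := hr
  obtain ⟨g, hg⟩ := G.d_surj l hlk (S'.γ b)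
  rw [← hg, j_d] at hle
  have hne : G.c.map l g ≠ r := fun e => by
    refine Set.disjoint_left.1 hd (.inl rfl) ?_
    rw [γ_j, ← hg, j_d, e]
    exact .inr ⟨r, hr, rfl⟩
  have hlt : S.UpLt (G.c.map l g) r := (G.upLe_of_i hle).resolve_left hne
  -- Common faces are not internal, so the relation can be moved from `δ a` to the domain of the
  -- maximal face above `a`.
  obtain ⟨r', hr', hle'⟩ := G.hS.exists_le_δ_max hz (G.isMax_c hl) (G.c_nonInt l hl g) hr hlt
  rw [G.c.δ_map] at hr'
  obtain ⟨ρ, hρ, rfl⟩ := hr'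
  refine lowLt_iff.2 ⟨_, G.d.mem_δ hρ, ?_⟩
  rw [← hg]
  rcases hle' with e | hlt'
  · rcases G.fibre l hl _ _ e with e' | e' | e'
    · exact .inl (congrArg _ e')
    · exact .inr (G.d.upLt (G.d_inj l) e')
    · exfalso
      obtain ⟨m, hm, hs, hms⟩ := G.hS'.exists_min_head (G.d.upLt (G.d_inj l) e')
      obtain rfl := G.hS'.min_eq_of_δ hm hmin hs (G.d.mem_δ hρ)
      have hjs := G.j_eq_of_between hl (upLe_of_mem hs) hms (by rw [j_d, j_d, e])
      have hloop := G.isLoop_c hl hs hjs.symm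
      have h₁ := G.hS.loop_of_le hz hloop
      rw [h₁.1.eq hr, h₁.2, e, hloop.eq (G.c.mem_δ hρ)] at hlt
      exact G.hS.upLt_irrefl _ hlt
  · exact .inr (G.d.upLt (G.d_inj l) (G.reflect l hl _ _ hlt'))

theorem PLt_of_low (p q : G.PH.face (l + 1)) (hd : Disjoint (G.PH.θ p) (G.PH.θ q))
    (h : G.PH.LowLt p q) : G.PLt p q := by
  rcases G.face_cases p with ⟨a, rfl⟩ | ⟨a, ha, rfl⟩ <;>
    rcases G.face_cases q with ⟨b, rfl⟩ | ⟨b, hb, rfl⟩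
  · rw [lt_ii]
    rw [θ_i, θ_i] at hd
    have h := G.lowLt_of_i h
    obtain ⟨t, ht, -⟩ := lowLt_iff.1 h
    exact (G.hS.lt_iff_lowLt a b (G.hS.thetaDisjoint ⟨t, ht⟩ (disjoint_of_image hd))).2 h
  · by_cases hl : l + 1 = k
    · exact G.lt_ij_of_low hl hd h
    · have hk := G.le_of_not_mem hb
      rw [G.lt_ij_above (by omega)]
      refine ⟨?_, h⟩
      by_contra hlk
      obtain ⟨t, ht, hle⟩ := lowLt_iff.1 h
      rw [γ_i] at hle
      rw [δ_j] at ht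
      obtain ⟨t, ht, rfl⟩ := ht
      rcases hle with e | hlt
      · exact G.not_i_eq_j (by omega) e
      · obtain ⟨z, -⟩ := G.upLt_of_ij (by omega) hlt
        exact (G.X_empty l (by omega)).false z
  · by_cases hl : l + 1 = k
    · exact G.lt_ji_of_low hl hd h
    · exfalso
      have hk := G.le_of_not_mem ha
      obtain ⟨t, ht, hle⟩ := lowLt_iff.1 h
      rcases hle with e | hlt
      · exact Set.disjoint_left.1 hd (.inl rfl) (.inr (e ▸ ht))
      · rw [γ_j] at hlt
        rw [δ_i] at ht
        obtain ⟨t, ht, rfl⟩ := ht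
        exact G.exists_of_upLt_ji (by omega) hlt
  · rw [lt_jj]
    have hk := G.le_of_not_mem ha
    obtain ⟨t, ht, hle⟩ := lowLt_iff.1 h
    have hne : G.PH.γ (G.j a) ≠ t := fun e =>
      Set.disjoint_left.1 hd (.inl rfl) (.inr (e ▸ ht))
    rw [γ_j] at hle hne
    rw [δ_j] at ht
    obtain ⟨t, ht, rfl⟩ := ht
    have hlt := hle.resolve_left hne
    have hlt : S'.UpLt (S'.γ a) t := by
      by_cases hl : l + 1 = k
      · exact G.upLt_of_j_pred hl hlt
      · exact G.upLt_of_jj (by omega) hlt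
    rw [θ_j, θ_j] at hd
    exact (G.hS'.lt_iff_lowLt a b (G.hS'.thetaDisjoint ⟨t, ht⟩ (disjoint_of_image hd))).2
      (lowLt_iff.2 ⟨t, ht, hlt.le⟩)

/-! ### Pencil linearity -/

theorem pencil_ij_mid (hl : l + 1 = k) {a : S.face (l + 1)} {b : S'.face (l + 1)}
    (hb : b ∉ Set.range (G.d.map (l + 1))) (hd : (G.PH.θ (G.i a) ∩ G.PH.θ (G.j b)).Nonempty) :
    (G.PLt (G.i a) (G.j b) ∨ G.PLt (G.j b) (G.i a)) ∨ G.PH.UpLt (G.i a) (G.j b) := by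
  have hlk : l < k := by omega
  rw [θ_i, θ_j] at hd
  obtain ⟨_, ⟨x, hx, rfl⟩, τ, hτ, e⟩ := hd
  obtain ⟨τ, rfl, rfl⟩ := G.j_eq_i e
  have hn := G.c_nonInt l hl τ
  obtain ⟨z, hz⟩ := G.exists_z hl a
  have hxz := G.hS.mem_θ_of_nonInt hz hn hx
  rw [G.c.θ_map] at hxz
  obtain ⟨σ, hσ, eσ⟩ := hxz
  have hσ' : G.d.map l σ ∈ S'.θ (G.d.map (l + 1) z) := by
    rw [G.d.θ_map]
    exact ⟨σ, hσ, rfl⟩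
  have hmin : S'.IsMin (G.d.map (l + 1) z) := G.isMin_d hl
  -- `σ` and `τ` may be different cuts over one face of `S`; being `<⁺`-comparable, they still make
  -- `z` and `b` comparable in `S'`.
  rcases G.hS'.cmp_of_θ' hσ' hτ (G.d.upCmp (G.d_inj l) (G.fibre l hl _ _ eσ)) with
    rfl | h | h | h | h
  · exact (hb ⟨z, rfl⟩).elim
  · exact .inl (.inl ((G.lt_ij hl hz).2 h))
  · refine .inl (.inr ((G.lt_ji hl hz).2 ⟨h, ?_⟩))
    obtain ⟨s, hs, hle⟩ := G.hS'.low_of_lt h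
    rw [G.d.δ_map] at hs
    obtain ⟨σ', hσ', rfl⟩ := hs
    obtain ⟨g, hg⟩ := G.d_surj l hlk (S'.γ b)
    rw [← hg] at hle
    have h₁ : S.UpLe (G.c.map l g) (G.c.map l σ') := by
      rcases hle with e | h'
      exacts [.inl (congrArg _ (G.d_inj l e)), G.upLe_c_of_upLt_d hl h']
    have h₂ : S.UpLe (G.c.map l τ) (G.c.map l g) := by
      have : S'.UpLe (G.d.map l τ) (G.d.map l g) := by
        rw [hg]
        exact hτ.elim (fun e => .inl e) upLe_of_mem
      rcases this with e | h'
      exacts [.inl (congrArg _ (G.d_inj l e)), G.upLe_c_of_upLt_d hl h']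
    have hσ'' := G.c.mem_δ hσ'
    have h₃ := upLe_of_mem hσ''
    have fin : G.c.map l τ ∈ S.δ a → G.c.map l g = G.c.map l τ →
        G.PH.LowLt (G.j b) (G.i a) := by
      intro hm e
      refine lowLt_iff.2 ⟨G.i (G.c.map l τ), ⟨_, hm, rfl⟩, .inl ?_⟩
      rw [γ_j, ← hg, j_d, e]
    have top : G.c.map l τ = S.γ (G.c.map (l + 1) z) →
        G.c.map l g = G.c.map l τ ∧ S.IsLoop (G.c.map (l + 1) z) := by
      intro e
      have e₁ := G.hS.le_antisymm h₂ (h₁.trans (h₃.trans (.inl e.symm)))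
      refine ⟨e₁.symm, ?_⟩
      by_contra hn
      have := (h₂.trans h₁).trans_lt (upLt_of_mem hn hσ'')
      rw [e] at this
      exact G.hS.upLt_irrefl _ this
    have inδ : G.c.map l τ ∈ S.δ a → G.PH.LowLt (G.j b) (G.i a) := by
      intro hm
      rcases G.hS.δ_cases_of_nonInt hz hn hm with h' | ⟨-, -, h'⟩
      · have e₁ : G.c.map l τ = G.c.map l σ' := by
          refine G.hS.δ_unique h' hσ'' ?_
          rcases h₂.trans h₁ with e | e
          exacts [.inl e, .inr (.inl e)]
        exact fin hm (G.hS.le_antisymm (e₁ ▸ h₁) h₂)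
      · exact fin hm (top h').1
    rcases hx with e | hm
    · by_cases hal : S.IsLoop a
      · exact inδ (e ▸ hal.mem)
      · have := G.hS.γ_eq_of_nonInt hz (e ▸ hn) hal
        exact (hal (G.hS.loop_of_le hz (top (e.trans this)).2).1).elim
    · exact inδ hm
  · refine .inr ((G.upLe_i hz).trans_lt ?_)
    have := G.upLt_j (l := l + 1) (by omega) h
    rwa [j_d] at this
  · exact (hmin.not_lt h).elim

theorem pencil_ij (a : S.face (l + 1)) {b : S'.face (l + 1)}
    (hb : b ∉ Set.range (G.d.map (l + 1))) (hd : (G.PH.θ (G.i a) ∩ G.PH.θ (G.j b)).Nonempty) :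
    (G.PLt (G.i a) (G.j b) ∨ G.PLt (G.j b) (G.i a)) ∨ G.PH.UpLt (G.i a) (G.j b) := by
  by_cases hl : l + 1 = k
  · exact G.pencil_ij_mid hl hb hd
  have hk := G.le_of_not_mem hb
  rw [θ_i, θ_j] at hd
  obtain ⟨_, ⟨x, hx, rfl⟩, τ, hτ, e⟩ := hd
  obtain ⟨w, rfl, rfl⟩ := G.j_eq_i e
  have hlk : l = k := by
    by_contra hlk
    exact (G.X_empty l (by omega)).false w
  refine .inl (.inl ((G.lt_ij_above (by omega)).2 ⟨by omega, ?_⟩))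
  -- The shared face is a common `k`-face. Maximal in `S` and minimal in `S'`, it must be the
  -- codomain of `a` and lie in the domain of `b`.
  have hγ : G.c.map l w = S.γ a := by
    rcases hx with e | hm
    · exact e
    · by_contra hne
      exact (G.isMax_c hlk) ⟨a, fun hl => hne (hl.eq hm), hm⟩
  have hδ : G.d.map l w ∈ S'.δ b := by
    rcases hτ with e | hm
    · by_cases hbl : S'.IsLoop b
      · exact e ▸ hbl.mem
      · exact (G.isMin_d hlk ⟨b, hbl, e.symm⟩).elim
    · exact hm
  refine lowLt_iff.2 ⟨G.j (G.d.map l w), ?_, .inl ?_⟩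
  · rw [δ_j]
    exact ⟨_, hδ, rfl⟩
  · rw [γ_i, j_d, hγ]

theorem pencil (p q : G.PH.face (l + 1)) (hne : p ≠ q) (hd : (G.PH.θ p ∩ G.PH.θ q).Nonempty) :
    (G.PLt p q ∨ G.PLt q p) ∨ (G.PH.UpLt p q ∨ G.PH.UpLt q p) := by
  rcases G.face_cases p with ⟨a, rfl⟩ | ⟨a, ha, rfl⟩ <;>
    rcases G.face_cases q with ⟨b, rfl⟩ | ⟨b, hb, rfl⟩
  · rw [θ_i, θ_i] at hd
    obtain ⟨_, ⟨x, hx, rfl⟩, y, hy, e⟩ := hd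
    obtain rfl := G.i_inj e
    rw [lt_ii, lt_ii]
    exact (G.hS.pencil a b (fun e => hne (e ▸ rfl)) ⟨y, hx, hy⟩).imp id
      (Or.imp G.upLt_i G.upLt_i)
  · exact (G.pencil_ij a hb hd).imp id .inl
  · rw [Set.inter_comm] at hd
    exact (G.pencil_ij b ha hd).imp Or.symm .inr
  · rw [θ_j, θ_j] at hd
    obtain ⟨_, ⟨x, hx, rfl⟩, y, hy, e⟩ := hd
    have hk := G.le_of_not_mem ha
    have hcmp : S'.UpCmp x y := by
      by_cases hl : l + 1 = k
      · exact G.cmp_of_j_eq hl e.symm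
      · exact .inl (G.j_inj hl e.symm)
    rw [lt_jj, lt_jj]
    rcases G.hS'.cmp_of_θ' hx hy hcmp with rfl | h | h | h | h
    · exact (hne rfl).elim
    · exact .inl (.inl h)
    · exact .inl (.inr h)
    · exact .inr (.inl (G.upLt_j (by omega) h))
    · exact .inr (.inr (G.upLt_j (by omega) h))

/-! ### Pencil linearity for faces with empty domain -/

/-- Two members of `δ y` that meet at `τ` in `P` do so in `S'` only up to comparability. Either `τ`
falls strictly inside a non-loop of `δ y`, or the climb through successive non-loops of `δ y` meets
it as a junction. -/
theorem int_or_intUnder (hl : l + 1 = k) {y : S'.face (l + 2)} {τ : S'.face l}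
    (h : G.j τ ∈ G.PH.ι (G.j y)) : τ ∈ S'.ι y ∨ ∃ x ∈ S'.δ y, S'.IntUnder τ x := by
  obtain ⟨e, he, e', he', hel, hel', eq₁, t, ht, eq₂⟩ := G.jH.exists_of_mem_ι h
  have hel₁ : ¬ S'.IsLoop e := fun h => hel (G.isLoop_j h)
  have hel₂ : ¬ S'.IsLoop e' := fun h => hel' (G.isLoop_j h)
  change G.j (S'.γ e) = G.j τ at eq₁
  change G.j t = G.j τ at eq₂
  have h₁ : S'.UpLe (S'.γ e) τ ∨ S'.UpLt τ (S'.γ e) := (G.cmp_of_j_eq hl eq₁).le_or_le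
  have h₂ : S'.UpLe τ t ∨ S'.UpLt t τ := (G.cmp_of_j_eq hl eq₂.symm).le_or_le
  rcases h₁ with h₁ | h₁
  swap
  · obtain ⟨y₁, hy₁, hlt, rfl⟩ := G.exists_inside hl hel eq₁.symm h₁
    exact .inr ⟨e, he, G.hS'.intUnder_of_lt hlt hy₁ fun e => G.hS'.upLt_irrefl _ (e ▸ h₁)⟩
  have between : ∀ x ∈ S'.δ y, ¬ S'.IsLoop x → ∀ s ∈ S'.δ x, S'.UpLt s τ → S'.UpLt τ (S'.γ x) →
      ∃ x ∈ S'.δ y, S'.IntUnder τ x := by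
    intro x hx hxl s hs hsτ hτ
    obtain ⟨m, hm, hmx, rfl⟩ := G.hS'.exists_min_between hxl hs hsτ hτ
    exact ⟨x, hx, G.hS'.intUnder_of_lt hmx (G.hS'.not_loop_of_min hm)
      fun e => G.hS'.upLt_irrefl _ (e ▸ hτ)⟩
  rcases h₂ with h₂ | h₂
  swap
  · exact .inr (between e' he' hel₂ t ht h₂ (G.lt_γ_of_j_eq hl hel' ht eq₂ h₂))
  have hlt : S'.UpLt τ (S'.γ (S'.γ y)) :=
    h₂.trans_lt ((upLt_of_mem hel₂ ht).trans_le (G.hS'.γ_le he'))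
  suffices H : ∀ v, ∀ x ∈ S'.δ y, ¬ S'.IsLoop x → S'.γ x = v → S'.UpLe v τ →
    τ ∈ S'.ι y ∨ ∃ x ∈ S'.δ y, S'.IntUnder τ x from H _ e he hel₁ rfl h₁
  intro v
  induction v using (G.hS'.wf' l).induction with
  | _ v ih =>
    rintro x hx hxl rfl hle
    rcases G.hS'.γ_eq_or_mem hx with e₁ | ⟨x', hx', hxl', hm⟩
    · exact (G.hS'.not_lt_of_le hle (e₁ ▸ hlt)).elim
    rcases hle with e₁ | hlt'
    · exact .inl ⟨x, hx, x', hx', hxl, hxl', e₁, e₁ ▸ hm⟩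
    · rcases (G.hS'.cmp_of_lt_lt (upLt_of_mem hxl' hm) hlt').le_or_le with h' | h'
      · exact ih _ (upLt_of_mem hxl' hm) x' hx' hxl' rfl h'
      · exact .inr (between x' hx' hxl' _ hm hlt' h')

theorem not_loop_of_ι {α : G.PH.face (l + 2)} {p : G.PH.face l} (hp : p ∈ G.PH.ι α) :
    ¬ G.PH.IsLoop α := by
  intro hα
  obtain ⟨e, he, e', he', hl, hl', rfl, hm⟩ := hp
  rw [hα.eq he', ← hα.eq he] at hm
  exact G.upLt_irrefl _ (upLt_of_mem hl hm)

theorem pencil_empty_jj (hl : l + 1 = k) {x y : S'.face (l + 2)} (hx : S'.δ x = ∅)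
    (h : G.j (S'.γ (S'.γ x)) ∈ G.PH.ι (G.j y)) : S'.lt x y ∨ S'.UpLt x y := by
  have hyl : ¬ S'.IsLoop y := fun hl => G.not_loop_of_ι h (G.isLoop_j hl)
  rcases G.int_or_intUnder hl h with h | ⟨x', hx', α, hα, hle, hι⟩
  · exact G.hS'.pencil_empty x y hx h
  · have hlow : S'.LowLt α y := lowLt_iff.2 ⟨x', hx', hle⟩
    have hlt : S'.lt α y := by
      refine (G.hS'.lt_of_low_left hlow hα).resolve_right fun hlt => ?_
      exact G.hS'.not_lt_of_le ((G.hS'.γ_mono hlt).trans hle) (upLt_of_mem hyl hx')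
    rcases G.hS'.pencil_empty x α hx hι with h' | h'
    · exact .inl (G.hS'.lt_trans _ _ _ h' hlt)
    · exact .inl (G.hS'.lt_of_upLt_lt h' hlt)

/-- The shared face is not internal in `S`, so it is still a face of the maximal `m` above `γ x`. In
`S'` this `m` is minimal and touches a face internal to `y` or to something below `δ y`, which puts
it under a member of `δ y`. -/
theorem pencil_empty_ij_succ (hl : l + 1 = k) {x : S.face (l + 2)} {y : S'.face (l + 2)}
    (hx : S.δ x = ∅) (h : G.i (S.γ (S.γ x)) ∈ G.PH.ι (G.j y)) : G.PLt (G.i x) (G.j y) := by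
  rw [G.lt_ij_above (by omega)]
  refine ⟨by omega, ?_⟩
  obtain ⟨m, hm⟩ := G.exists_z hl (S.γ x)
  have hql := (G.hS.loop_of_empty hx).1
  obtain ⟨e, he, -, -, -, -, e₁, -⟩ := G.jH.exists_of_mem_ι h
  obtain ⟨w, -, e₂⟩ := G.j_eq_i e₁
  have hn : S.NonInt (S.γ (S.γ x)) := e₂ ▸ G.c_nonInt l hl w
  have hθ := G.hS.mem_θ_of_nonInt hm hn (.inl rfl)
  rw [G.c.θ_map] at hθ
  obtain ⟨σ, hσ, e₃⟩ := hθ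
  have hσ' : G.d.map l σ ∈ S'.θ (G.d.map (l + 1) m) := by
    rw [G.d.θ_map]
    exact ⟨σ, hσ, rfl⟩
  rw [← e₃, ← j_d] at h
  have hmin : S'.IsMin (G.d.map (l + 1) m) := G.isMin_d hl
  have key : ∀ α : S'.face (l + 2), G.d.map l σ ∈ S'.ι α →
      ∃ r ∈ S'.δ α, S'.UpLe (G.d.map (l + 1) m) r := by
    rintro α ⟨e, he, e', he', hel, hel', e₁, hm'⟩
    rcases hσ' with h' | h'
    · exact ⟨e, he, G.hS'.min_le_of_γ hmin hel (h'.symm.trans e₁.symm)⟩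
    · exact ⟨e', he', G.hS'.min_le_of_δ hmin hel' h' hm'⟩
  obtain ⟨r, hr, hle⟩ : ∃ r ∈ S'.δ y, S'.UpLe (G.d.map (l + 1) m) r := by
    rcases G.int_or_intUnder hl h with h | ⟨x', hx', α, hα, hle, hι⟩
    · exact key y h
    · obtain ⟨r, hr, hle'⟩ := key α hι
      exact ⟨x', hx', hle'.trans ((upLe_of_mem hr).trans hle)⟩
  refine lowLt_iff.2 ⟨G.j r, ?_, ?_⟩
  · rw [δ_j]
    exact ⟨r, hr, rfl⟩
  · rw [γ_i]
    refine (G.upLe_i hm).trans ?_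
    rw [← j_d]
    exact G.upLe_j hle

/-- A codimension two face of `x` remains one of the common face `z` above `x`. If it comes from the
empty domain of `z`, the axiom of `S'` applies; otherwise `lt_or_le_of_int` takes its place. -/
theorem pencil_empty_ij_mid (hl : l + 2 = k) {x : S.face (l + 2)} {y : S'.face (l + 2)}
    (hy : y ∉ Set.range (G.d.map (l + 2)))
    (hx : S.δ x = ∅) (h : G.i (S.γ (S.γ x)) ∈ G.PH.ι (G.j y)) :
    G.PLt (G.i x) (G.j y) ∨ G.PH.UpLt (G.i x) (G.j y) := by
  obtain ⟨z, hz⟩ := G.exists_z hl x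
  obtain ⟨v, hv, e⟩ := G.jH.mem_ι_of_map (G.j_inj (by omega)) h
  change G.j v = _ at e
  have hmin : S'.IsMin (G.d.map (l + 2) z) := G.isMin_d hl
  suffices H : S'.lt (G.d.map (l + 2) z) y ∨ S'.UpLe (G.d.map (l + 2) z) y by
    rcases H with H | H | H
    · exact .inl ((G.lt_ij hl hz).2 H)
    · exact (hy ⟨z, H⟩).elim
    · refine .inr ((G.upLe_i hz).trans_lt ?_)
      have := G.upLt_j (l := l + 2) (by omega) H
      rwa [j_d] at this
  have hε : S.γ (S.γ x) ∈ S.ε x := by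
    rw [(G.hS.loop_of_empty hx).2]
    rfl
  have hcz : S.γ (S.γ x) ∈ S.ε (G.c.map _ z) ∨
      ∃ f ∈ S.δ (G.c.map _ z), S.γ (S.γ x) ∈ S.θ f := by
    rcases hz with rfl | hz
    exacts [.inl hε, G.hS.mem_εθ_of_lt hz (.inl hε)]
  rcases hcz with hc | ⟨f, hf, hc⟩
  · have hδ : S.δ (G.c.map _ z) = ∅ := by
      rcases S.δ_cases (G.c.map _ z) with ⟨-, e'⟩ | ⟨e', -⟩
      · rw [e'] at hc
        exact hc.elim
      · exact e'
    have hδ' : S'.δ (G.d.map _ z) = ∅ := by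
      rw [G.c.δ_map, Set.image_eq_empty] at hδ
      rw [G.d.δ_map, hδ, Set.image_empty]
    rw [(G.hS.loop_of_empty hδ).2] at hc
    have e' : S'.γ (S'.γ (G.d.map _ z)) = v := by
      refine G.j_inj (by omega) ?_
      rw [e, hc, ← G.d.map_γ, ← G.d.map_γ, j_d, G.c.map_γ, G.c.map_γ]
    exact (G.hS'.pencil_empty _ y hδ' (e' ▸ hv)).imp id .inr
  · rw [G.c.δ_map] at hf
    obtain ⟨φ, hφ, rfl⟩ := hf
    rw [G.c.θ_map] at hc
    obtain ⟨w, hw, e'⟩ := hc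
    have e'' : G.d.map l w = v := by
      refine G.j_inj (by omega) ?_
      rw [e, j_d, e']
    refine G.hS'.lt_or_le_of_int hmin (G.d.mem_δ hφ) ?_ hv
    rw [G.d.θ_map]
    exact ⟨w, hw, e''⟩

/-- What is internal to `y` is internal to `z` above it, so the axiom of `S'` gives `x <~ z`. The
required `<⁻` comes from `exists_le_δ_of_int`, since the loop `γ x` is common and not internal in
`S`. -/
theorem pencil_empty_ji_mid (hl : l + 2 = k) {x : S'.face (l + 2)} {y : S.face (l + 2)}
    (hx : S'.δ x = ∅) (h : G.j (S'.γ (S'.γ x)) ∈ G.PH.ι (G.i y)) :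
    G.PLt (G.j x) (G.i y) := by
  obtain ⟨z, hz⟩ := G.exists_z hl y
  obtain ⟨u, hu, e⟩ := G.iH.mem_ι_of_map G.i_inj h
  change G.i u = _ at e
  have hmin : S'.IsMin (G.d.map (l + 2) z) := G.isMin_d hl
  have huz : u ∈ S.ι (G.c.map _ z) := by
    rcases hz with rfl | hz
    exacts [hu, G.hS.int_of_lt hz hu]
  obtain ⟨w, hw, rfl⟩ := G.c.mem_ι_of_map (G.c_inj l (by omega)) huz
  have hw' := G.d.mem_ι (G.d_inj l) hw
  have e' : G.d.map l w = S'.γ (S'.γ x) := by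
    refine G.j_inj (by omega) ?_
    rw [← e, j_d]
  rw [e'] at hw'
  have hlt : S'.lt x (G.d.map _ z) :=
    (G.hS'.pencil_empty x _ hx hw').resolve_right hmin.not_lt
  rw [G.lt_ji hl hz]
  refine ⟨hlt, ?_⟩
  obtain ⟨g, hg⟩ := G.d_surj (l + 1) (by omega) (S'.γ x)
  have hgl : G.X.IsLoop g := by
    refine G.d.isLoop_of_map (G.d_inj l) ?_
    rw [hg]
    exact (G.hS'.loop_of_empty hx).1
  have hcg : S.γ (G.c.map (l + 1) g) = G.c.map l w := by
    rw [← G.c.map_γ]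
    congr 1
    refine G.d_inj l ?_
    rw [G.d.map_γ, hg, e']
  obtain ⟨r, hr, hle⟩ := G.hS.exists_le_δ_of_int (G.c_nonInt (l + 1) hl g) (G.c.isLoop hgl)
    (hcg ▸ hu)
  refine lowLt_iff.2 ⟨G.i r, ⟨r, hr, rfl⟩, ?_⟩
  rw [γ_j, ← hg, j_d]
  exact G.upLe_i hle

theorem pencil_empty (p q : G.PH.face (l + 2)) (hp : G.PH.δ p = ∅)
    (h : G.PH.γ (G.PH.γ p) ∈ G.PH.ι q) : G.PLt p q ∨ G.PH.UpLt p q := by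
  rcases G.face_cases p with ⟨a, rfl⟩ | ⟨a, ha, rfl⟩ <;>
    rcases G.face_cases q with ⟨b, rfl⟩ | ⟨b, hb, rfl⟩
  · rw [δ_i] at hp
    replace hp := Set.image_eq_empty.1 hp
    obtain ⟨u, hu, e⟩ := G.iH.mem_ι_of_map G.i_inj h
    obtain rfl := G.i_inj e
    rw [lt_ii]
    exact (G.hS.pencil_empty a b hp hu).imp id G.upLt_i
  · rw [δ_i] at hp
    replace hp := Set.image_eq_empty.1 hp
    rw [γ_i, γ_i] at h
    have hk := G.le_of_not_mem hb
    by_cases hl : l + 2 = k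
    · exact G.pencil_empty_ij_mid hl hb hp h
    by_cases hl' : l + 1 = k
    · exact .inl (G.pencil_empty_ij_succ hl' hp h)
    -- From dimension `k` on, an internal face cannot be common.
    exfalso
    obtain ⟨v, hv, e⟩ := G.jH.mem_ι_of_map (G.j_inj (by omega)) h
    obtain ⟨w, rfl, -⟩ := G.j_eq_i e
    by_cases hlk : l = k
    · exact G.hS'.nonInt_of_min (G.isMin_d hlk) ⟨b, hv⟩
    · exact (G.X_empty l (by omega)).false w
  · rw [δ_j] at hp
    replace hp := Set.image_eq_empty.1 hp
    rw [γ_j, γ_j] at h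
    have hk := G.le_of_not_mem ha
    by_cases hl : l + 2 = k
    · exact .inl (G.pencil_empty_ji_mid hl hp h)
    exfalso
    obtain ⟨u, hu, e⟩ := G.iH.mem_ι_of_map G.i_inj h
    obtain ⟨w, -, rfl⟩ := G.j_eq_i e.symm
    by_cases hl' : l + 1 = k
    · exact G.c_nonInt l hl' w ⟨b, hu⟩
    by_cases hlk : l = k
    · obtain ⟨e, he, e', he', hel, hel', -, hm⟩ := hu
      exact G.isMax_c hlk ⟨e', hel', hm⟩
    · exact (G.X_empty l (by omega)).false w
  · rw [δ_j] at hp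
    replace hp := Set.image_eq_empty.1 hp
    rw [γ_j, γ_j] at h
    have hk := G.le_of_not_mem ha
    rw [lt_jj]
    by_cases hl : l + 1 = k
    · exact (G.pencil_empty_jj hl hp h).imp id (G.upLt_j (by omega))
    · obtain ⟨v, hv, e⟩ := G.jH.mem_ι_of_map (G.j_inj hl) h
      obtain rfl := G.j_inj hl e
      exact (G.hS'.pencil_empty a b hp hv).imp id (G.upLt_j (by omega))

/-- The glued hypergraph with its order. -/
noncomputable def P : OrdHypergraph.{u} where
  toHypergraph := G.PH
  lt := G.PLt

theorem isOrderedFS : G.P.IsOrderedFS where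
  nonempty := ⟨G.i G.hS.nonempty.some⟩
  glob_γ := G.glob_γ
  glob_δ_two := G.glob_δ'
  glob_δ := G.glob_δ
  discrete := G.discrete
  upLt_irrefl := G.upLt_irrefl
  lt_irrefl := G.PLt_irrefl
  lt_trans := G.PLt_trans
  upLt_linear := G.upLt_linear
  disjoint p q h := by
    rintro (h' | h') <;> rcases h with h | h
    exacts [(G.PLt_disjoint _ _ h).1 h', (G.PLt_disjoint _ _ h).2 h', (G.PLt_disjoint _ _ h).2 h',
      (G.PLt_disjoint _ _ h).1 h']
  lowLt_of_lt := G.lowLt_of_lt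
  lt_iff_lowLt p q h := ⟨G.lowLt_of_lt p q, G.PLt_of_low p q h.disjoint⟩
  pencil := G.pencil
  pencil_empty := G.pencil_empty
  loop_filling := G.loop_filling

end Gluing
-- The `k`-domain and `k`-codomain and their cuts.
theorem Hypergraph.generate_carrier {S : Hypergraph.{u}} (Y : S.Sub) (l : ℕ) :
    (S.generate Y.carrier).carrier l = Y.carrier l :=
  Set.Subset.antisymm (fun _ hx => hx Y fun _ => subset_rfl) fun _ hx _ hX => hX l hx

theorem OrdHypergraph.iso_hom_inv {S T : OrdHypergraph.{u}} (e : S ≅ T) {l : ℕ} (x : S.face l) :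
    e.inv.map l (e.hom.map l x) = x :=
  congrArg (fun f : S ⟶ S => f.map l x) e.hom_inv_id

theorem OrdHypergraph.iso_inv_hom {S T : OrdHypergraph.{u}} (e : S ≅ T) {l : ℕ} (x : T.face l) :
    e.hom.map l (e.inv.map l x) = x :=
  congrArg (fun f : T ⟶ T => f.map l x) e.inv_hom_id

theorem OrdHypergraph.iso_lt {S T : OrdHypergraph.{u}} (e : S ≅ T) {l : ℕ} (x y : S.face l) :
    T.lt (e.hom.map l x) (e.hom.map l y) ↔ S.lt x y := by
  refine ⟨fun h => ?_, e.hom.map_lt x y⟩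
  have := e.inv.map_lt _ _ h
  rwa [OrdHypergraph.iso_hom_inv, OrdHypergraph.iso_hom_inv] at this

namespace OrderedFS

variable (k : ℕ) (T : OrderedFS.{u}) {l : ℕ}

/-- The subhypergraph `c⁽ᵏ⁾ T`. -/
abbrev codSub : T.toOrd.Sub := T.toOrd.generate (codFaces k T.toOrd.toHypergraph)

/-- The subhypergraph `d⁽ᵏ⁾ T`. -/
abbrev domSub : T.toOrd.Sub := T.toOrd.generate (domFaces k T.toOrd.toHypergraph)

variable {k T}

/-- The generating set is already closed, because faces of maximal faces are not internal. -/
theorem mem_codSub {x : T.toOrd.face l} : x ∈ (codSub k T).carrier l ↔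
    l ≤ k ∧ (l = k → T.toOrd.IsMax x) ∧ (l + 1 = k → T.toOrd.NonInt x) := by
  let Y : T.toOrd.Sub :=
    { carrier := codFaces k T.toOrd.toHypergraph
      γ_mem := fun a ha => ⟨by have := ha.1; omega, fun h => by have := ha.1; omega,
        fun h => T.isOrderedFS.nonInt_γ_of_max (ha.2.1 h)⟩
      δ_mem := fun a ha x hx => ⟨by have := ha.1; omega, fun h => by have := ha.1; omega,
        fun h => T.isOrderedFS.nonInt_δ_of_max (ha.2.1 h) hx⟩
      ε_mem := fun a ha x hx => ⟨by have := ha.1; omega, fun h => by have := ha.1; omega,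
        fun h => by have := ha.1; omega⟩ }
  exact Set.ext_iff.1 (generate_carrier Y l) x

theorem mem_domSub {x : T.toOrd.face l} : x ∈ (domSub k T).carrier l ↔
    l ≤ k ∧ (l = k → T.toOrd.IsMin x) := by
  let Y : T.toOrd.Sub :=
    { carrier := domFaces k T.toOrd.toHypergraph
      γ_mem := fun a ha => ⟨by have := ha.1; omega, fun h => by have := ha.1; omega⟩
      δ_mem := fun a ha x hx => ⟨by have := ha.1; omega, fun h => by have := ha.1; omega⟩
      ε_mem := fun a ha x hx => ⟨by have := ha.1; omega, fun h => by have := ha.1; omega⟩ }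
  exact Set.ext_iff.1 (generate_carrier Y l) x

/-- The filler of a loop can be chosen minimal and so stays in `d⁽ᵏ⁾T`, while minimal faces of
dimension `k` are not loops. Hence there is just one cut over each face. -/
theorem not_mem_emptyLoops_domSub {x : T.toOrd.face l} {a : T.toOrd.face (l + 1)} :
    a ∉ emptyLoops (domSub k T) x := by
  rintro ⟨ha, hl, -, hn⟩
  obtain ⟨α, hα, rfl⟩ := T.isOrderedFS.loop_filling a hl
  obtain ⟨hk, hm⟩ := mem_domSub.1 ha
  have hk' : l + 1 ≠ k := fun e => hm e ⟨α, hα, rfl⟩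
  obtain ⟨β, hβ, e, hβm⟩ := T.isOrderedFS.exists_min_γ hα
  exact hn ⟨β, mem_domSub.2 ⟨by omega, fun _ => hβm⟩, hβ, e⟩

/-- A loop of dimension below `k` keeps a filler: a maximal one of dimension `k`, as loops of
dimension `k - 1` in `c⁽ᵏ⁾T` are not internal, or a minimal one further down. Stretching thus
matters only over faces of dimension `k - 1`. -/
theorem not_mem_emptyLoops_codSub (hl : l + 1 ≠ k) {x : T.toOrd.face l}
    {a : T.toOrd.face (l + 1)} : a ∉ emptyLoops (codSub k T) x := by
  rintro ⟨ha, hal, -, hn⟩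
  obtain ⟨α, hα, rfl⟩ := T.isOrderedFS.loop_filling a hal
  obtain ⟨hk, -, hi⟩ := mem_codSub.1 ha
  by_cases hk' : l + 1 + 1 = k
  · obtain ⟨β, hβ, e, hm⟩ := T.isOrderedFS.exists_max_γ hα (hi hk')
    exact hn ⟨β, mem_codSub.2 ⟨by omega, fun _ => hm, fun h => by omega⟩, hβ, e⟩
  · obtain ⟨β, hβ, e, hm⟩ := T.isOrderedFS.exists_min_γ hα
    exact hn ⟨β, mem_codSub.2 ⟨by omega, fun h => by omega,
      fun _ => T.isOrderedFS.nonInt_of_min hm⟩, hβ, e⟩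

theorem _root_.FaceStr.Cut.ext_of_empty {X : T.toOrd.Sub} {c c' : Cut T X l}
    (h : ∀ a, a ∉ emptyLoops X c.base) (e : c.base = c'.base) : c = c' := by
  refine Cut.ext e ?_
  have h₁ : c.lower = ∅ := Set.eq_empty_of_forall_notMem fun a ha => h a (c.lower_sub ha)
  have h₂ : c'.lower = ∅ :=
    Set.eq_empty_of_forall_notMem fun a ha => h a (e ▸ c'.lower_sub ha)
  rw [h₁, h₂]

/-- The least cut over a face. -/
def _root_.FaceStr.Cut.bot {X : T.toOrd.Sub} (x : T.toOrd.face l) (hx : x ∈ X.carrier l) :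
    Cut T X l where
  base := x
  lower := ∅
  base_mem := hx
  lower_sub := Set.empty_subset _
  isLower _ h := h.elim

theorem isMax_of_mem_emptyLoops (hl : l + 1 = k) {x : T.toOrd.face l} {a : T.toOrd.face (l + 1)}
    (ha : a ∈ emptyLoops (codSub k T) x) : T.toOrd.IsMax a :=
  (mem_codSub.1 ha.1).2.1 hl

theorem emptyLoops_lt (hl : l + 1 = k) {x : T.toOrd.face l} {a b : T.toOrd.face (l + 1)}
    (ha : a ∈ emptyLoops (codSub k T) x) (hb : T.toOrd.IsMax b) (hx : x ∈ T.toOrd.θ b)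
    (hab : a ≠ b) : T.toOrd.lt a b ∨ T.toOrd.lt b a := by
  refine (T.isOrderedFS.pencil a b hab ⟨x, .inl ha.2.2.1.symm, hx⟩).resolve_right ?_
  rintro (h | h)
  · exact (isMax_of_mem_emptyLoops hl ha).not_lt h
  · exact hb.not_lt h

/-- Cuts over the same face are joined by a chain of loops. -/
theorem cut_upLe (hl : l + 1 = k) : ∀ (n : ℕ) (c c' : Cut T (codSub k T) l),
    c.base = c'.base → c.lower ⊆ c'.lower → c'.lower.ncard = n → (kCod k T).UpLe c c' := by
  intro n
  induction n with
  | zero =>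
    intro c c' e hs hn
    have := T.toOrd.finite_face (l + 1)
    rw [Set.ncard_eq_zero] at hn
    rw [hn] at hs
    exact .inl (Cut.ext e ((Set.subset_empty_iff.1 hs).trans hn.symm))
  | succ n ih =>
    intro c c' e hs hn
    have := T.toOrd.finite_face (l + 1)
    by_cases heq : c.lower = c'.lower
    · exact .inl (Cut.ext e heq)
    have hne : (c'.lower \ c.lower).Nonempty :=
      Set.sdiff_nonempty.2 fun h => heq (hs.antisymm h)
    have hwf : WellFounded (fun a b : T.toOrd.face (l + 1) => T.toOrd.lt b a) := by
      have : IsTrans _ (fun a b : T.toOrd.face (l + 1) => T.toOrd.lt b a) :=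
        ⟨fun a b c h h' => T.isOrderedFS.lt_trans _ _ _ h' h⟩
      have : Std.Irrefl (fun a b : T.toOrd.face (l + 1) => T.toOrd.lt b a) :=
        ⟨fun a => T.isOrderedFS.lt_irrefl a⟩
      exact Finite.wellFounded_of_trans_of_irrefl _
    -- A `<~`-maximal loop of the difference. Stretching turns it into an arrow into `c'` from the
    -- cut with `a` removed, which is one step closer to `c`.
    obtain ⟨a, ⟨ha, ha'⟩, hmax⟩ := hwf.has_min _ hne
    have haE := c'.lower_sub ha
    have htop : ∀ b ∈ c'.lower, ¬ T.toOrd.lt a b := fun b hb h => by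
      by_cases hb' : b ∈ c.lower
      · exact ha' (c.isLower b hb' a (e ▸ haE) h)
      · exact hmax b ⟨hb, hb'⟩ h
    let c₁ : Cut T (codSub k T) l :=
      { base := c'.base
        lower := c'.lower \ {a}
        base_mem := c'.base_mem
        lower_sub := Set.sdiff_subset.trans c'.lower_sub
        isLower := fun b hb b' hb' h => ⟨c'.isLower b hb.1 b' hb' h, fun e => by
          rw [Set.mem_singleton_iff] at e
          exact htop b hb.1 (e ▸ h)⟩ }
    have cmp : ∀ b ∈ emptyLoops (codSub k T) c'.base, b ≠ a → T.toOrd.lt b a ∨ T.toOrd.lt a b :=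
      fun b hb hba => emptyLoops_lt hl hb (isMax_of_mem_emptyLoops hl haE)
        (.inl haE.2.2.1.symm) hba
    let α : Cut T (codSub k T) (l + 1) := Cut.bot a haE.1
    have hγ : (kCod k T).γ α = c' := by
      refine Cut.ext haE.2.2.1 ?_
      change {b ∈ emptyLoops _ (T.toOrd.γ a) | ¬ T.toOrd.lt a b} = c'.lower
      rw [haE.2.2.1]
      ext b
      refine ⟨fun hb => ?_, fun hb => ⟨c'.lower_sub hb, htop b hb⟩⟩
      by_cases hba : b = a
      · rwa [hba]
      · exact c'.isLower a ha b hb.1 ((cmp b hb.1 hba).resolve_right hb.2)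
    have hδ : c₁ ∈ (kCod k T).δ α := by
      refine ⟨?_, Cut.ext rfl ?_⟩
      · change c'.base ∈ T.toOrd.δ a
        rw [haE.2.1, haE.2.2.1]
        rfl
      · change c'.lower \ {a} = {b ∈ emptyLoops _ c'.base | T.toOrd.lt b a}
        ext b
        refine ⟨fun hb => ⟨c'.lower_sub hb.1, ?_⟩, fun hb => ⟨c'.isLower a ha b hb.1 hb.2, ?_⟩⟩
        · exact (cmp b (c'.lower_sub hb.1) hb.2).resolve_right (htop b hb.1)
        · rintro rfl
          exact T.isOrderedFS.lt_irrefl _ hb.2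
    have hle : (kCod k T).UpLe c₁ c' := by
      rw [← hγ]
      exact upLe_of_mem hδ
    refine UpLe.trans (ih c c₁ e (fun b hb => ⟨hs hb, ?_⟩) ?_) hle
    · rintro rfl
      exact ha' hb
    · have := Set.ncard_sdiff_singleton_of_mem ha
      change (c'.lower \ {a}).ncard = n
      omega

theorem cut_upLe_or (hl : l + 1 = k) (c c' : Cut T (codSub k T) l) (e : c.base = c'.base) :
    (kCod k T).UpLe c c' ∨ (kCod k T).UpLe c' c := by
  by_cases h : c.lower ⊆ c'.lower
  · exact .inl (cut_upLe hl _ c c' e h rfl)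
  · refine .inr (cut_upLe hl _ c' c e.symm (fun b hb => ?_) rfl)
    obtain ⟨a, ha, ha'⟩ := Set.not_subset.1 h
    have haE := c.lower_sub ha
    have hbE := c'.lower_sub hb
    rw [← e] at hbE
    by_cases hba : b = a
    · rwa [hba]
    · rcases emptyLoops_lt hl hbE (isMax_of_mem_emptyLoops hl haE) (.inl haE.2.2.1.symm) hba
        with h' | h'
      · exact c.isLower a ha b hbE h'
      · exact (ha' (c'.isLower b hb a (e ▸ haE) h')).elim

/-- A maximal non-loop `a` leaving the lower face lifts to an arrow. It is `<~`-above all empty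
loops on its domain face and `<~`-below those on its codomain, so chains of loops join its ends to
the prescribed cuts. -/
theorem cut_reflect (hl : l + 1 = k) (c c' : Cut T (codSub k T) l)
    (h : T.toOrd.UpLt c.base c'.base) : (kCod k T).UpLt c c' := by
  suffices H : ∀ x, T.toOrd.UpLt x c'.base → ∀ c : Cut T (codSub k T) l, c.base = x →
    (kCod k T).UpLt c c' from H _ h c rfl
  clear h c
  intro x
  induction x using (T.isOrderedFS.wf' l).induction with
  | _ x ih =>
    rintro h c rfl
    have hn : ∀ c : Cut T (codSub k T) l, T.toOrd.NonInt c.base :=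
      fun c => (mem_codSub.1 c.base_mem).2.2 hl
    obtain ⟨a, ha, hal, hxa, hle⟩ := T.isOrderedFS.exists_max_head h (hn c) (hn c')
    have hlt := upLt_of_mem hal hxa
    have ne : ∀ {x b}, b ∈ emptyLoops (codSub k T) x → b ≠ a := fun hb e => hal (e ▸ hb.2.1)
    let α : Cut T (codSub k T) (l + 1) :=
      Cut.bot a (mem_codSub.2 ⟨by omega, fun _ => ha, fun h => by omega⟩)
    obtain ⟨t, ht, e⟩ := α.bijOn_dom.surjOn hxa
    have h₁ : (kCod k T).UpLe c t := by
      refine cut_upLe hl _ c t e.symm (fun b hb => ?_) rfl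
      have hbE := c.lower_sub hb
      have : t.lower = {b ∈ emptyLoops _ t.base | T.toOrd.lt b a} := congrArg Cut.lower ht.2
      rw [this, e]
      refine ⟨hbE, (emptyLoops_lt hl hbE ha (.inr hxa) (ne hbE)).resolve_right fun h' => ?_⟩
      obtain ⟨s, hs, hle⟩ := T.isOrderedFS.low_of_lt h'
      rw [hbE.2.1, hbE.2.2.1, Set.mem_singleton_iff] at hs
      exact T.isOrderedFS.not_lt_of_le (hs ▸ hle) hlt
    have h₂ : (kCod k T).UpLt t ((kCod k T).γ α) :=
      upLt_of_mem (fun h' => hal ((ν T (codSub k T)).toHom.isLoop (a := α) h')) ht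
    have h₃ : (kCod k T).UpLe ((kCod k T).γ α) c' := by
      rcases hle with e' | hlt'
      · refine cut_upLe hl _ _ c' e' (fun b hb => ?_) rfl
        obtain ⟨hbE, hb'⟩ := hb
        rcases emptyLoops_lt hl hbE ha (.inl rfl) (ne hbE) with h' | h'
        · obtain ⟨s, hs, hle⟩ := T.isOrderedFS.low_of_lt h'
          rw [hbE.2.2.1] at hle
          exact (T.isOrderedFS.not_lt_of_le hle (upLt_of_mem hal hs)).elim
        · exact (hb' h').elim
      · exact (ih _ hlt hlt' _ rfl).le
    exact (h₁.trans_lt h₂).trans_le h₃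

end OrderedFS

/-! ### Gluing data of a composable pair. -/

namespace TensorPair

open OrderedFS

variable {k : ℕ} (X : TensorPair.{u} k) {l : ℕ}

theorem domMap_map (x : (kCod k X.fst).face l) :
    X.domMap.map l x = (X.glue.hom.map l x : Cut X.snd (domSub k X.snd) l).base := rfl

theorem mem_range_domMap (y : X.snd.toOrd.face l) :
    y ∈ Set.range (X.domMap.map l) ↔ y ∈ (domSub k X.snd).carrier l := by
  constructor
  · rintro ⟨x, rfl⟩
    exact Cut.base_mem _
  · intro hy
    let z : (kDom k X.snd).face l := Cut.bot y hy
    exact ⟨X.glue.inv.map l z, congrArg Cut.base (OrdHypergraph.iso_inv_hom X.glue z)⟩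

theorem mem_range_codMap (y : X.fst.toOrd.face l) :
    y ∈ Set.range (X.codMap.map l) ↔ y ∈ (codSub k X.fst).carrier l := by
  constructor
  · rintro ⟨x, rfl⟩
    exact Cut.base_mem _
  · exact fun hy => ⟨Cut.bot y hy, rfl⟩

theorem domMap_injective (l : ℕ) : Function.Injective (X.domMap.map l) := by
  intro x y h
  rw [domMap_map, domMap_map] at h
  have := Cut.ext_of_empty (fun a => not_mem_emptyLoops_domSub) h
  rw [← OrdHypergraph.iso_hom_inv X.glue x, this, OrdHypergraph.iso_hom_inv]

/-- The gluing data of a pair. -/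
def gluing : Gluing k X.fst.toOrd X.snd.toOrd where
  hS := X.fst.isOrderedFS
  hS' := X.snd.isOrderedFS
  X := kCod k X.fst
  c := X.codMap
  d := X.domMap
  lt_c _ _ := Iff.rfl
  lt_d x y := OrdHypergraph.iso_lt X.glue x y
  d_inj := X.domMap_injective
  d_surj l hl y := (X.mem_range_domMap y).2 (mem_domSub.2 ⟨hl.le, fun h => by omega⟩)
  d_range y := (X.mem_range_domMap y).trans
    (mem_domSub.trans ⟨fun h => h.2 rfl, fun h => ⟨le_rfl, fun _ => h⟩⟩)
  X_empty l hl := ⟨fun c => by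
    have := (mem_codSub.1 (Cut.base_mem c)).1
    omega⟩
  c_inj l hl _ _ h := Cut.ext_of_empty (fun _ => not_mem_emptyLoops_codSub hl) h
  c_range x := (X.mem_range_codMap x).trans
    (mem_codSub.trans ⟨fun h => h.2.1 rfl, fun h => ⟨le_rfl, fun _ => h, fun h => by omega⟩⟩)
  c_nonInt l hl x := (mem_codSub.1 (Cut.base_mem x)).2.2 hl
  fibre l hl x y e := by
    rcases cut_upLe_or hl x y e with (h | h) | (h | h)
    exacts [.inl h, .inr (.inl h), .inl h.symm, .inr (.inr h)]
  reflect l hl x y h := cut_reflect hl x y h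

end TensorPair

/-! ### The gluing as a pushout of local face structures. -/

theorem bijOn_image_of_comp {α β γ : Type*} {f : α → β} {g : β → γ} {s : Set α} {t : Set γ}
    (h : Set.BijOn (g ∘ f) s t) : Set.BijOn g (f '' s) t := by
  refine ⟨?_, ?_, ?_⟩
  · rintro _ ⟨x, hx, rfl⟩
    exact h.mapsTo hx
  · rintro _ ⟨x, hx, rfl⟩ _ ⟨y, hy, rfl⟩ e
    rw [h.injOn hx hy e]
  · intro z hz
    obtain ⟨x, hx, rfl⟩ := h.surjOn hz
    exact ⟨_, ⟨x, hx, rfl⟩, rfl⟩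

namespace Gluing

variable {k : ℕ} {S S' : OrdHypergraph.{u}} (G : Gluing k S S') {l : ℕ}

/-- The monotone morphism from `S`. -/
noncomputable def iO : S ⟶ G.P where
  toHom := G.iH
  map_lt _ _ h := G.lt_ii.2 h

/-- The monotone morphism from `S'`. -/
noncomputable def jO : S' ⟶ G.P where
  toHom := G.jH
  map_lt _ _ h := G.lt_jj.2 h

section desc

variable {Q : Hypergraph.{u}} (f : Hypergraph.Hom S.toHypergraph Q)
  (f' : Hypergraph.Hom S'.toHypergraph Q)

/-- The map on faces induced by a compatible pair of morphisms. -/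
def descMap (l : ℕ) (p : G.Face l) : Q.face l :=
  Sum.elim (f.map l) (fun b => f'.map l b.1) p

theorem descMap_i (a : S.face l) : G.descMap f f' l (G.i a) = f.map l a := rfl

theorem descMap_j (w : ∀ l (x : G.X.face l), f.map l (G.c.map l x) = f'.map l (G.d.map l x))
    (b : S'.face l) : G.descMap f f' l (G.j b) = f'.map l b := by
  by_cases hb : b ∈ Set.range (G.d.map l)
  · obtain ⟨z, rfl⟩ := hb
    rw [j_d, descMap_i, w]
  · rw [G.j_of_not_mem hb]
    rfl

/-- The morphism induced by a compatible pair of morphisms. -/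
def desc (w : ∀ l (x : G.X.face l), f.map l (G.c.map l x) = f'.map l (G.d.map l x)) :
    Hypergraph.Hom G.PH Q where
  map := G.descMap f f'
  map_γ p := by
    rcases G.face_cases p with ⟨a, rfl⟩ | ⟨b, -, rfl⟩
    · rw [γ_i, descMap_i, descMap_i, f.map_γ]
    · rw [γ_j, G.descMap_j f f' w, G.descMap_j f f' w, f'.map_γ]
  bijOn_δ p := by
    rcases G.face_cases p with ⟨a, rfl⟩ | ⟨b, -, rfl⟩
    · rw [δ_i, descMap_i]
      exact bijOn_image_of_comp (f.bijOn_δ a)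
    · rw [δ_j, G.descMap_j f f' w]
      -- The composite of `j` with the induced map is `f'`, which is injective on `δ b`; so the
      -- induced map is injective on the image of `δ b`.
      refine bijOn_image_of_comp ((f'.bijOn_δ b).congr fun b _ => ?_)
      exact (G.descMap_j f f' w b).symm
  map_ε p := by
    rcases G.face_cases p with ⟨a, rfl⟩ | ⟨b, -, rfl⟩
    · rw [ε_i, descMap_i, f.map_ε]
      exact (Set.image_image (G.descMap f f' _) G.i _).symm
    · rw [ε_j, G.descMap_j f f' w, f'.map_ε]
      refine Eq.trans ?_ (Set.image_image (G.descMap f f' _) G.j _).symm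
      exact Set.image_congr fun b _ => (G.descMap_j f f' w b).symm

end desc

theorem isLocal_c : OrdHypergraph.IsLocal G.c := fun _ _ x _ y _ => (G.lt_c x y).symm

theorem isLocal_d : OrdHypergraph.IsLocal G.d := fun _ _ x _ y _ => (G.lt_d x y).symm

theorem isLocal_i : OrdHypergraph.IsLocal G.iO := fun _ _ _ _ _ _ => G.lt_ii.symm

theorem isLocal_j : OrdHypergraph.IsLocal G.jO := fun _ _ _ _ _ _ => G.lt_jj.symm

/-- The local morphism induced by a compatible pair of local morphisms. -/
def descLoc {Q : LocalFS.{u}} (f : S.loc ⟶ Q) (f' : S'.loc ⟶ Q)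
    (w : ∀ l (x : G.X.face l), f.map l (G.c.map l x) = f'.map l (G.d.map l x)) :
    G.P.loc ⟶ Q where
  toHom := G.desc f.toHom f'.toHom w
  locLt_iff p := by
    rcases G.face_cases p with ⟨a, rfl⟩ | ⟨b, -, rfl⟩
    · rintro _ ⟨x, hx, rfl⟩ _ ⟨y, hy, rfl⟩
      refine Iff.trans ?_ (f.locLt_iff a x hx y hy)
      exact ⟨fun h => ⟨hx, hy, G.lt_ii.1 h.2.2⟩,
        fun h => ⟨⟨x, hx, rfl⟩, ⟨y, hy, rfl⟩, G.lt_ii.2 h.2.2⟩⟩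
    · intro x hx₀ y hy₀
      obtain ⟨x, hx, rfl⟩ : x ∈ G.j '' S'.δ b := G.δ_j b ▸ hx₀
      obtain ⟨y, hy, rfl⟩ : y ∈ G.j '' S'.δ b := G.δ_j b ▸ hy₀
      have e : ∀ {l} (b : S'.face l), (G.desc f.toHom f'.toHom w).map l (G.j b) = f'.map l b :=
        fun b => G.descMap_j f.toHom f'.toHom w b
      rw [e, e, e]
      refine Iff.trans ?_ (f'.locLt_iff b x hx y hy)
      exact ⟨fun h => ⟨hx, hy, G.lt_jj.1 h.2.2⟩,
        fun h => ⟨G.jH.mem_δ hx, G.jH.mem_δ hy, G.lt_jj.2 h.2.2⟩⟩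

theorem isLocalPushout : IsLocalPushout G.c G.d G.iO G.jO := by
  refine ⟨G.isLocal_c, G.isLocal_d, G.isLocal_i, G.isLocal_j, ?_⟩
  have w : OrdHypergraph.locMap G.c G.isLocal_c ≫ OrdHypergraph.locMap G.iO G.isLocal_i =
      OrdHypergraph.locMap G.d G.isLocal_d ≫ OrdHypergraph.locMap G.jO G.isLocal_j := by
    refine LocalFS.Hom.ext ?_
    funext l x
    exact (G.j_d x).symm
  have w' : ∀ s : Limits.PushoutCocone (OrdHypergraph.locMap G.c G.isLocal_c)
      (OrdHypergraph.locMap G.d G.isLocal_d), ∀ l (x : G.X.face l),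
      s.inl.map l (G.c.map l x) = s.inr.map l (G.d.map l x) := fun s l x =>
    congrArg (fun g : G.X.loc ⟶ s.pt => g.map l x) s.condition
  refine IsPushout.of_isColimit' ⟨w⟩ (Limits.PushoutCocone.IsColimit.mk _
    (fun s => G.descLoc s.inl s.inr (w' s)) (fun s => ?_) (fun s => ?_) (fun s m h₁ h₂ => ?_))
  · rfl
  · refine LocalFS.Hom.ext ?_
    funext l x
    exact G.descMap_j s.inl.toHom s.inr.toHom (w' s) x
  · refine LocalFS.Hom.ext ?_
    funext l p
    rcases G.face_cases p with ⟨a, rfl⟩ | ⟨b, -, rfl⟩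
    · exact congrArg (fun g : S.loc ⟶ s.pt => g.map l a) h₁
    · refine (congrArg (fun g : S'.loc ⟶ s.pt => g.map l b) h₂).trans ?_
      exact (G.descMap_j s.inl.toHom s.inr.toHom (w' s) b).symm

end Gluing

/-! ### The tensor functor and its transformations. -/

namespace TensorPair

variable {k : ℕ}

/-- The tensor of a pair. -/
noncomputable def tensorObj (X : TensorPair.{u} k) : OrderedFS.{u} :=
  ⟨X.gluing.P, X.gluing.isOrderedFS⟩

/-- The morphism from the first component to the tensor. -/
noncomputable def inl (X : TensorPair.{u} k) : X.fst ⟶ X.tensorObj := X.gluing.iO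

/-- The morphism from the second component to the tensor. -/
noncomputable def inr (X : TensorPair.{u} k) : X.snd ⟶ X.tensorObj := X.gluing.jO

theorem isTensorSquare (X : TensorPair.{u} k) : X.IsTensorSquare X.inl X.inr where
  isLocalPushoutSquare := X.gluing.isLocalPushout
  lt_below l hl p q := by
    constructor
    · rintro (h | ⟨a, b, h, rfl, rfl⟩ | ⟨hl, -⟩ | ⟨hl, -⟩ | ⟨hl, -⟩)
      · exact h
      · obtain ⟨a, rfl⟩ := X.gluing.d_surj l hl a
        obtain ⟨b, rfl⟩ := X.gluing.d_surj l hl b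
        rw [X.gluing.lt_d, ← X.gluing.lt_c] at h
        exact ⟨_, _, h, (X.gluing.j_d a).symm, (X.gluing.j_d b).symm⟩
      all_goals omega
    · exact .inl
  lt_mid p q := by
    have mixed : ∀ a b z, X.gluing.MixedAt a b z ↔ X.MixedAt a b z := fun a b z =>
      and_congr not_not (and_congr not_not Iff.rfl)
    constructor
    · rintro (h | h | ⟨-, a, b, z, hm, h⟩ | ⟨-, a, b, z, hm, h⟩ | ⟨hl, -⟩)
      · exact .inl h
      · exact .inr (.inl h)
      · exact .inr (.inr (.inl ⟨a, b, z, (mixed a b z).1 hm, h⟩))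
      · exact .inr (.inr (.inr ⟨a, b, z, (mixed a b z).1 hm, h⟩))
      · omega
    · rintro (h | h | ⟨a, b, z, hm, h⟩ | ⟨a, b, z, hm, h⟩)
      · exact .inl h
      · exact .inr (.inl h)
      · exact .inr (.inr (.inl ⟨rfl, a, b, z, (mixed a b z).2 hm, h⟩))
      · exact .inr (.inr (.inr (.inl ⟨rfl, a, b, z, (mixed a b z).2 hm, h⟩)))
  lt_succ p q := by
    constructor
    · rintro (h | h | ⟨hl, -⟩ | ⟨hl, -⟩ | ⟨-, h⟩)
      · exact .inl h
      · exact .inr (.inl h)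
      · omega
      · omega
      · exact .inr (.inr h)
    · rintro (h | h | h)
      · exact .inl h
      · exact .inr (.inl h)
      · exact .inr (.inr (.inr (.inr ⟨rfl, h⟩)))
  lt_above l hl p q := by
    constructor
    · rintro (h | h | ⟨hl, -⟩ | ⟨hl, -⟩ | ⟨hl, -⟩)
      · exact .inl h
      · exact .inr h
      all_goals omega
    · rintro (h | h)
      · exact .inl h
      · exact .inr (.inl h)

section map

variable {X Y : TensorPair.{u} k} (φ : X ⟶ Y)

/-- The first component of a morphism of pairs. -/
abbrev mapFst : X.fst.toOrd ⟶ Y.fst.toOrd := OrderedFS.homToOrd (Hom.fst φ)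

/-- The second component of a morphism of pairs. -/
abbrev mapSnd : X.snd.toOrd ⟶ Y.snd.toOrd := OrderedFS.homToOrd (Hom.snd φ)

theorem exists_common {l : ℕ} (z : X.gluing.X.face l) : ∃ z' : Y.gluing.X.face l,
    (mapFst φ).map l (X.gluing.c.map l z) = Y.gluing.c.map l z' ∧
    (mapSnd φ).map l (X.gluing.d.map l z) = Y.gluing.d.map l z' := by
  obtain ⟨g, h, h'⟩ := Hom.comm φ
  exact ⟨g.map l z, congrArg (fun f : kCod k X.fst ⟶ Y.fst.toOrd => f.map l z) h,
    congrArg (fun f : kCod k X.fst ⟶ Y.snd.toOrd => f.map l z) h'⟩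

theorem map_comm (l : ℕ) (x : X.gluing.X.face l) :
    ((mapFst φ).toHom.comp Y.gluing.iH).map l (X.gluing.c.map l x) =
      ((mapSnd φ).toHom.comp Y.gluing.jH).map l (X.gluing.d.map l x) := by
  obtain ⟨z, h, h'⟩ := exists_common φ x
  change Y.gluing.i ((mapFst φ).map l _) = Y.gluing.j ((mapSnd φ).map l _)
  rw [h, h', Gluing.j_d]

/-- The morphism of hypergraphs between tensors. -/
noncomputable def tensorHom : Hypergraph.Hom X.gluing.PH Y.gluing.PH :=
  X.gluing.desc _ _ (map_comm φ)

theorem tensorHom_i {l : ℕ} (a : X.fst.toOrd.face l) :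
    (tensorHom φ).map l (X.gluing.i a) = Y.gluing.i ((mapFst φ).map l a) := rfl

theorem tensorHom_j {l : ℕ} (b : X.snd.toOrd.face l) :
    (tensorHom φ).map l (X.gluing.j b) = Y.gluing.j ((mapSnd φ).map l b) :=
  X.gluing.descMap_j _ _ (map_comm φ) b

/-- Common faces go to common faces, so `lt_ij` and `lt_ji` transfer along the image of `z`. Their
uniform form matters, as the image of a non-maximal or non-minimal face need not be so again. -/
theorem tensorHom_lt : ∀ {l : ℕ} (p q : X.gluing.PH.face l), X.gluing.PLt p q →
    Y.gluing.PLt ((tensorHom φ).map l p) ((tensorHom φ).map l q)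
  | 0, p, q, h => (X.gluing.isOrderedFS.not_lt_zero h).elim
  | l + 1, p, q, h => by
    have hlow := (tensorHom φ).lowLt (X.gluing.lowLt_of_lt p q h)
    rcases h with ⟨a, b, h, rfl, rfl⟩ | ⟨a, b, h, rfl, rfl⟩ | ⟨hl, a, b, z, hm, rfl, rfl, h⟩ |
      ⟨hl, a, b, z, hm, rfl, rfl, h, -⟩ | ⟨hl, a, b, rfl, rfl, -⟩
    · rw [tensorHom_i, tensorHom_i]
      exact Y.gluing.lt_ii.2 ((mapFst φ).map_lt _ _ h)
    · rw [tensorHom_j, tensorHom_j]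
      exact Y.gluing.lt_jj.2 ((mapSnd φ).map_lt _ _ h)
    · obtain ⟨z', h₁, h₂⟩ := exists_common φ z
      rw [tensorHom_i, tensorHom_j]
      refine (Y.gluing.lt_ij hl (z := z') ?_).2 ?_
      · rw [← h₁]
        exact (mapFst φ).upLe hm.2.2
      · rw [← h₂]
        exact (mapSnd φ).map_lt _ _ h
    · obtain ⟨z', h₁, h₂⟩ := exists_common φ z
      rw [tensorHom_i, tensorHom_j] at hlow ⊢
      refine (Y.gluing.lt_ji hl (z := z') ?_).2 ⟨?_, hlow⟩
      · rw [← h₁]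
        exact (mapFst φ).upLe hm.2.2
      · rw [← h₂]
        exact (mapSnd φ).map_lt _ _ h
    · rw [tensorHom_i, tensorHom_j] at hlow ⊢
      exact (Y.gluing.lt_ij_above (by omega)).2 ⟨hl, hlow⟩

/-- The tensor of a morphism. -/
noncomputable def tensorMap : X.tensorObj ⟶ Y.tensorObj :=
  ({ toHom := tensorHom φ, map_lt := tensorHom_lt φ } : OrdHypergraph.Hom _ _)

end map

/-- Morphisms out of the tensor are determined by their values on the faces of the components. -/
theorem tensorObj_hom_ext {X : TensorPair.{u} k} {Q : OrdHypergraph.{u}} {f g : X.gluing.P ⟶ Q}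
    (h : ∀ l a, f.map l (X.gluing.i a) = g.map l (X.gluing.i a))
    (h' : ∀ l b, f.map l (X.gluing.j b) = g.map l (X.gluing.j b)) : f = g := by
  refine OrdHypergraph.Hom.ext ?_
  funext l p
  rcases X.gluing.face_cases p with ⟨a, rfl⟩ | ⟨b, -, rfl⟩
  exacts [h l a, h' l b]

/-- The `k`-tensor functor. -/
noncomputable def tensor (k : ℕ) : TensorPair.{u} k ⥤ OrderedFS.{u} where
  obj X := X.tensorObj
  map φ := tensorMap φ
  map_id X := tensorObj_hom_ext (fun _ _ => rfl) fun _ b => tensorHom_j (𝟙 X) b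
  map_comp {X Y Z} φ ψ := tensorObj_hom_ext (fun _ _ => rfl) fun l b => by
    refine (tensorHom_j (φ ≫ ψ) b).trans ?_
    exact ((congrArg ((tensorHom ψ).map l) (tensorHom_j φ b)).trans (tensorHom_j ψ _)).symm

/-- The natural transformation with components `inl`. -/
noncomputable def κ₀ (k : ℕ) : π₀.{u} k ⟶ tensor k where
  app X := X.inl
  naturality _ _ _ := rfl

/-- The natural transformation with components `inr`. -/
noncomputable def κ₁ (k : ℕ) : π₁.{u} k ⟶ tensor k where
  app X := X.inr
  naturality _ _ φ := OrdHypergraph.Hom.ext (funext fun _ => funext fun b =>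
    (tensorHom_j φ b).symm)

end TensorPair

/-! ### Reflection of globularity. -/

namespace Hypergraph.Hom

variable {S T : Hypergraph.{u}} {k : ℕ}

theorem domNonloop_map (f : Hom S T) (hf : Function.Injective (f.map k)) (a : S.face (k + 2)) :
    T.domNonloop (f.map (k + 2) a) = f.map (k + 1) '' S.domNonloop a := by
  ext x
  constructor
  · rintro ⟨hx, hl⟩
    rw [f.δ_map] at hx
    obtain ⟨x, hx, rfl⟩ := hx
    exact ⟨x, ⟨hx, fun h => hl (f.isLoop h)⟩, rfl⟩
  · rintro ⟨x, ⟨hx, hl⟩, rfl⟩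
    exact ⟨f.mem_δ hx, fun h => hl (f.isLoop_of_map hf h)⟩

theorem iUnion_domNonloop_map (f : Hom S T) (hf : Function.Injective (f.map k))
    (a : S.face (k + 2)) : ⋃ x ∈ T.domNonloop (f.map (k + 2) a), T.δ x =
      f.map k '' ⋃ x ∈ S.domNonloop a, S.δ x := by
  simp only [f.domNonloop_map hf, Set.biUnion_image, Set.image_iUnion, f.δ_map]

theorem γ_domNonloop_map (f : Hom S T) (hf : Function.Injective (f.map k))
    (a : S.face (k + 2)) : T.γ '' T.domNonloop (f.map (k + 2) a) =
      f.map k '' (S.γ '' S.domNonloop a) := by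
  simp only [f.domNonloop_map hf, Set.image_image, f.map_γ]

/-- Injectivity on faces of codimension two suffices, because it makes loops agree on both sides.
The projection of an unrolled loop is injective in every dimension where this is used. -/
theorem glob_γ_of_map (f : Hom S T) (hf : Function.Injective (f.map k)) (a : S.face (k + 2))
    (h : {T.γ (T.γ (f.map (k + 2) a))} = T.codDom (f.map (k + 2) a) \
      ⋃ x ∈ T.domNonloop (f.map (k + 2) a), T.δ x) :
    {S.γ (S.γ a)} = S.codDom a \ ⋃ x ∈ S.domNonloop a, S.δ x := by
  rw [f.iUnion_domNonloop_map hf, f.codDom_map, ← Set.image_sdiff hf, ← f.map_γ, ← f.map_γ,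
    ← Set.image_singleton] at h
  exact hf.image_injective h

theorem glob_δ_of_map (f : Hom S T) (hf : Function.Injective (f.map k)) (a : S.face (k + 2))
    (h : T.δ (T.γ (f.map (k + 2) a)) = T.domDom (f.map (k + 2) a) \
      T.γ '' T.domNonloop (f.map (k + 2) a)) :
    S.δ (S.γ a) = S.domDom a \ S.γ '' S.domNonloop a := by
  rw [f.γ_domNonloop_map hf, f.domDom_map, ← Set.image_sdiff hf, ← f.map_γ, f.δ_map] at h
  exact hf.image_injective h

theorem oneEq_of_map (f : Hom S T) (hf : Function.Injective (f.map (k + 1)))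
    (hf' : Function.Injective (f.map k)) (a : S.face (k + 3))
    (h : T.OneEq (T.δ (T.γ (f.map (k + 3) a))) (T.ε (T.γ (f.map (k + 3) a)))
      (T.domDom (f.map (k + 3) a) \ T.γ '' T.domNonloop (f.map (k + 3) a))
      (⋃ x ∈ T.δ (f.map (k + 3) a), T.ε x)) :
    S.OneEq (S.δ (S.γ a)) (S.ε (S.γ a)) (S.domDom a \ S.γ '' S.domNonloop a)
      (⋃ x ∈ S.δ a, S.ε x) := by
  have h₁ := f.glob_δ_of_map hf a h.1
  refine ⟨h₁, ?_⟩
  have h₂ := h.2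
  rw [← h.1] at h₂
  rw [← h₁]
  rw [← f.map_γ, f.δ_map, f.map_ε, f.δ_map] at h₂
  simp only [Set.biUnion_image, f.θ_map, f.map_ε] at h₂
  simp only [← Set.image_iUnion, ← Set.image_union] at h₂
  exact hf'.image_injective h₂

end Hypergraph.Hom

/-! ### Unrolling a loop into an arrow. -/

/-- A loop over a minimal face of dimension `k`. -/
structure MinLoop (k : ℕ) (T : OrderedFS.{u}) where
  loop : T.toOrd.face (k + 1)
  isLoop : T.toOrd.IsLoop loop
  isMin : T.toOrd.IsMin (T.toOrd.γ loop)

namespace MinLoop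

variable {k : ℕ} {T : OrderedFS.{u}} (L : MinLoop k T) {l : ℕ}

/-- The faces of the loop outside its domain. -/
def Extra (l : ℕ) (x : T.toOrd.face l) : Prop :=
  (l = k ∧ HEq x (T.toOrd.γ L.loop)) ∨ (l = k + 1 ∧ HEq x L.loop)

/-- The faces of `d⁽ᵏ⁾ T`, flagged `false`, and a copy of the loop and its codomain, flagged
`true`. -/
def Face (l : ℕ) : Type u :=
  {p : T.toOrd.face l × Bool // (p.2 = false ∧ p.1 ∈ (OrderedFS.domSub k T).carrier l) ∨
    (p.2 = true ∧ L.Extra l p.1)}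

variable {L}

theorem le_of_face (p : L.Face l) : l ≤ k + 1 := by
  rcases p.2 with ⟨-, h⟩ | ⟨-, h | h⟩
  · have := (OrderedFS.mem_domSub.1 h).1
    omega
  · have := h.1
    omega
  · have := h.1
    omega

/-- A face occurs twice only in dimension `k`, where the codomain of the loop is duplicated;
elsewhere the dimension determines the flag. -/
theorem flag_eq (hl : l ≠ k) (p : L.Face l) : p.1.2 = decide (k < l) := by
  rcases p.2 with ⟨h, h'⟩ | ⟨h, h' | h'⟩
  · have := (OrderedFS.mem_domSub.1 h').1
    rw [h]
    symm
    rw [decide_eq_false_iff_not]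
    omega
  · exact (hl h'.1).elim
  · rw [h]
    symm
    rw [decide_eq_true_iff]
    omega

theorem face_ext {p q : L.Face l} (h : p.1.1 = q.1.1) (h' : p.1.2 = q.1.2) : p = q :=
  Subtype.ext (Prod.ext h h')

theorem mem_domSub_of_le (hl : l ≤ k) (p : L.Face l) :
    p.1.1 ∈ (OrderedFS.domSub k T).carrier l := by
  rcases p.2 with ⟨-, h⟩ | ⟨-, ⟨e, h⟩ | ⟨e, -⟩⟩
  · exact h
  · subst e
    exact OrderedFS.mem_domSub.2 ⟨le_rfl, fun _ => eq_of_heq h ▸ L.isMin⟩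
  · omega

theorem eq_loop (p : L.Face (k + 1)) : p.1.1 = L.loop := by
  rcases p.2 with ⟨-, h⟩ | ⟨-, ⟨e, h⟩ | ⟨e, h⟩⟩
  · have := (OrderedFS.mem_domSub.1 h).1
    omega
  · omega
  · exact eq_of_heq h

theorem δ_subset (p : L.Face (l + 1)) :
    T.toOrd.δ p.1.1 ⊆ (OrderedFS.domSub k T).carrier l := by
  by_cases hl : l = k
  · subst hl
    rw [eq_loop, L.isLoop]
    rintro _ rfl
    exact OrderedFS.mem_domSub.2 ⟨le_rfl, fun _ => L.isMin⟩
  · have := le_of_face p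
    exact (OrderedFS.domSub k T).δ_mem _ (mem_domSub_of_le (by omega) p)

theorem ε_subset (p : L.Face (l + 2)) :
    T.toOrd.ε p.1.1 ⊆ (OrderedFS.domSub k T).carrier l := by
  have := le_of_face p
  exact fun _ _ => OrderedFS.mem_domSub.2 ⟨by omega, fun h => by omega⟩

theorem γ_mem (p : L.Face (l + 1)) :
    ((p.1.2 && decide (l = k)) = false ∧ T.toOrd.γ p.1.1 ∈ (OrderedFS.domSub k T).carrier l) ∨
    ((p.1.2 && decide (l = k)) = true ∧ L.Extra l (T.toOrd.γ p.1.1)) := by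
  by_cases hl : l = k
  · subst hl
    right
    refine ⟨?_, .inl ⟨rfl, by rw [eq_loop]⟩⟩
    rw [flag_eq (by omega) p]
    simp
  · have := le_of_face p
    exact .inl ⟨by simp [hl],
      (OrderedFS.domSub k T).γ_mem _ (mem_domSub_of_le (by omega) p)⟩

variable (L)

/-- A face of `d⁽ᵏ⁾ T`. -/
def low (x : T.toOrd.face l) (hx : x ∈ (OrderedFS.domSub k T).carrier l) : L.Face l :=
  ⟨(x, false), .inl ⟨rfl, hx⟩⟩

/-- The copy of the loop. -/
def arrow : L.Face (k + 1) := ⟨(L.loop, true), .inr ⟨rfl, .inr ⟨rfl, HEq.rfl⟩⟩⟩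

/-- The hypergraph obtained from `d⁽ᵏ⁾ T` by adding an arrow, mapped to the loop, from the
codomain of the loop to a new face. -/
def unroll : OrdHypergraph.{u} where
  face := L.Face
  finite_face l := by
    have := T.toOrd.finite_face l
    unfold Face
    infer_instance
  bounded := ⟨k + 1, fun l hl => ⟨fun p => by
    have := le_of_face p
    omega⟩⟩
  -- Only the arrow has the duplicate as its codomain. The duplicate itself shares the boundary of
  -- the original, so below dimension `k` the flag is dropped.
  γ p := ⟨(T.toOrd.γ p.1.1, p.1.2 && decide (_ = k)), γ_mem p⟩
  δ p := {q | q.1.2 = false ∧ q.1.1 ∈ T.toOrd.δ p.1.1}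
  ε p := {q | q.1.2 = false ∧ q.1.1 ∈ T.toOrd.ε p.1.1}
  δ_one p := by
    obtain ⟨x, hx⟩ := T.toOrd.δ_one p.1.1
    have hm : x ∈ T.toOrd.δ p.1.1 := hx ▸ rfl
    refine ⟨L.low x (δ_subset p hm), Set.eq_singleton_iff_unique_mem.2 ⟨⟨rfl, hm⟩, ?_⟩⟩
    rintro q ⟨hq, hq'⟩
    rw [hx] at hq'
    exact face_ext hq' hq
  δ_cases p := by
    rcases T.toOrd.δ_cases p.1.1 with ⟨⟨x, hx⟩, e⟩ | ⟨e, x, hx⟩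
    · refine .inl ⟨⟨L.low x (δ_subset p hx), rfl, hx⟩, ?_⟩
      exact Set.eq_empty_of_forall_notMem fun q hq => by
        have := hq.2
        rw [e] at this
        exact this
    · have hm : x ∈ T.toOrd.ε p.1.1 := hx ▸ rfl
      refine .inr ⟨Set.eq_empty_of_forall_notMem fun q hq => ?_, L.low x (ε_subset p hm),
        Set.eq_singleton_iff_unique_mem.2 ⟨⟨rfl, hm⟩, ?_⟩⟩
      · have := hq.2
        rw [e] at this
        exact this
      · rintro q ⟨hq, hq'⟩
        rw [hx] at hq'
        exact face_ext hq' hq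
  lt p q := T.toOrd.lt p.1.1 q.1.1

/-- The canonical morphism. -/
def proj : L.unroll ⟶ T.toOrd where
  map _ p := p.1.1
  map_γ _ := rfl
  bijOn_δ p := by
    refine ⟨fun q hq => hq.2, fun q hq q' hq' e => face_ext e (hq.1.trans hq'.1.symm),
      fun x hx => ⟨L.low x (δ_subset p hx), ⟨rfl, hx⟩, rfl⟩⟩
  map_ε p := by
    ext x
    refine ⟨fun hx => ⟨L.low x (ε_subset p hx), ⟨rfl, hx⟩, rfl⟩, ?_⟩
    rintro ⟨q, hq, rfl⟩
    exact hq.2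
  map_lt _ _ h := h

theorem proj_injective (hl : l ≠ k) : Function.Injective (L.proj.map l) := fun p q h =>
  face_ext h ((flag_eq hl p).trans (flag_eq hl q).symm)

variable {L}

theorem eq_arrow (p : L.unroll.face (k + 1)) : p = L.arrow :=
  L.proj_injective (by omega) (eq_loop p)

theorem isMin_of_face (hl : l = k) (p : L.unroll.face l) : T.toOrd.IsMin (L.proj.map l p) :=
  (OrderedFS.mem_domSub.1 (mem_domSub_of_le hl.le p)).2 hl

theorem arrow_not_loop : ¬ L.unroll.IsLoop L.arrow := fun h => by
  have h₁ : (L.unroll.γ L.arrow).1.2 = false := h.mem.1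
  have h₂ : (L.unroll.γ L.arrow).1.2 = true := by
    change (true && decide (k = k)) = true
    simp
  rw [h₂] at h₁
  cases h₁

theorem upLt_proj (hl : l ≠ k) {p q : L.unroll.face l} (h : L.unroll.UpLt p q) :
    T.toOrd.UpLt (L.proj.map l p) (L.proj.map l q) :=
  L.proj.upLt (L.proj_injective hl) h

theorem flags_of_upLt {p q : L.unroll.face k} (h : L.unroll.UpLt p q) :
    p.1.2 = false ∧ q.1.2 = true := by
  obtain ⟨α, -, hp, -⟩ := h.head
  obtain ⟨β, -, -, rfl⟩ := h.tail
  refine ⟨hp.1, ?_⟩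
  rw [eq_arrow β]
  change (true && decide (k = k)) = true
  simp

theorem upLt_of_flags {p q : L.unroll.face k} (h : p.1.1 = q.1.1) (hp : p.1.2 = false)
    (hq : q.1.2 = true) : L.unroll.UpLt p q := by
  have hq' : q.1.1 = T.toOrd.γ L.loop := by
    rcases q.2 with ⟨h', -⟩ | ⟨-, ⟨-, h'⟩ | ⟨h', -⟩⟩
    · rw [hq] at h'
      cases h'
    · exact eq_of_heq h'
    · omega
  have e : q = L.unroll.γ L.arrow := by
    refine face_ext hq' ?_
    change q.1.2 = (true && decide (k = k))
    simp [hq]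
  rw [e]
  refine upLt_of_mem arrow_not_loop ⟨hp, ?_⟩
  rw [h, hq']
  exact L.isLoop.mem

/-- Chains of `T` below dimension `k` can be refined to minimal faces, and minimal faces of
dimension at most `k` belong to `d⁽ᵏ⁾T`. -/
theorem upLt_of_proj (hl : l < k) {p q : L.unroll.face l}
    (h : T.toOrd.UpLt (L.proj.map l p) (L.proj.map l q)) : L.unroll.UpLt p q := by
  suffices H : ∀ x, T.toOrd.UpLt x (L.proj.map l q) → ∀ p : L.unroll.face l, L.proj.map l p = x →
    L.unroll.UpLt p q from H _ h p rfl
  clear h p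
  intro x
  induction x using (T.isOrderedFS.wf' l).induction with
  | _ x ih =>
    rintro h p rfl
    obtain ⟨d, hd, hm, hle⟩ := T.isOrderedFS.exists_min_head h
    have hdl := T.isOrderedFS.not_loop_of_min hd
    let α : L.unroll.face (l + 1) :=
      L.low d (OrderedFS.mem_domSub.2 ⟨by omega, fun _ => hd⟩)
    have h₁ : L.unroll.UpLt p (L.unroll.γ α) := by
      refine upLt_of_mem (fun h' => hdl (L.proj.isLoop (a := α) h')) ⟨?_, hm⟩
      rw [flag_eq (by omega) p]
      simp only [decide_eq_false_iff_not]
      omega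
    rcases hle with e | hlt
    · have : L.unroll.γ α = q := L.proj_injective (by omega) e
      rwa [this] at h₁
    · exact h₁.trans (ih _ (upLt_of_mem hdl hm) hlt (L.unroll.γ α) rfl)

theorem upLe_of_proj (hl : l < k) {p q : L.unroll.face l}
    (h : T.toOrd.UpLe (L.proj.map l p) (L.proj.map l q)) : L.unroll.UpLe p q := by
  rcases h with h | h
  exacts [.inl (L.proj_injective (by omega) h), .inr (upLt_of_proj hl h)]

theorem le_of_unroll (p : L.unroll.face l) : l ≤ k + 1 := le_of_face p

theorem upLt_of_face_zero (p q : L.unroll.face 0) (hpq : p ≠ q) :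
    L.unroll.UpLt p q ∨ L.unroll.UpLt q p := by
  by_cases hk : 0 = k
  · subst hk
    have e : p.1.1 = q.1.1 := by
      by_contra hne
      rcases T.isOrderedFS.upLt_linear _ _ hne with h | h
      exacts [(isMin_of_face rfl q).not_lt h, (isMin_of_face rfl p).not_lt h]
    cases hp : p.1.2 <;> cases hq : q.1.2
    · exact (hpq (face_ext e (hp.trans hq.symm))).elim
    · exact .inl (upLt_of_flags e hp hq)
    · exact .inr (upLt_of_flags e.symm hq hp)
    · exact (hpq (face_ext e (hp.trans hq.symm))).elim
  · exact (T.isOrderedFS.upLt_linear _ _ fun e => hpq (L.proj_injective hk e)).imp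
      (upLt_of_proj (by omega)) (upLt_of_proj (by omega))

theorem lt_disjoint (p q : L.unroll.face (l + 1)) (h : L.unroll.lt p q ∨ L.unroll.lt q p) :
    ¬ (L.unroll.UpLt p q ∨ L.unroll.UpLt q p) := by
  by_cases hl : l + 1 = k
  · subst hl
    rintro h'
    have e : L.proj.map _ p = L.proj.map _ q := by
      rcases h' with h' | h'
      · exact ((isMin_of_face rfl q).eq_of_le (L.proj.upLe h'.le))
      · exact ((isMin_of_face rfl p).eq_of_le (L.proj.upLe h'.le)).symm
    have e : p.1.1 = q.1.1 := e
    rcases h with h | h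
    · change T.toOrd.lt p.1.1 q.1.1 at h
      rw [e] at h
      exact T.isOrderedFS.lt_irrefl _ h
    · change T.toOrd.lt q.1.1 p.1.1 at h
      rw [e] at h
      exact T.isOrderedFS.lt_irrefl _ h
  · exact fun h' => T.isOrderedFS.disjoint _ _ h (h'.imp (upLt_proj hl) (upLt_proj hl))

theorem lowLt_of_lt : ∀ {l : ℕ} (p q : L.unroll.face l), L.unroll.lt p q → L.unroll.LowLt p q
  | 0, _, _, h => (T.isOrderedFS.not_lt_zero h).elim
  | l + 1, p, q, h => by
    obtain ⟨t, ht, hle⟩ := T.isOrderedFS.low_of_lt h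
    have := le_of_unroll p
    have hl : l < k := by
      by_contra hl
      obtain rfl : l = k := by omega
      rw [eq_arrow p, eq_arrow q] at h
      exact T.isOrderedFS.lt_irrefl _ h
    exact lowLt_iff.2 ⟨L.low t (δ_subset q ht), ⟨rfl, ht⟩, upLe_of_proj hl hle⟩

theorem lt_of_lowLt (p q : L.unroll.face (l + 1)) (hd : L.unroll.ThetaDisjoint p q)
    (h : L.unroll.LowLt p q) : L.unroll.lt p q := by
  have hd := hd.disjoint
  have := le_of_unroll p
  by_cases hl : l = k
  · subst hl
    rw [eq_arrow p, eq_arrow q] at hd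
    exact (Set.disjoint_left.1 hd (.inl rfl) (.inl rfl)).elim
  · have h' := L.proj.lowLt h
    obtain ⟨t, ht, -⟩ := lowLt_iff.1 h'
    refine (T.isOrderedFS.lt_iff_lowLt (L.proj.map _ p) (L.proj.map _ q)
      (T.isOrderedFS.thetaDisjoint ⟨t, ht⟩ ?_)).2 h'
    rw [L.proj.θ_map, L.proj.θ_map]
    exact Set.disjoint_image_of_injective (L.proj_injective hl) hd

theorem pencil (p q : L.unroll.face (l + 1)) (hpq : p ≠ q)
    (hd : (L.unroll.θ p ∩ L.unroll.θ q).Nonempty) :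
    (L.unroll.lt p q ∨ L.unroll.lt q p) ∨ (L.unroll.UpLt p q ∨ L.unroll.UpLt q p) := by
  have := le_of_unroll p
  obtain ⟨x, hx, hx'⟩ := hd
  have hd : (T.toOrd.θ (L.proj.map _ p) ∩ T.toOrd.θ (L.proj.map _ q)).Nonempty := by
    refine ⟨L.proj.map l x, ?_, ?_⟩
    · rw [L.proj.θ_map]
      exact ⟨x, hx, rfl⟩
    · rw [L.proj.θ_map]
      exact ⟨x, hx', rfl⟩
  by_cases hl : l = k
  · subst hl
    rw [eq_arrow p, eq_arrow q] at hpq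
    exact (hpq rfl).elim
  by_cases hl' : l + 1 = k
  -- Distinct faces with equal projection are the duplicated pair, related by the arrow. Otherwise
  -- the projections are minimal in `T`, so `<⁺` cannot occur between them.
  · by_cases e : p.1.1 = q.1.1
    · right
      subst hl'
      cases hp : p.1.2 <;> cases hq : q.1.2
      · exact (hpq (face_ext e (hp.trans hq.symm))).elim
      · exact .inl (upLt_of_flags e hp hq)
      · exact .inr (upLt_of_flags e.symm hq hp)
      · exact (hpq (face_ext e (hp.trans hq.symm))).elim
    · refine .inl ((T.isOrderedFS.pencil _ _ e hd).resolve_right ?_)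
      rintro (h | h)
      exacts [(isMin_of_face hl' q).not_lt h, (isMin_of_face hl' p).not_lt h]
  · exact (T.isOrderedFS.pencil _ _ (fun e => hpq (L.proj_injective hl' e)) hd).imp id
      (Or.imp (upLt_of_proj (by omega)) (upLt_of_proj (by omega)))

theorem pencil_empty (p q : L.unroll.face (l + 2)) (hp : L.unroll.δ p = ∅)
    (h : L.unroll.γ (L.unroll.γ p) ∈ L.unroll.ι q) : L.unroll.lt p q ∨ L.unroll.UpLt p q := by
  have := le_of_unroll p
  have hp' : T.toOrd.δ (L.proj.map _ p) = ∅ := by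
    rw [L.proj.δ_map, hp, Set.image_empty]
  rcases T.isOrderedFS.pencil_empty _ _ hp' (L.proj.mem_ι (L.proj_injective (by omega)) h)
    with h' | h'
  · exact .inl h'
  · by_cases hl : l + 2 < k
    · exact .inr (upLt_of_proj hl h')
    · by_cases hl' : l + 2 = k
      · exact ((isMin_of_face hl' q).not_lt h').elim
      · obtain rfl : l + 1 = k := by omega
        rw [eq_arrow p, eq_arrow q] at h'
        exact (T.isOrderedFS.upLt_irrefl _ h').elim

theorem loop_filling (p : L.unroll.face (l + 1)) (hp : L.unroll.IsLoop p) :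
    ∃ α : L.unroll.face (l + 2), ¬ L.unroll.IsLoop α ∧ L.unroll.γ α = p := by
  have := le_of_unroll p
  have hl : l ≠ k := fun hl => by
    subst hl
    rw [eq_arrow p] at hp
    exact arrow_not_loop hp
  have hp' := L.proj.isLoop hp
  have hl' : l + 1 ≠ k := fun hl' =>
    T.isOrderedFS.not_loop_of_min (isMin_of_face hl' p) hp'
  obtain ⟨α, hα, e⟩ := T.isOrderedFS.loop_filling _ hp'
  obtain ⟨β, hβ, e', hm⟩ := T.isOrderedFS.exists_min_γ hα
  let α' : L.unroll.face (l + 2) := L.low β (OrderedFS.mem_domSub.2 ⟨by omega, fun _ => hm⟩)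
  exact ⟨α', fun h => hβ (L.proj.isLoop (a := α') h),
    L.proj_injective hl' (e'.trans e)⟩

theorem isOrderedFS : L.unroll.IsOrderedFS where
  nonempty := by
    by_cases hk : 0 = k
    · subst hk
      exact ⟨L.unroll.γ L.arrow⟩
    · obtain ⟨x⟩ := T.isOrderedFS.nonempty
      exact ⟨L.low x (OrderedFS.mem_domSub.2 ⟨by omega, fun h => (hk h).elim⟩)⟩
  -- Since `l + 2 ≤ k + 1`, faces of codimension two lie below dimension `k`, where the projection
  -- is injective.
  glob_γ p := by
    have := le_of_unroll p
    exact L.proj.glob_γ_of_map (L.proj_injective (by omega)) p (T.isOrderedFS.glob_γ _)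
  glob_δ_two p := by
    have := le_of_unroll p
    exact L.proj.glob_δ_of_map (L.proj_injective (by omega)) p (T.isOrderedFS.glob_δ_two _)
  glob_δ p := by
    have := le_of_unroll p
    exact L.proj.oneEq_of_map (L.proj_injective (by omega)) (L.proj_injective (by omega)) p
      (T.isOrderedFS.glob_δ _)
  discrete := by
    intro l p x hx y hy h
    by_cases hl : l = k
    · subst hl
      have h₁ := (flags_of_upLt h).2
      have h₂ : y.1.2 = false := hy.1
      rw [h₁] at h₂
      cases h₂
    · exact T.isOrderedFS.discrete _ _ (L.proj.mem_δ hx) _ (L.proj.mem_δ hy) (upLt_proj hl h)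
  upLt_irrefl := by
    intro l p h
    by_cases hl : l = k
    · subst hl
      have h₁ := flags_of_upLt h
      rw [h₁.1] at h₁
      cases h₁.2
    · exact T.isOrderedFS.upLt_irrefl _ (upLt_proj hl h)
  lt_irrefl _ := T.isOrderedFS.lt_irrefl _
  lt_trans _ _ _ := T.isOrderedFS.lt_trans _ _ _
  upLt_linear := upLt_of_face_zero
  disjoint := lt_disjoint
  lowLt_of_lt := lowLt_of_lt
  lt_iff_lowLt p q h := ⟨lowLt_of_lt p q, lt_of_lowLt p q h⟩
  pencil := pencil
  pencil_empty := pencil_empty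
  loop_filling := loop_filling

end MinLoop

/-! ### Embeddings of ordered hypergraphs. -/

namespace OrdHypergraph

/-- A morphism factors through an embedding whose image contains its image. -/
theorem exists_factor {A B T : OrdHypergraph.{u}} (f : A ⟶ T) (g : B ⟶ T)
    (hg : ∀ l, Function.Injective (g.map l)) (hr : ∀ l x, f.map l x ∈ Set.range (g.map l))
    (hlt : ∀ {l} (x y : B.face l), T.lt (g.map l x) (g.map l y) → B.lt x y) :
    ∃ h : A ⟶ B, h ≫ g = f := by
  choose h hh using hr
  refine ⟨{ map := h, map_γ := fun a => hg _ ?_, bijOn_δ := fun a => ?_,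
            map_ε := fun a => (hg _).image_injective ?_,
            map_lt := fun a b hab => hlt _ _ ?_ }, ?_⟩
  · rw [hh, g.map_γ, hh, f.map_γ]
  · have e : f.map _ '' A.δ a = g.map _ '' B.δ (h _ a) := by
      rw [← f.δ_map, ← g.δ_map, hh]
    have e' : g.map _ '' (h _ '' A.δ a) = f.map _ '' A.δ a := by
      rw [Set.image_image]
      exact Set.image_congr fun x _ => hh _ x
    rw [← (hg _).image_injective (e'.trans e)]
    refine Set.InjOn.bijOn_image fun x hx y hy hxy => (f.bijOn_δ a).injOn hx hy ?_
    rw [← hh, ← hh, hxy]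
  · rw [← g.map_ε, hh, f.map_ε, Set.image_image]
    exact Set.image_congr fun x _ => (hh _ x).symm
  · rw [hh, hh]
    exact f.map_lt a b hab
  · refine OrdHypergraph.Hom.ext ?_
    funext l x
    exact hh l x

theorem hom_eq_of_injective {A B T : OrdHypergraph.{u}} (g : B ⟶ T)
    (hg : ∀ l, Function.Injective (g.map l)) {p q : A ⟶ B} (h : p ≫ g = q ≫ g) : p = q := by
  refine OrdHypergraph.Hom.ext ?_
  funext l x
  exact hg l (congrArg (fun f : A ⟶ T => f.map l x) h)

/-- Embeddings with the same image are isomorphic. -/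
theorem exists_iso_over {A B T : OrdHypergraph.{u}} (f : A ⟶ T) (g : B ⟶ T)
    (hf : ∀ l, Function.Injective (f.map l)) (hg : ∀ l, Function.Injective (g.map l))
    (hr : ∀ l, Set.range (f.map l) = Set.range (g.map l))
    (hf' : ∀ {l} (x y : A.face l), T.lt (f.map l x) (f.map l y) → A.lt x y)
    (hg' : ∀ {l} (x y : B.face l), T.lt (g.map l x) (g.map l y) → B.lt x y) :
    ∃ e : A ≅ B, e.hom ≫ g = f := by
  obtain ⟨p, hp⟩ := exists_factor f g hg (fun l x => hr l ▸ ⟨x, rfl⟩) hg'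
  obtain ⟨q, hq⟩ := exists_factor g f hf (fun l x => (hr l).symm ▸ ⟨x, rfl⟩) hf'
  refine ⟨⟨p, q, hom_eq_of_injective f hf ?_, hom_eq_of_injective g hg ?_⟩, hp⟩
  · rw [Category.assoc, hq, hp, Category.id_comp]
  · rw [Category.assoc, hp, hq, Category.id_comp]

end OrdHypergraph

namespace MinLoop

variable {k : ℕ} {T : OrderedFS.{u}} (L : MinLoop k T)

/-- The ordered face structure `L.unroll`. -/
def unrollFS : OrderedFS.{u} := ⟨L.unroll, MinLoop.isOrderedFS⟩

theorem isMin_unroll (p : L.unroll.face k) : L.unroll.IsMin p ↔ p.1.2 = false := by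
  constructor
  · intro h
    by_contra hp
    rw [Bool.not_eq_false] at hp
    let q : L.unroll.face k := L.low p.1.1 (mem_domSub_of_le le_rfl p)
    exact h.not_lt (upLt_of_flags (p := q) rfl rfl hp)
  · rintro h ⟨α, -, rfl⟩
    rw [eq_arrow α] at h
    have : (true && decide (k = k)) = false := h
    simp at this

theorem mem_domSub_unroll {l : ℕ} (p : L.unroll.face l) :
    p ∈ (OrderedFS.domSub k L.unrollFS).carrier l ↔ p.1.2 = false := by
  refine (OrderedFS.mem_domSub (T := L.unrollFS)).trans ?_
  by_cases hl : l = k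
  · subst hl
    exact ⟨fun h => (L.isMin_unroll p).1 (h.2 rfl),
      fun h => ⟨le_rfl, fun _ => (L.isMin_unroll p).2 h⟩⟩
  · rw [flag_eq hl p, decide_eq_false_iff_not, not_lt]
    exact ⟨fun h => h.1, fun h => ⟨h, fun h' => (hl h').elim⟩⟩

/-- The minimal `k`-faces of the unrolled structure are the unflagged ones, so its `k`-domain and
that of `T` embed in `T` with the same image. -/
theorem exists_kDom_iso :
    ∃ e : kDom k T ≅ kDom k L.unrollFS, e.hom ≫ kDomMap k L.unrollFS ≫ L.proj = kDomMap k T := by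
  refine OrdHypergraph.exists_iso_over (kDomMap k T) (kDomMap k L.unrollFS ≫ L.proj) ?_ ?_ ?_
    (fun _ _ h => h) (fun _ _ h => h)
  · exact fun l x y h => Cut.ext_of_empty (fun _ => OrderedFS.not_mem_emptyLoops_domSub) h
  · intro l x y h
    refine Cut.ext_of_empty (fun _ => OrderedFS.not_mem_emptyLoops_domSub) ?_
    have hx := (L.mem_domSub_unroll _).1 (Cut.base_mem x)
    have hy := (L.mem_domSub_unroll _).1 (Cut.base_mem y)
    exact face_ext h (hx.trans hy.symm)
  · intro l
    ext x
    constructor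
    · rintro ⟨y, rfl⟩
      have hy : Cut.base y ∈ (OrderedFS.domSub k T).carrier l := Cut.base_mem y
      exact ⟨Cut.bot (T := L.unrollFS) (X := OrderedFS.domSub k L.unrollFS) (L.low _ hy)
        ((L.mem_domSub_unroll _).2 rfl), rfl⟩
    · rintro ⟨y, rfl⟩
      have hy := (OrderedFS.mem_domSub (T := L.unrollFS)).1 (Cut.base_mem y)
      exact ⟨Cut.bot (X := OrderedFS.domSub k T) _ (mem_domSub_of_le (L := L) hy.1 (Cut.base y)),
        rfl⟩

end MinLoop

/-! ### Comparison with another local pushout. -/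

namespace TensorPair

variable {k : ℕ}

section

variable {X : TensorPair.{u} k} {Y : OrderedFS.{u}} {m : X.fst ⟶ Y} {n : X.snd ⟶ Y}

/-- A comparison of hypergraphs between the tensor and another local pushout. -/
structure Comparison (X : TensorPair.{u} k) (Y : OrderedFS.{u}) (m : X.fst ⟶ Y)
    (n : X.snd ⟶ Y) where
  hom : Hypergraph.Hom X.gluing.PH Y.toOrd.toHypergraph
  inv : Hypergraph.Hom Y.toOrd.toHypergraph X.gluing.PH
  hom_inv : ∀ {l} (p : X.gluing.PH.face l), inv.map l (hom.map l p) = p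
  inv_hom : ∀ {l} (y : Y.toOrd.face l), hom.map l (inv.map l y) = y
  map_i : ∀ {l} (a : X.fst.toOrd.face l),
    hom.map l (X.gluing.i a) = (OrderedFS.homToOrd m).map l a
  map_j : ∀ {l} (b : X.snd.toOrd.face l),
    hom.map l (X.gluing.j b) = (OrderedFS.homToOrd n).map l b

theorem exists_comparison (h : X.IsLocalPushoutSquare m n) : Nonempty (Comparison X Y m n) := by
  obtain ⟨hc, hd, hm, hn, hpo⟩ := h
  obtain ⟨hc', hd', hi, hj, hpo'⟩ := X.gluing.isLocalPushout
  let e : X.gluing.P.loc ≅ Y.toOrd.loc := IsPushout.isoIsPushout _ _ hpo' hpo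
  have h₁ := IsPushout.inl_isoIsPushout_hom _ _ hpo' hpo
  have h₂ := IsPushout.inr_isoIsPushout_hom _ _ hpo' hpo
  exact ⟨{
    hom := e.hom.toHom
    inv := e.inv.toHom
    hom_inv := fun {l} p => congrArg (fun f : X.gluing.P.loc ⟶ X.gluing.P.loc => f.map l p)
      e.hom_inv_id
    inv_hom := fun {l} p => congrArg (fun f : Y.toOrd.loc ⟶ Y.toOrd.loc => f.map l p)
      e.inv_hom_id
    map_i := fun {l} a => congrArg (fun f : X.fst.toOrd.loc ⟶ Y.toOrd.loc => f.map l a) h₁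
    map_j := fun {l} b => congrArg (fun f : X.snd.toOrd.loc ⟶ Y.toOrd.loc => f.map l b) h₂ }⟩

namespace Comparison

variable (e : Comparison X Y m n) {l : ℕ}

theorem hom_injective (l : ℕ) : Function.Injective (e.hom.map l) := fun p q h => by
  rw [← e.hom_inv p, h, e.hom_inv]

theorem inv_injective (l : ℕ) : Function.Injective (e.inv.map l) := fun p q h => by
  rw [← e.inv_hom p, h, e.inv_hom]

theorem upLt_of_hom {p q : X.gluing.PH.face l} (h : Y.toOrd.UpLt (e.hom.map l p) (e.hom.map l q)) :
    X.gluing.PH.UpLt p q := by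
  have := e.inv.upLt (e.inv_injective l) h
  rwa [e.hom_inv, e.hom_inv] at this

theorem lowLt_of_hom {p q : X.gluing.PH.face (l + 1)}
    (h : Y.toOrd.LowLt (e.hom.map (l + 1) p) (e.hom.map (l + 1) q)) : X.gluing.PH.LowLt p q := by
  have := e.inv.lowLt h
  rwa [e.hom_inv, e.hom_inv] at this

/-- A non-loop forces `<~` up to `<⁺`, and in dimension `k + 1` no `<⁺`-chain joins `S` and `S'`, as
nothing is common there. -/
theorem lt_of_not_loop (e : Comparison X Y m n) {a : X.fst.toOrd.face (k + 1)} {b : X.snd.toOrd.face (k + 1)}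
    (h : X.gluing.PH.LowLt (X.gluing.i a) (X.gluing.j b))
    (hl : ¬ X.fst.toOrd.IsLoop a ∨ ¬ X.snd.toOrd.IsLoop b) :
    Y.toOrd.lt ((OrderedFS.homToOrd m).map _ a) ((OrderedFS.homToOrd n).map _ b) := by
  have h' := e.hom.lowLt h
  rcases hl with hl | hl
  · refine e.map_i a ▸ e.map_j b ▸ (Y.isOrderedFS.lt_of_low_left h' fun h => hl ?_).resolve_right
      fun h => X.gluing.exists_of_upLt_ji (by omega) (e.upLt_of_hom h)
    exact X.gluing.isLoop_i.1 (e.hom.isLoop_of_map (e.hom_injective k) h)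
  · refine e.map_i a ▸ e.map_j b ▸ (Y.isOrderedFS.lt_of_low_right h' fun h => hl ?_).resolve_right
      fun h => ?_
    · exact X.gluing.isLoop_of_j (by omega) (e.hom.isLoop_of_map (e.hom_injective k) h)
    · obtain ⟨z, -⟩ := X.gluing.upLt_of_ij (by omega) (e.upLt_of_hom h)
      exact (X.gluing.X_empty _ (by omega)).false z

/-- Faces of dimension `k + 1` of the two components that are comparable in `<⁻` compare in the
same way in `<~`, unless both are loops over the same face. -/
theorem lt_or_loops (e : Comparison X Y m n) {a : X.fst.toOrd.face (k + 1)} {b : X.snd.toOrd.face (k + 1)}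
    (h : X.gluing.PH.LowLt (X.gluing.i a) (X.gluing.j b)) :
    Y.toOrd.lt ((OrderedFS.homToOrd m).map _ a) ((OrderedFS.homToOrd n).map _ b) ∨
    (X.snd.toOrd.IsLoop b ∧ X.gluing.i (X.fst.toOrd.γ a) = X.gluing.j (X.snd.toOrd.γ b)) := by
  by_cases ha : X.fst.toOrd.IsLoop a
  · by_cases hb : X.snd.toOrd.IsLoop b
    · rcases Y.isOrderedFS.cmp_of_low (e.hom.lowLt h) with h' | h' | h' | h' | h'
      · exact (X.gluing.not_i_eq_j (by omega) (e.hom_injective _ h')).elim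
      · exact .inl (e.map_i a ▸ e.map_j b ▸ h')
      · obtain ⟨t, ht, hat⟩ := lowLt_iff.1 h
        obtain ⟨s, hs, hbs⟩ := lowLt_iff.1 (e.lowLt_of_hom (Y.isOrderedFS.lowLt_of_lt _ _ h'))
        have h₁ := (X.gluing.isOrderedFS.loop_of_low_low ht hat hs hbs).2.2
        refine .inr ⟨hb, ?_⟩
        rw [← X.gluing.γ_j]
        exact h₁
      · obtain ⟨z, -⟩ := X.gluing.upLt_of_ij (by omega) (e.upLt_of_hom h')
        exact ((X.gluing.X_empty _ (by omega)).false z).elim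
      · exact (X.gluing.exists_of_upLt_ji (by omega) (e.upLt_of_hom h')).elim
    · exact .inl (e.lt_of_not_loop h (.inr hb))
  · exact .inl (e.lt_of_not_loop h (.inl ha))

/-- Outside dimension `k + 1`, mixed relations follow from those with the common face `z` by
`lt_of_upLt_lt` and `lt_of_lt_low`, which hold in any ordered face structure. -/
theorem map_lt (H : ∀ (a : X.fst.toOrd.face (k + 1)) (b : X.snd.toOrd.face (k + 1)),
      X.gluing.PH.LowLt (X.gluing.i a) (X.gluing.j b) →
      Y.toOrd.lt ((OrderedFS.homToOrd m).map _ a) ((OrderedFS.homToOrd n).map _ b)) :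
    ∀ {l : ℕ} (p q : X.gluing.PH.face l), X.gluing.PLt p q →
      Y.toOrd.lt (e.hom.map l p) (e.hom.map l q)
  | 0, p, q, h => (X.gluing.isOrderedFS.not_lt_zero h).elim
  | l + 1, p, q, h => by
    have hlow := e.hom.lowLt (X.gluing.lowLt_of_lt p q h)
    rcases h with ⟨a, b, h, rfl, rfl⟩ | ⟨a, b, h, rfl, rfl⟩ | ⟨hl, a, b, z, hm, rfl, rfl, h⟩ |
      ⟨hl, a, b, z, hm, rfl, rfl, h, -⟩ | ⟨hl, a, b, rfl, rfl, hl'⟩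
    · rw [e.map_i, e.map_i]
      exact (OrderedFS.homToOrd m).map_lt _ _ h
    · rw [e.map_j, e.map_j]
      exact (OrderedFS.homToOrd n).map_lt _ _ h
    · have h₁ := e.hom.upLe (X.gluing.upLe_i hm.2.2)
      have h₂ := (OrderedFS.homToOrd n).map_lt _ _ h
      rw [← e.map_j, ← e.map_j, X.gluing.j_d] at h₂
      rcases h₁ with h₁ | h₁
      · rw [h₁]
        exact h₂
      · exact Y.isOrderedFS.lt_of_upLt_lt h₁ h₂
    · have h₁ := e.hom.upLe (X.gluing.upLe_i hm.2.2)
      have h₂ := (OrderedFS.homToOrd n).map_lt _ _ h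
      rw [← e.map_j, ← e.map_j, X.gluing.j_d] at h₂
      exact Y.isOrderedFS.lt_of_lt_low h₁ h₂ hlow
    · obtain rfl : l = k := by omega
      rw [e.map_i, e.map_j]
      exact H a b hl'

/-- Preservation implies reflection: `<~` in the target gives `<⁻`, hence comparability in the
tensor, and every outcome but the desired one is carried to a contradiction. -/
theorem lt_of_map_lt (H : ∀ {l : ℕ} (p q : X.gluing.PH.face l), X.gluing.PLt p q →
      Y.toOrd.lt (e.hom.map l p) (e.hom.map l q)) :
    ∀ {l : ℕ} (p q : X.gluing.PH.face l), Y.toOrd.lt (e.hom.map l p) (e.hom.map l q) →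
      X.gluing.PLt p q
  | 0, p, q, h => (Y.isOrderedFS.not_lt_zero h).elim
  | l + 1, p, q, h => by
    have hlow := e.lowLt_of_hom (Y.isOrderedFS.lowLt_of_lt _ _ h)
    rcases X.gluing.isOrderedFS.cmp_of_low hlow with rfl | h' | h' | h' | h'
    · exact (Y.isOrderedFS.lt_irrefl _ h).elim
    · exact h'
    · exact (Y.isOrderedFS.lt_asymm' h (H _ _ h')).elim
    · exact ((Y.isOrderedFS.not_lt_and h).1 (e.hom.upLt (e.hom_injective _) h')).elim
    · exact ((Y.isOrderedFS.not_lt_and h).2 (e.hom.upLt (e.hom_injective _) h')).elim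

end Comparison

end

/-! ### Uniqueness through naturality. -/

section uniqueness

variable {G : TensorPair.{u} k ⥤ OrderedFS.{u}} {μ₀ : π₀.{u} k ⟶ G} {μ₁ : π₁.{u} k ⟶ G}

/-- A pair with the second component replaced by its `k`-domain and an arrow over the loop. -/
theorem exists_unroll (X : TensorPair.{u} k) (L : MinLoop k X.snd) :
    ∃ g : kCod k X.fst ≅ kDom k L.unrollFS,
      (g.hom ≫ kDomMap k L.unrollFS) ≫ L.proj = X.domMap := by
  obtain ⟨e, he⟩ := L.exists_kDom_iso
  exact ⟨X.glue ≪≫ e, congrArg (fun f => X.glue.hom ≫ f) he⟩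

/-- Two loops over one face are `<⁻` each other in both directions, so `<⁻` decides nothing. After
unrolling, `b` becomes a non-loop arrow whose order is forced; the projection is a morphism of pairs
sending the arrow to `b`, and its image under `G` is monotone. -/
theorem lt_of_loops
    (hG : ∀ X : TensorPair.{u} k, X.IsLocalPushoutSquare (μ₀.app X) (μ₁.app X))
    (X : TensorPair.{u} k) {a : X.fst.toOrd.face (k + 1)} {b : X.snd.toOrd.face (k + 1)}
    (hb : X.snd.toOrd.IsLoop b)
    (h : X.gluing.i (X.fst.toOrd.γ a) = X.gluing.j (X.snd.toOrd.γ b)) :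
    (G.obj X).toOrd.lt ((OrderedFS.homToOrd (μ₀.app X)).map _ a)
      ((OrderedFS.homToOrd (μ₁.app X)).map _ b) := by
  obtain ⟨z, hz, hz'⟩ := X.gluing.j_eq_i h.symm
  -- `γ b` is a common face, hence minimal in `S'`, as unrolling requires.
  let L : MinLoop k X.snd := ⟨b, hb, hz ▸ X.gluing.isMin_d rfl⟩
  obtain ⟨g, hg⟩ := exists_unroll X L
  let X' : TensorPair.{u} k := ⟨X.fst, L.unrollFS, g⟩
  let φ : X' ⟶ X := ⟨𝟙 X.fst, L.proj, 𝟙 _, rfl, hg⟩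
  obtain ⟨e⟩ := exists_comparison (hG X')
  have hlow : X'.gluing.PH.LowLt (X'.gluing.i a) (X'.gluing.j L.arrow) := by
    refine lowLt_iff.2 ⟨X'.gluing.i (X.fst.toOrd.γ a), ?_, .inl rfl⟩
    have h₁ : X'.gluing.i (X.fst.toOrd.γ a) = X'.gluing.j (X'.domMap.map k z) :=
      (congrArg X'.gluing.i hz'.symm).trans (X'.gluing.j_d z).symm
    rw [h₁]
    have h₂ := (X'.mem_range_domMap _).1 ⟨z, rfl⟩
    have h₃ : L.proj.map k (X'.domMap.map k z) = X.domMap.map k z :=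
      congrArg (fun f : kCod k X.fst ⟶ X.snd.toOrd => f.map k z) hg
    refine X'.gluing.jH.mem_δ (a := L.arrow) ⟨(L.mem_domSub_unroll _).1 h₂, ?_⟩
    change L.proj.map k (X'.domMap.map k z) ∈ X.snd.toOrd.δ b
    rw [h₃, hb]
    exact hz
  have h' := e.lt_of_not_loop hlow (.inr MinLoop.arrow_not_loop)
  have h'' := (OrderedFS.homToOrd (G.map φ)).map_lt _ _ h'
  have n₀ : (OrderedFS.homToOrd (G.map φ)).map (k + 1)
      ((OrderedFS.homToOrd (μ₀.app X')).map _ a) = (OrderedFS.homToOrd (μ₀.app X)).map _ a :=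
    (congrArg (fun f : X.fst.toOrd ⟶ (G.obj X).toOrd => f.map (k + 1) a)
      (μ₀.naturality φ)).symm
  have n₁ : (OrderedFS.homToOrd (G.map φ)).map (k + 1)
      ((OrderedFS.homToOrd (μ₁.app X')).map _ L.arrow) =
        (OrderedFS.homToOrd (μ₁.app X)).map _ b :=
    (congrArg (fun f : L.unroll ⟶ (G.obj X).toOrd => f.map (k + 1) L.arrow)
      (μ₁.naturality φ)).symm
  rwa [n₀, n₁] at h''

theorem exists_iso
    (hG : ∀ X : TensorPair.{u} k, X.IsLocalPushoutSquare (μ₀.app X) (μ₁.app X))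
    (X : TensorPair.{u} k) :
    ∃ e : X.tensorObj ≅ G.obj X, X.inl ≫ e.hom = μ₀.app X ∧ X.inr ≫ e.hom = μ₁.app X := by
  obtain ⟨e⟩ := exists_comparison (hG X)
  have H : ∀ {l : ℕ} (p q : X.gluing.PH.face l), X.gluing.PLt p q →
      (G.obj X).toOrd.lt (e.hom.map l p) (e.hom.map l q) :=
    e.map_lt fun a b h => (e.lt_or_loops h).elim id fun h' => lt_of_loops hG X h'.1 h'.2
  let p : X.gluing.P ⟶ (G.obj X).toOrd := ({ toHom := e.hom, map_lt := H } : OrdHypergraph.Hom _ _)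
  let q : (G.obj X).toOrd ⟶ X.gluing.P :=
    ({ toHom := e.inv, map_lt := fun x y h => e.lt_of_map_lt H _ _ (by
        rwa [e.inv_hom, e.inv_hom]) } : OrdHypergraph.Hom _ _)
  refine ⟨⟨p, q, ?_, ?_⟩, ?_, ?_⟩
  · exact OrdHypergraph.Hom.ext (funext fun _ => funext fun x => e.hom_inv x)
  · exact OrdHypergraph.Hom.ext (funext fun _ => funext fun x => e.inv_hom x)
  · exact OrdHypergraph.Hom.ext (funext fun _ => funext fun x => e.map_i x)
  · exact OrdHypergraph.Hom.ext (funext fun _ => funext fun x => e.map_j x)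

/-- The two inclusions are jointly surjective on faces; naturality and uniqueness of the comparison
are read off from this. -/
theorem tensor_hom_ext {X : TensorPair.{u} k} {Y : OrderedFS.{u}} {f g : X.tensorObj ⟶ Y}
    (h : X.inl ≫ f = X.inl ≫ g) (h' : X.inr ≫ f = X.inr ≫ g) : f = g :=
  tensorObj_hom_ext (fun l a => congrArg (fun f : X.fst.toOrd ⟶ Y.toOrd => f.map l a) h)
    fun l b => congrArg (fun f : X.snd.toOrd ⟶ Y.toOrd => f.map l b) h'

theorem inr_tensorMap {X Y : TensorPair.{u} k} (φ : X ⟶ Y) :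
    X.inr ≫ tensorMap φ = Hom.snd φ ≫ Y.inr := ((κ₁ k).naturality φ).symm

theorem tensorMap_naturality {e : ∀ X : TensorPair.{u} k, X.tensorObj ≅ G.obj X}
    (h₀ : ∀ X, X.inl ≫ (e X).hom = μ₀.app X) (h₁ : ∀ X, X.inr ≫ (e X).hom = μ₁.app X)
    {X Y : TensorPair.{u} k} (φ : X ⟶ Y) :
    tensorMap φ ≫ (e Y).hom = (e X).hom ≫ G.map φ := by
  refine tensor_hom_ext ?_ ?_
  · have h : X.inl ≫ tensorMap φ = Hom.fst φ ≫ Y.inl := rfl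
    rw [← Category.assoc, h, Category.assoc, h₀ Y, ← Category.assoc, h₀ X]
    exact μ₀.naturality φ
  · rw [← Category.assoc, inr_tensorMap, Category.assoc, h₁ Y, ← Category.assoc, h₁ X]
    exact μ₁.naturality φ

end uniqueness

end TensorPair

end FaceStr

theorem mainTheorem10 (k : ℕ) :
    ∃ (T : FaceStr.TensorPair.{u} k ⥤ FaceStr.OrderedFS.{u})
      (κ₀ : FaceStr.TensorPair.π₀.{u} k ⟶ T) (κ₁ : FaceStr.TensorPair.π₁.{u} k ⟶ T),
      (∀ X : FaceStr.TensorPair.{u} k, X.IsTensorSquare (κ₀.app X) (κ₁.app X)) ∧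
      ∀ (G : FaceStr.TensorPair.{u} k ⥤ FaceStr.OrderedFS.{u})
        (μ₀ : FaceStr.TensorPair.π₀.{u} k ⟶ G) (μ₁ : FaceStr.TensorPair.π₁.{u} k ⟶ G),
        (∀ X : FaceStr.TensorPair.{u} k, X.IsLocalPushoutSquare (μ₀.app X) (μ₁.app X)) →
        ∃! e : T ≅ G, κ₀ ≫ e.hom = μ₀ ∧ κ₁ ≫ e.hom = μ₁ := by
  refine ⟨FaceStr.TensorPair.tensor k, FaceStr.TensorPair.κ₀ k, FaceStr.TensorPair.κ₁ k,
    FaceStr.TensorPair.isTensorSquare, fun G μ₀ μ₁ hG => ?_⟩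
  -- No coherence is required of this choice: the two triangles determine each component.
  choose e h₀ h₁ using FaceStr.TensorPair.exists_iso hG
  refine ⟨NatIso.ofComponents e (FaceStr.TensorPair.tensorMap_naturality h₀ h₁), ⟨?_, ?_⟩, ?_⟩
  · ext X
    exact h₀ X
  · ext X
    exact h₁ X
  · rintro e' ⟨h₀', h₁'⟩
    ext X
    refine FaceStr.TensorPair.tensor_hom_ext ?_ ?_
    · exact (congrArg (fun f : _ ⟶ G => f.app X) h₀').trans (h₀ X).symm
    · exact (congrArg (fun f : _ ⟶ G => f.app X) h₁').trans (h₁ X).symm
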